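/- Let $\nu$ be the law of a random variable $\xi$ with values in a measurable space $\Xi$, let $f:\mathbb R^m\to\mathbb R$, $g:\mathbb R^n\times\Xi\to\mathbb R^m$, $h:\mathbb R^n\times\Xi\to\mathbb R^p$, $q:\mathbb R^p\to\mathbb R^J$, $R:\mathbb R^n\to\mathbb R\cup\{+\infty\}$ and $\mathcal X\subset\mathbb R^n$, and consider the problem $$(\mathcal P)\qquad \min_{x\in\mathcal X}\; f(\mathbb E\,g(x,\xi))+R(x)\quad\text{subject to}\quad q(\mathbb E\,h(x,\xi))\le 0 .$$ Write $F(x)=f(\mathbb E\,g(x,\xi))$, $Q(x)=q(\mathbb E\,h(x,\xi))$ and $H=F+R$. Assumptions. (i) $\mathcal X$ is compact and convex, and $F$ and all components $Q_j$ are convex on $\mathcal X$. (ii) $R$ is closed and convex, the constraint $x\in\mathcal X$ is included in $R$ (that is, $R=+\infty$ outside $\mathcal X$), and $R$ has bounded subgradients: for some $K$, at every point where $R$ is finite it has a subgradient of norm at most $K$. (iii) $f$ and $q$ are continuously differentiable with bounded and Lipschitz gradients. (iv) $g(x,\cdot)$ and $h(x,\cdot)$ are measurable for every $x$, $g(\cdot,s)$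 and $h(\cdot,s)$ are continuously differentiable for every $s$, and for $\phi\in\{g,h\}$: $\mathbb E\|\phi(x,\xi)\|^2$ is finite for all $x\in\mathbb R^n$ and bounded over $x\in\mathcal X$; $\mathbb E\|\phi(x,\xi)-\phi(x',\xi)\|^2\le L\|x-x'\|^2$ for all $x,x'\in\mathbb R^n$; and $x\mapsto\mathbb E\,\phi(x,\xi)$ is differentiable with Lipschitz derivative. (v) $F$ and $Q$ are differentiable with Lipschitz derivatives. (vi) $\xi_1,\xi_2,\dots$ are independent with law $\nu$. (vii) $x^\star$ is a solution of $(\mathcal P)$ with $R(x^\star)<\infty$. Let $C_\ell\ge0$ be an upper bound of $\max_jQ_j(x)$ over $x\in\mathcal X$, and let $\ell(w)=\sum_{j=1}^J\ell_j(w_j)$ with $\ell_j(u)=0$ for $u<0$, $\ell_j(u)=u^2/2$ for $0\le u\le C_\ell$, and $\ell_j(u)=C_\ell u-C_\ell^2/2$ for $u>C_\ell$. The ACSCPG algorithm starts from an arbitrary $x_1\in\mathbb R^n$ with $w_1=x_1$, $y_1=0$, $z_1=0$, and for $t=1,2,\dots$ sets $$x_{t+1}=\mathrm{prox}_{\alpha_tR}\big\{x_t-\alpha_t\nabla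 g(x_t,\xi_t)\nabla f(y_t)-\delta_t\nabla h(x_t,\xi_t)\nabla q(z_t)\nabla\ell(q(z_t))\big\},$$ $$w_{t+1}=\Big(1-\tfrac1{\beta_t}\Big)x_t+\tfrac1{\beta_t}x_{t+1},\quad y_{t+1}=(1-\beta_t)y_t+\beta_t\,g(w_{t+1},\xi_{t+1}),\quad z_{t+1}=(1-\beta_t)z_t+\beta_t\,h(w_{t+1},\xi_{t+1}),$$ where the gradient of a vector-valued map is the transpose of its Jacobian and $\mathrm{prox}_{\alpha R}(v)=\arg\min_u\{\alpha R(u)+\tfrac12\|u-v\|^2\}$. Its output $\hat x=\hat x_T$ is the average of the iterates $x_{t+1}$ over the integers $t$ with $T/2\le t\le T$. Theorem. Let $\alpha_t=Ct^{-a}$, $\beta_t=C_bt^{-b}$, $\delta_t=Ct^{-c}$ with $C>0$, $C_b>2$, $a,b,c\in[0,1]$ and $a\ge c$, and let $d,e$ be arbitrary real numbers (the exponents of the auxiliary sequences $\gamma_t=Ct^{-d}$ and $\eta_t=Ct^{-e}$, which do not enter the algorithm). Then $R(\hat x)<\infty$, $H(\hat x)$ and all $Q_j(\hat x)$ are integrable,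 and for all $T\ge1$, with constants in $\mathcal O$ that do not depend on $T$, $$\frac2T\sum_{T/2\le t\le T}\mathbb E[H(\hat x)-H(x^\star)]\le\mathcal O\Big(T^{a-1}+T^{d}+T^{4b-4c-d}+T^{-b-d}+T^{2a+4b-6c-d}+T^{2a-b-2c-d}+T^{-2a}+T^{-a-c}+T^{-e}+T^{2a-2c-e}+T^{e-2a}\Big),$$ $$\frac2T\sum_{T/2\le t\le T}\max_j\mathbb E[Q_j(\hat x)]\le\mathcal O\Big(T^{\frac{c-1}2}+T^{\frac{d+c-a}2}+T^{\frac{4b-3c-d-a}2}+T^{\frac{c-a-b-d}2}+T^{\frac{a+4b-5c-d}2}+T^{-a}+T^{\frac{a-b-c-d}2}+T^{\frac{-3a+c}2}+T^{\frac{c-a-e}2}+T^{\frac{a-c-e}2}+T^{\frac{e-3a+c}2}+T^{\frac{c-a}2}\Big).$$ (The summands on the left do not depend on $t$.) In particular, these two quantities are bounded by $\mathcal O(T^{-2/21})$ and $\mathcal O(T^{-2/21})$ for $(a,b,c)=(\tfrac{19}{21},\tfrac47,\tfrac57)$; by $\mathcal O(T^{-1/7})$ and $\mathcal O(T^{-1/14})$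 for $(a,b,c)=(\tfrac67,\tfrac47,\tfrac57)$; and by $\mathcal O(T^{-2/7})$ and $\mathcal O(1)$ for $(a,b,c)=(\tfrac57,\tfrac47,\tfrac57)$. -/

import Mathlib

open MeasureTheory ProbabilityTheory

/-- `ℝⁿ` with the Euclidean norm. -/
abbrev Eu (n : ℕ) : Type := EuclideanSpace ℝ (Fin n)

/-- `φ` is smooth in the sense of optimization: differentiable with (globally) Lipschitz
derivative. -/
def IsSmoothFun {n m : ℕ} (φ : Eu n → Eu m) : Prop :=
  Differentiable ℝ φ ∧ ∃ L : NNReal, LipschitzWith L (fderiv ℝ φ)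

/-- The same notion for real-valued functions. -/
def IsSmoothReal {n : ℕ} (φ : Eu n → ℝ) : Prop :=
  Differentiable ℝ φ ∧ ∃ L : NNReal, LipschitzWith L (fderiv ℝ φ)

/-- Data of the problem: minimize `f (E g(x, ξ)) + R x` over `x ∈ X`
subject to `q (E h(x, ξ)) ≤ 0`. The regularizer `R` is extended-real-valued. -/
structure CompProblem (n m p J : ℕ) (Ξ : Type*) where
  f : Eu m → ℝ
  g : Eu n → Ξ → Eu m
  h : Eu n → Ξ → Eu p
  q : Eu p → Eu J
  R : Eu n → EReal
  X : Set (Eu n)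

namespace CompProblem

variable {n m p J : ℕ} {Ξ : Type*} [MeasurableSpace Ξ]

/-- `E g(x, ξ)`, where `ν` is the law of `ξ`. -/
noncomputable def gbar (P : CompProblem n m p J Ξ) (ν : Measure Ξ) (x : Eu n) : Eu m :=
  ∫ s, P.g x s ∂ν

/-- `E h(x, ξ)`. -/
noncomputable def hbar (P : CompProblem n m p J Ξ) (ν : Measure Ξ) (x : Eu n) : Eu p :=
  ∫ s, P.h x s ∂ν

/-- `F(x) = f (E g(x, ξ))`. -/
noncomputable def F (P : CompProblem n m p J Ξ) (ν : Measure Ξ) (x : Eu n) : ℝ :=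
  P.f (P.gbar ν x)

/-- `Q(x) = q (E h(x, ξ))`. -/
noncomputable def Q (P : CompProblem n m p J Ξ) (ν : Measure Ξ) (x : Eu n) : Eu J :=
  P.q (P.hbar ν x)

/-- `H = F + R`, as a real number; it is only used at points where `R` is finite. -/
noncomputable def H (P : CompProblem n m p J Ξ) (ν : Measure Ξ) (x : Eu n) : ℝ :=
  P.F ν x + (P.R x).toReal

/-- `xs` is a (finite-valued) minimizer of the constrained problem. -/
def IsSolution (P : CompProblem n m p J Ξ) (ν : Measure Ξ) (xs : Eu n) : Prop :=
  xs ∈ P.X ∧ P.R xs ≠ ⊤ ∧ (∀ j, P.Q ν xs j ≤ 0) ∧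
    ∀ x ∈ P.X, (∀ j, P.Q ν x j ≤ 0) →
      ((P.F ν xs : ℝ) : EReal) + P.R xs ≤ ((P.F ν x : ℝ) : EReal) + P.R x

/-- Conditions on a random inner function `g`: it is measurable in the sample, `C¹` in `x`,
square integrable with second moments bounded on `X`, Lipschitz in expectation (in mean square),
and smooth in expectation (which is implied by smoothness of the sample functions with a
uniform constant). -/
structure InnerAssumptions {k : ℕ} (X : Set (Eu n)) (ν : Measure Ξ) (g : Eu n → Ξ → Eu k) :
    Prop where
  measurable : ∀ x, Measurable (g x)
  contDiff : ∀ s, ContDiff ℝ 1 (fun x => g x s)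
  memLp : ∀ x, MemLp (g x) 2 ν
  moment : ∃ V : ℝ, ∀ x ∈ X, ∫ s, ‖g x s‖ ^ 2 ∂ν ≤ V
  lipschitz : ∃ L : ℝ, ∀ x x', ∫ s, ‖g x s - g x' s‖ ^ 2 ∂ν ≤ L * ‖x - x'‖ ^ 2
  smooth : IsSmoothFun (fun x => ∫ s, g x s ∂ν)

/-- The standing assumptions on the problem. -/
structure Assumptions (P : CompProblem n m p J Ξ) (ν : Measure Ξ) : Prop where
  /- the set `X` -/
  X_compact : IsCompact P.X
  X_convex : Convex ℝ P.X
  /- `R : ℝⁿ → ℝ ∪ {+∞}` is closed and convex, the constraint `x ∈ X` is part of `R`, and `R`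
  has bounded subgradients on its effective domain -/
  R_ne_bot : ∀ x, P.R x ≠ ⊥
  R_closed : LowerSemicontinuous P.R
  R_convex : Convex ℝ {u : Eu n × ℝ | P.R u.1 ≤ ((u.2 : ℝ) : EReal)}
  R_dom : ∀ x, P.R x ≠ ⊤ → x ∈ P.X
  R_subgrad : ∃ K : ℝ, ∀ x, P.R x ≠ ⊤ → ∃ v : Eu n, ‖v‖ ≤ K ∧
    ∀ u, P.R x + ((inner ℝ v (u - x) : ℝ) : EReal) ≤ P.R u
  /- the outer functions are continuously differentiable and smooth, with bounded gradients -/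
  f_contDiff : ContDiff ℝ 1 P.f
  f_smooth : IsSmoothReal P.f
  f_bdd : ∃ K : ℝ, ∀ y, ‖fderiv ℝ P.f y‖ ≤ K
  q_contDiff : ContDiff ℝ 1 P.q
  q_smooth : IsSmoothFun P.q
  q_bdd : ∃ K : ℝ, ∀ z, ‖fderiv ℝ P.q z‖ ≤ K
  /- the inner functions -/
  g_inner : InnerAssumptions P.X ν P.g
  h_inner : InnerAssumptions P.X ν P.h
  /- the compositions are smooth, and the problem is convex -/
  F_smooth : IsSmoothReal (P.F ν)
  Q_smooth : IsSmoothFun (P.Q ν)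
  F_convex : ConvexOn ℝ P.X (P.F ν)
  Q_convex : ∀ j, ConvexOn ℝ P.X (fun x => P.Q ν x j)

end CompProblem

/-- The scalar penalty `ℓ_j` with parameter `Cl`. -/
noncomputable def huber (Cl x : ℝ) : ℝ :=
  if x < 0 then 0 else if x ≤ Cl then x ^ 2 / 2 else Cl * x - Cl ^ 2 / 2

/-- `ℓ(w) = ∑ⱼ ℓ_j(w_j)`. -/
noncomputable def penalty {J : ℕ} (Cl : ℝ) (w : Eu J) : ℝ :=
  ∑ j, huber Cl (w j)

/-- `prox_{αR}(v)`: the minimizer of `u ↦ α R(u) + ‖u - v‖² / 2`. -/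
noncomputable def prox {n : ℕ} (α : ℝ) (R : Eu n → EReal) (v : Eu n) : Eu n :=
  Classical.epsilon fun u : Eu n =>
    IsMinOn (fun u : Eu n => (α : EReal) * R u + ((‖u - v‖ ^ 2 / 2 : ℝ) : EReal)) Set.univ u

/-- The variables of the algorithm. -/
structure AlgState (n m p : ℕ) where
  x : Eu n
  w : Eu n
  y : Eu m
  z : Eu p

namespace CompProblem

variable {n m p J : ℕ} {Ξ : Type*} [MeasurableSpace Ξ]

/-- One iteration of the algorithm with step sizes `α`, `β`, `δ`; here `s = ξ_t` and
`s' = ξ_{t+1}`. The gradient of a vector-valued map is the transpose of its Jacobian. -/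
noncomputable def step (P : CompProblem n m p J Ξ) (Cl α β δ : ℝ) (s s' : Ξ)
    (S : AlgState n m p) : AlgState n m p :=
  let x' : Eu n := prox α P.R
    (S.x
      - α • (ContinuousLinearMap.adjoint (fderiv ℝ (fun x => P.g x s) S.x)) (gradient P.f S.y)
      - δ • (ContinuousLinearMap.adjoint (fderiv ℝ (fun x => P.h x s) S.x))
          ((ContinuousLinearMap.adjoint (fderiv ℝ P.q S.z)) (gradient (penalty Cl) (P.q S.z))))
  let w' : Eu n := (1 - 1 / β) • S.x + (1 / β) • x'
  { x := x'
    w := w'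
    y := (1 - β) • S.y + β • P.g w' s'
    z := (1 - β) • S.z + β • P.h w' s' }

/-- The state `(x_t, w_t, y_t, z_t)` of the algorithm along a sample sequence `ξ_1, ξ_2, …`,
for step size sequences `α`, `β`, `δ`, initialized at time `t = 1` with `x_1 = w_1 = x1` and
`y_1 = z_1 = 0`. (Time `0` is a dummy value and is not used.) -/
noncomputable def run (P : CompProblem n m p J Ξ) (Cl : ℝ) (α β δ : ℕ → ℝ) (x1 : Eu n)
    (ξ : ℕ → Ξ) : ℕ → AlgState n m p
  | 0 => { x := x1, w := x1, y := 0, z := 0 }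
  | 1 => { x := x1, w := x1, y := 0, z := 0 }
  | t + 2 => P.step Cl (α (t + 1)) (β (t + 1)) (δ (t + 1)) (ξ (t + 1)) (ξ (t + 2))
      (P.run Cl α β δ x1 ξ (t + 1))

/-- The output of the algorithm: the average of the iterates `x_{t+1}`, `T/2 ≤ t ≤ T`. -/
noncomputable def output (P : CompProblem n m p J Ξ) (Cl : ℝ) (α β δ : ℕ → ℝ) (x1 : Eu n)
    (ξ : ℕ → Ξ) (T : ℕ) : Eu n :=
  ((Finset.Icc ((T + 1) / 2) T).card : ℝ)⁻¹ •
    ∑ t ∈ Finset.Icc ((T + 1) / 2) T, (P.run Cl α β δ x1 ξ (t + 1)).x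

/-- The output for `α_t = C t^{-a}`, `β_t = C_b t^{-b}`, `δ_t = C t^{-c}`. -/
noncomputable def xhat (P : CompProblem n m p J Ξ) (Cl C Cb a b c : ℝ) (x1 : Eu n)
    (ξ : ℕ → Ξ) (T : ℕ) : Eu n :=
  P.output Cl (fun t => C * (t : ℝ) ^ (-a)) (fun t => Cb * (t : ℝ) ^ (-b))
    (fun t => C * (t : ℝ) ^ (-c)) x1 ξ T

/-- The output takes values in the set where `R` is finite, and the objective and the
constraint functions at the output are integrable. -/
def OutputRegular {Ω : Type*} [MeasurableSpace Ω] (P : CompProblem n m p J Ξ) (ν : Measure Ξ)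
    (μ : Measure Ω) (xh : ℕ → Ω → Eu n) : Prop :=
  ∀ T : ℕ, 1 ≤ T → (∀ ω, P.R (xh T ω) ≠ ⊤) ∧ Integrable (fun ω => P.H ν (xh T ω)) μ ∧
    ∀ j, Integrable (fun ω => P.Q ν (xh T ω) j) μ

/-- `(2/T) ∑_{t=T/2}^T E[H(x̂) - H(xs)]`. -/
noncomputable def optGap {Ω : Type*} [MeasurableSpace Ω] (P : CompProblem n m p J Ξ)
    (ν : Measure Ξ) (μ : Measure Ω) (xs : Eu n) (xh : ℕ → Ω → Eu n) (T : ℕ) : ℝ :=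
  2 / (T : ℝ) * ∑ _t ∈ Finset.Icc ((T + 1) / 2) T, ∫ ω, (P.H ν (xh T ω) - P.H ν xs) ∂μ

/-- `(2/T) ∑_{t=T/2}^T max_j E[Q_j(x̂)]`. -/
noncomputable def violation {Ω : Type*} [MeasurableSpace Ω] (P : CompProblem n m p J Ξ)
    (ν : Measure Ξ) (μ : Measure Ω) (xh : ℕ → Ω → Eu n) (T : ℕ) : ℝ :=
  2 / (T : ℝ) * ∑ _t ∈ Finset.Icc ((T + 1) / 2) T, ⨆ j, ∫ ω, P.Q ν (xh T ω) j ∂μ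

end CompProblem

/-- `u(T) ≤ O(r(T))`: an upper bound with a constant that does not depend on `T`. -/
def UpperO (u r : ℕ → ℝ) : Prop :=
  ∃ K : ℝ, ∀ T : ℕ, 1 ≤ T → u T ≤ K * r T

/-- The sum of powers of `T` bounding the optimality gap. -/
noncomputable def gapRate (a b c d e : ℝ) (T : ℕ) : ℝ :=
  (T : ℝ) ^ (a - 1) + (T : ℝ) ^ d + (T : ℝ) ^ (4 * b - 4 * c - d) + (T : ℝ) ^ (-b - d)
    + (T : ℝ) ^ (2 * a + 4 * b - 6 * c - d) + (T : ℝ) ^ (2 * a - b - 2 * c - d)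
    + (T : ℝ) ^ (-2 * a) + (T : ℝ) ^ (-a - c) + (T : ℝ) ^ (-e)
    + (T : ℝ) ^ (2 * a - 2 * c - e) + (T : ℝ) ^ (e - 2 * a)

/-- The sum of powers of `T` bounding the constraint violation. -/
noncomputable def violRate (a b c d e : ℝ) (T : ℕ) : ℝ :=
  (T : ℝ) ^ ((c - 1) / 2) + (T : ℝ) ^ ((d + c - a) / 2)
    + (T : ℝ) ^ ((4 * b - 3 * c - d - a) / 2) + (T : ℝ) ^ ((c - a - b - d) / 2)
    + (T : ℝ) ^ ((a + 4 * b - 5 * c - d) / 2) + (T : ℝ) ^ (-a)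
    + (T : ℝ) ^ ((a - b - c - d) / 2) + (T : ℝ) ^ ((-3 * a + c) / 2)
    + (T : ℝ) ^ ((c - a - e) / 2) + (T : ℝ) ^ ((a - c - e) / 2)
    + (T : ℝ) ^ ((e - 3 * a + c) / 2) + (T : ℝ) ^ ((c - a) / 2)

/-! The scheme is a proximal gradient method for `H` plus a penalty on the constraints, with penalty
weight `δ t / α t`. In the chain rule the unknown means of `g` and `h` are replaced by the running
averages `y`, `z`. Everything is compared with the solution `xs` through V_t = E‖x_t - xs‖².

Tracking. The outer gradients are bounded and the sampled Jacobians have bounded second moments, so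
E‖x_{t+1} - x_t‖² = O(δ_t²), because `c ≤ a` makes δ_t the larger step. Split y_t - E g(x_t) at ȳ_t,
the running average of the exact means at the points w_t. Since x_{t+1} is the combination of x_t
and w_{t+1} with weight β_t, a smooth mean is affine up to O(‖x_{t+1} - x_t‖² / β_t), and
contraction by 1 - β_t makes the L¹ bias O(t^{-(2c-2b)}); this needs C_b > 2 ≥ 2c - 2b. The noise
y_t - ȳ_t is driven by centred increments and has second moment O(t^{-b}). Together they give the
rate ρ_t = t^{-(2c-2b)} + t^{-b/2}.

Decoupling. Both y_t and the sampled Jacobian at time t involve ξ_t, so conditioning on the past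
does not factor their product. The bias is determined before ξ_t and does factor; the noise is split
off by Young's inequality (`exists_integral_inner_fderiv_ge`).

Descent (`exists_expected_descent`). Convexity and the proximal inequality give 2α_t E[H(x_{t+1}) -
H(xs)] + 2δ_t E ℓ(Q(x_{t+1})) ≤ V_t - V_{t+1} + O(δ_t ρ_t). Dividing by 2α_t, dropping the penalty
and averaging over the window yields the gap T^{a-1} + T^{a-c} ρ_T. Dividing by 2δ_t and using that
H is bounded yields T^{c-1} + ρ_T + T^{c-a} for the penalty. As Q_j ≤ C_ℓ on X, the penalty there is
half the squared positive part, so the violation is of the order of the square root. Jensen's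
inequality passes to the averaged output.

Exponents. Each exponent of these reduced rates occurs in the stated bounds or is the midpoint of
two of theirs, whatever d is. If b = 0 or b > c, the reduced rates are at least 1 and compactness
suffices. -/

section Taylor

/-! ### Taylor estimates for smooth and convex maps -/

theorem norm_sub_sub_fderiv_le {E F : Type*} [NormedAddCommGroup E] [NormedSpace ℝ E]
    [NormedAddCommGroup F] [NormedSpace ℝ F] {φ : E → F} {L : NNReal}
    (hd : Differentiable ℝ φ) (hL : LipschitzWith L (fderiv ℝ φ)) (x y : E) :
    ‖φ y - φ x - fderiv ℝ φ x (y - x)‖ ≤ L * ‖y - x‖ ^ 2 := by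
  have h := (convex_closedBall x ‖y - x‖).norm_image_sub_le_of_norm_fderiv_le' (𝕜 := ℝ) (f := φ)
    (φ := fderiv ℝ φ x) (C := L * ‖y - x‖) (x := x) (y := y) (fun z _ => hd z) ?_ ?_ ?_
  · calc _ ≤ _ := h
      _ = _ := by ring
  · intro z hz
    have h1 := hL.norm_sub_le z x
    have h2 : ‖z - x‖ ≤ ‖y - x‖ := by simpa [dist_eq_norm] using hz
    exact h1.trans (mul_le_mul_of_nonneg_left h2 L.2)
  · simp
  · simp [dist_eq_norm]

/-- The defect of affinity of a smooth map along a segment. -/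
theorem norm_segment_defect_le {E F : Type*} [NormedAddCommGroup E] [NormedSpace ℝ E]
    [NormedAddCommGroup F] [NormedSpace ℝ F] {φ : E → F} {L : NNReal}
    (hd : Differentiable ℝ φ) (hL : LipschitzWith L (fderiv ℝ φ)) (x w : E) {β : ℝ}
    (h0 : 0 ≤ β) (h1 : β ≤ 1) :
    ‖(1 - β) • φ x + β • φ w - φ ((1 - β) • x + β • w)‖ ≤ L * β * ‖w - x‖ ^ 2 := by
  set u := (1 - β) • x + β • w with hu
  have e1 : x - u = (-β) • (w - x) := by rw [hu]; module
  have e2 : w - u = (1 - β) • (w - x) := by rw [hu]; module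
  -- Expanding at the intermediate point cancels the first-order terms, since the weighted
  -- displacements sum to zero.
  have key : (1 - β) • φ x + β • φ w - φ u
      = (1 - β) • (φ x - φ u - fderiv ℝ φ u (x - u))
        + β • (φ w - φ u - fderiv ℝ φ u (w - u)) := by
    rw [e1, e2, map_smul, map_smul]; module
  have n1 := norm_sub_sub_fderiv_le hd hL u x
  have n2 := norm_sub_sub_fderiv_le hd hL u w
  rw [e1, norm_smul, norm_neg, Real.norm_of_nonneg h0] at n1
  rw [e2, norm_smul, Real.norm_of_nonneg (by linarith : (0:ℝ) ≤ 1 - β)] at n2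
  rw [key, e1, e2]
  calc _ ≤ ‖(1 - β) • (φ x - φ u - fderiv ℝ φ u (-β • (w - x)))‖
        + ‖β • (φ w - φ u - fderiv ℝ φ u ((1 - β) • (w - x)))‖ := norm_add_le _ _
    _ = (1 - β) * ‖φ x - φ u - fderiv ℝ φ u (-β • (w - x))‖
        + β * ‖φ w - φ u - fderiv ℝ φ u ((1 - β) • (w - x))‖ := by
        rw [norm_smul, norm_smul, Real.norm_of_nonneg h0,
          Real.norm_of_nonneg (by linarith : (0:ℝ) ≤ 1 - β)]
    _ ≤ (1 - β) * (L * (β * ‖w - x‖) ^ 2) + β * (L * ((1 - β) * ‖w - x‖) ^ 2) := by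
        gcongr
    -- (1 - β)β² + β(1 - β)² = β - β². Keeping one factor β is essential: with w - x = (x_{t+1} -
    -- x_t)/β the defect is ‖x_{t+1} - x_t‖²/β.
    _ = L * β * ‖w - x‖ ^ 2 - L * β ^ 2 * ‖w - x‖ ^ 2 := by ring
    _ ≤ _ := by
        have : 0 ≤ (L : ℝ) * β ^ 2 * ‖w - x‖ ^ 2 := by positivity
        linarith

/-- Along the segment from `x` to `u`, which stays in `X`, the derivative at 0 is at most the slope
over [0, 1]. -/
theorem ConvexOn.add_fderiv_le {E : Type*} [NormedAddCommGroup E] [NormedSpace ℝ E]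
    {X : Set E} {f : E → ℝ} (hf : ConvexOn ℝ X f) {x u : E} (hx : x ∈ X) (hu : u ∈ X)
    (hd : DifferentiableAt ℝ f x) : f x + fderiv ℝ f x (u - x) ≤ f u := by
  have hline : HasDerivAt (fun s : ℝ => f (x + s • (u - x))) (fderiv ℝ f x (u - x)) 0 := by
    have h1 : HasDerivAt (fun s : ℝ => x + s • (u - x)) (u - x) 0 := by
      simpa using ((hasDerivAt_id (0:ℝ)).smul_const (u - x)).const_add x
    have h2 : HasFDerivAt f (fderiv ℝ f x) (x + (0:ℝ) • (u - x)) := by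
      simpa using hd.hasFDerivAt
    exact h2.comp_hasDerivAt (0:ℝ) h1
  have hconv : ConvexOn ℝ (Set.Icc (0:ℝ) 1) (fun s : ℝ => f (x + s • (u - x))) := by
    refine ⟨convex_Icc 0 1, ?_⟩
    intro s hs t ht a b ha hb hab
    have hm : ∀ s ∈ Set.Icc (0:ℝ) 1, x + s • (u - x) ∈ X := by
      intro s hs
      have := hf.1 hx hu (by linarith [hs.2] : (0:ℝ) ≤ 1 - s) hs.1 (by ring)
      convert this using 1
      module
    have := hf.2 (hm s hs) (hm t ht) ha hb hab
    refine le_trans (le_of_eq ?_) this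
    simp only [smul_eq_mul]
    congr 1
    have : x = (a + b) • x := by rw [hab, one_smul]
    calc _ = (a + b) • x + (a * s + b * t) • (u - x) := by rw [← this]
      _ = _ := by module
  have h := hconv.le_slope_of_hasDerivAt (x := 0) (y := 1) (by simp) (by simp) one_pos hline
  simp [slope_def_field] at h
  rw [map_sub]
  linarith

end Taylor

/-! ### The penalty and its gradient -/

section Huber

/-- Projection of the real line onto `[0, Cl]`. -/
noncomputable def clip (Cl x : ℝ) : ℝ := max 0 (min x Cl)

theorem clip_nonneg (Cl x : ℝ) : 0 ≤ clip Cl x := le_max_left _ _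

theorem clip_le {Cl : ℝ} (h : 0 ≤ Cl) (x : ℝ) : clip Cl x ≤ Cl := max_le h (min_le_right _ _)

theorem abs_clip_sub_le (Cl x y : ℝ) : |clip Cl x - clip Cl y| ≤ |x - y| := by
  unfold clip
  calc _ ≤ |min x Cl - min y Cl| := by
        simpa using abs_max_sub_max_le_max 0 (min x Cl) 0 (min y Cl)
    _ ≤ _ := by simpa using abs_min_sub_min_le_max x Cl y Cl

/-- The penalty is a conjugate: it is the maximum of u x - u²/2 over u in [0, Cl], attained at the
projection of x. This form replaces case distinctions below. -/
theorem huber_eq_clip {Cl : ℝ} (h : 0 ≤ Cl) (x : ℝ) :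
    huber Cl x = clip Cl x * x - clip Cl x ^ 2 / 2 := by
  unfold huber clip
  split_ifs with h1 h2
  · rw [min_eq_left (by linarith), max_eq_left h1.le]; ring
  · rw [min_eq_left h2, max_eq_right (by linarith)]; ring
  · rw [min_eq_right (by linarith), max_eq_right h]

theorem huber_nonneg {Cl : ℝ} (h : 0 ≤ Cl) (x : ℝ) : 0 ≤ huber Cl x := by
  unfold huber
  split_ifs with h1 h2
  · rfl
  · positivity
  · nlinarith

theorem huber_of_le {Cl x : ℝ} (h : x ≤ Cl) : huber Cl x = max x 0 ^ 2 / 2 := by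
  unfold huber
  split_ifs with h1
  · rw [max_eq_right h1.le]; ring
  · rw [max_eq_left (by linarith)]

/-- The maximizer u for x gives an affine minorant of the maximum that touches it at x, which is a
subgradient inequality with slope `clip Cl x`. -/
theorem huber_add_clip_mul_le {Cl : ℝ} (h : 0 ≤ Cl) (x y : ℝ) :
    huber Cl x + clip Cl x * (y - x) ≤ huber Cl y := by
  have key : ∀ u, 0 ≤ u → u ≤ Cl → u * y - u ^ 2 / 2 ≤ huber Cl y := by
    intro u h0 h1
    unfold huber
    split_ifs with h2 h3
    · nlinarith
    · nlinarith [sq_nonneg (u - y)]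
    · nlinarith
  have := key (clip Cl x) (clip_nonneg _ _) (clip_le h x)
  rw [huber_eq_clip h x]
  linarith

/-- The gradient of the penalty. -/
noncomputable def clipVec {J : ℕ} (Cl : ℝ) (w : Eu J) : Eu J :=
  WithLp.toLp 2 fun j => clip Cl (w j)

@[simp] theorem clipVec_apply {J : ℕ} (Cl : ℝ) (w : Eu J) (j : Fin J) :
    clipVec Cl w j = clip Cl (w j) := rfl

theorem inner_eq_sum {J : ℕ} (v w : Eu J) : inner ℝ v w = ∑ j, v j * w j := by
  simp [PiLp.inner_apply, mul_comm]

theorem norm_clipVec_sub_le {J : ℕ} (Cl : ℝ) (v w : Eu J) :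
    ‖clipVec Cl v - clipVec Cl w‖ ≤ ‖v - w‖ := by
  rw [EuclideanSpace.norm_eq, EuclideanSpace.norm_eq]
  apply Real.sqrt_le_sqrt
  apply Finset.sum_le_sum
  intro j _
  have := abs_clip_sub_le Cl (v j) (w j)
  simp only [PiLp.sub_apply, clipVec_apply, Real.norm_eq_abs]
  gcongr

theorem norm_clipVec_le {J : ℕ} {Cl : ℝ} (h : 0 ≤ Cl) (v : Eu J) :
    ‖clipVec Cl v‖ ≤ √(J * Cl ^ 2) := by
  rw [EuclideanSpace.norm_eq]
  apply Real.sqrt_le_sqrt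
  calc _ ≤ ∑ _j : Fin J, Cl ^ 2 := by
        apply Finset.sum_le_sum
        intro j _
        rw [clipVec_apply, Real.norm_of_nonneg (clip_nonneg _ _)]
        have := clip_le h (v j)
        have := clip_nonneg Cl (v j)
        gcongr
    _ = _ := by simp

theorem penalty_add_inner_le {J : ℕ} {Cl : ℝ} (h : 0 ≤ Cl) (v w : Eu J) :
    penalty Cl v + inner ℝ (clipVec Cl v) (w - v) ≤ penalty Cl w := by
  unfold penalty
  rw [inner_eq_sum, ← Finset.sum_add_distrib]
  exact Finset.sum_le_sum fun j _ => huber_add_clip_mul_le h (v j) (w j)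

theorem penalty_nonneg {J : ℕ} {Cl : ℝ} (h : 0 ≤ Cl) (v : Eu J) : 0 ≤ penalty Cl v :=
  Finset.sum_nonneg fun _ _ => huber_nonneg h _

theorem abs_penalty_sub_le {J : ℕ} {Cl : ℝ} (h : 0 ≤ Cl) (v w : Eu J) :
    |penalty Cl v - penalty Cl w| ≤ √(J * Cl ^ 2) * ‖v - w‖ := by
  have aux : ∀ v w : Eu J, penalty Cl v - penalty Cl w ≤ √(J * Cl ^ 2) * ‖v - w‖ := by
    intro v w
    have h1 := penalty_add_inner_le h v w
    have h2 : -inner ℝ (clipVec Cl v) (w - v) ≤ √(J * Cl ^ 2) * ‖v - w‖ := by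
      rw [← inner_neg_right, neg_sub]
      exact (real_inner_le_norm _ _).trans
        (mul_le_mul_of_nonneg_right (norm_clipVec_le h v) (norm_nonneg _))
    linarith
  rw [abs_le]
  constructor
  · have := aux w v
    rw [norm_sub_rev] at this
    linarith
  · exact aux v w

/-- The subgradient inequalities at both ends, with the 1-Lipschitz dependence of `clipVec`, squeeze
the first-order remainder between 0 and ‖w - v‖², so the break points need no separate treatment. -/
theorem hasGradientAt_penalty {J : ℕ} {Cl : ℝ} (h : 0 ≤ Cl) (v : Eu J) :
    HasGradientAt (penalty Cl) (clipVec Cl v) v := by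
  rw [hasGradientAt_iff_isLittleO]
  have hO : (fun w => penalty Cl w - penalty Cl v - inner ℝ (clipVec Cl v) (w - v))
      =O[nhds v] fun w => ‖w - v‖ ^ 2 := by
    refine Asymptotics.IsBigO.of_bound 1 (Filter.Eventually.of_forall fun w => ?_)
    have h1 := penalty_add_inner_le h v w
    have h2 := penalty_add_inner_le h w v
    have h3 : inner ℝ (clipVec Cl w - clipVec Cl v) (w - v) ≤ ‖w - v‖ * ‖w - v‖ :=
      (real_inner_le_norm _ _).trans
        (mul_le_mul_of_nonneg_right (norm_clipVec_sub_le _ _ _) (norm_nonneg _))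
    rw [inner_sub_left] at h3
    have h4 : inner ℝ (clipVec Cl w) (v - w) = - inner ℝ (clipVec Cl w) (w - v) := by
      rw [← inner_neg_right, neg_sub]
    rw [Real.norm_of_nonneg (by linarith), Real.norm_of_nonneg (by positivity)]
    nlinarith
  refine hO.trans_isLittleO ?_
  have := (Asymptotics.isLittleO_pow_sub_sub v (m := 2) (by norm_num))
  exact (Asymptotics.isLittleO_norm_right.1 (by simpa using this))

theorem gradient_penalty {J : ℕ} {Cl : ℝ} (h : 0 ≤ Cl) (v : Eu J) :
    gradient (penalty Cl) v = clipVec Cl v := (hasGradientAt_penalty h v).gradient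

/-- Descent property of the penalized constraint at a feasible point. -/
theorem penalty_le_inner_clipVec {n J : ℕ} {Cl : ℝ} (h : 0 ≤ Cl) {X : Set (Eu n)}
    {Q : Eu n → Eu J} (hQ : Differentiable ℝ Q) (hc : ∀ j, ConvexOn ℝ X fun x => Q x j)
    {x u : Eu n} (hx : x ∈ X) (hu : u ∈ X) (hfeas : ∀ j, Q u j ≤ 0) :
    penalty Cl (Q x) ≤ inner ℝ (clipVec Cl (Q x)) (fderiv ℝ Q x (x - u)) := by
  rw [inner_eq_sum]
  unfold penalty
  apply Finset.sum_le_sum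
  intro j _
  have hd : HasFDerivAt (fun x => Q x j)
      ((EuclideanSpace.proj j : Eu J →L[ℝ] ℝ).comp (fderiv ℝ Q x)) x :=
    (EuclideanSpace.proj j : Eu J →L[ℝ] ℝ).hasFDerivAt.comp x (hQ x).hasFDerivAt
  have h1 := (hc j).add_fderiv_le hx hu hd.differentiableAt
  rw [hd.fderiv] at h1
  have h2 : ((EuclideanSpace.proj j : Eu J →L[ℝ] ℝ).comp (fderiv ℝ Q x)) (u - x)
      = - (fderiv ℝ Q x (x - u)) j := by
    rw [← neg_sub x u, map_neg]; simp
  rw [h2] at h1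
  have h3 := hfeas j
  -- The penalty is at most clip · Q_j(x). Convexity and Q_j(u) ≤ 0 bound Q_j(x) by the directional
  -- derivative, and the factor clip is nonnegative.
  rw [huber_eq_clip h, clipVec_apply]
  have h4 := clip_nonneg Cl (Q x j)
  nlinarith [sq_nonneg (clip Cl (Q x j)), mul_le_mul_of_nonneg_left (by linarith : Q x j ≤ (fderiv ℝ Q x (x - u)) j) h4]

end Huber

/-! ### Scalar recursions and summation by parts -/

section Sequences

/-- A sequence contracting at rate `B t ^ (-b)` with a forcing term `K t ^ (-b - r)` is
`O(t ^ (-r))`. -/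
theorem exists_rpow_bound_of_recursion {e : ℕ → ℝ} {b r B K : ℝ} {t₀ : ℕ} (ht₀ : 1 ≤ t₀)
    (hb0 : 0 < b) (hb1 : b ≤ 1) (hr : 0 ≤ r) (hrB : r < B) (hK : 0 ≤ K)
    (hrec : ∀ t ≥ t₀, B * (t : ℝ) ^ (-b) ≤ 1 →
      e (t + 1) ≤ (1 - B * (t : ℝ) ^ (-b)) * e t + K * (t : ℝ) ^ (-b - r)) :
    ∃ K', 0 ≤ K' ∧ ∀ t ≥ t₀, e t ≤ K' * (t : ℝ) ^ (-r) := by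
  have hlim : Filter.Tendsto (fun t : ℕ => B * (t : ℝ) ^ (-b)) Filter.atTop (nhds 0) := by
    have := ((tendsto_rpow_neg_atTop hb0).comp tendsto_natCast_atTop_atTop).const_mul B
    simpa using this
  obtain ⟨t₁, ht₁⟩ := Filter.eventually_atTop.1 (hlim.eventually_le_const (zero_lt_one))
  set s := max t₀ t₁ with hs
  obtain ⟨M, hM⟩ := ((Finset.Icc t₀ s).image fun t => e t * (t : ℝ) ^ r).exists_le
  -- `M` covers the finitely many times before β falls below 1. The other entry ensures K ≤ K'(B -
  -- r): what is left of the contraction after paying for the decay of t^{-r} absorbs the forcing.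
  set K' := max M (K / (B - r)) with hK'
  have hBr : 0 < B - r := by linarith
  have hK'0 : 0 ≤ K' := le_max_of_le_right (by positivity)
  refine ⟨K', hK'0, ?_⟩
  have small : ∀ t ∈ Finset.Icc t₀ s, e t ≤ K' * (t : ℝ) ^ (-r) := by
    intro t ht
    have ht0 : (0:ℝ) < t := by
      have := (Finset.mem_Icc.1 ht).1
      exact_mod_cast (by omega : 0 < t)
    have h1 : e t * (t : ℝ) ^ r ≤ K' := (hM _ (Finset.mem_image_of_mem _ ht)).trans (le_max_left _ _)
    calc e t = (e t * (t : ℝ) ^ r) * (t : ℝ) ^ (-r) := by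
          rw [mul_assoc, ← Real.rpow_add ht0, add_neg_cancel, Real.rpow_zero, mul_one]
      _ ≤ _ := by gcongr
  have large : ∀ t ≥ s, e t ≤ K' * (t : ℝ) ^ (-r) := by
    intro t ht
    induction t, ht using Nat.le_induction with
    | base => exact small s (by simp [hs])
    | succ t ht ih =>
      have ht0' : 1 ≤ t := by omega
      have ht0 : (0:ℝ) < t := by exact_mod_cast ht0'
      have ht1 : (1:ℝ) ≤ t := by exact_mod_cast ht0'
      have hβ := ht₁ t (by omega)
      have h1 := hrec t (by omega) hβ
      -- The decay of t^{-r} over one step: both sides are compared through exp(-r/t).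
      have h2 : (1 - r / t) * (t : ℝ) ^ (-r) ≤ ((t + 1 : ℕ) : ℝ) ^ (-r) := by
        push_cast
        have e1 : (t : ℝ) + 1 = t * (1 + 1 / t) := by field_simp
        rw [e1, Real.mul_rpow ht0.le (by positivity), mul_comm]
        gcongr
        have h3 : (1 + 1 / (t : ℝ)) ≤ Real.exp (1 / t) := by
          have := Real.add_one_le_exp (1 / (t : ℝ)); linarith
        calc 1 - r / t ≤ Real.exp (-(r / t)) := by
              have := Real.add_one_le_exp (-(r / (t : ℝ))); linarith
          _ = Real.exp (1 / t) ^ (-r) := by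
              rw [← Real.exp_mul]; congr 1; ring
          _ ≤ _ := Real.rpow_le_rpow_of_nonpos (by positivity) h3 (by linarith)
      -- Here b ≤ 1 enters: the loss r/t is at most r t^{-b}, a part of the contraction.
      have h4 : (t : ℝ) ^ (-(1:ℝ)) ≤ (t : ℝ) ^ (-b) :=
        Real.rpow_le_rpow_of_exponent_le ht1 (by linarith)
      rw [Real.rpow_neg_one] at h4
      have h5 : K ≤ K' * (B - r) := by
        rw [← div_le_iff₀ hBr]; exact le_max_right _ _
      set p := (t : ℝ) ^ (-b) with hp
      set ρ := (t : ℝ) ^ (-r) with hρ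
      have hp0 : 0 ≤ p := by positivity
      have hρ0 : 0 ≤ ρ := by positivity
      have h6 : (t : ℝ) ^ (-b - r) = p * ρ := by
        rw [hp, hρ, ← Real.rpow_add ht0]; congr 1
      rw [h6] at h1
      calc e (t + 1) ≤ (1 - B * p) * e t + K * (p * ρ) := h1
        _ ≤ (1 - B * p) * (K' * ρ) + (K' * (B - r)) * (p * ρ) := by
            gcongr
        _ = K' * ((1 - r * p) * ρ) := by ring
        _ ≤ K' * ((1 - r / t) * ρ) := by
            gcongr
            rw [div_eq_mul_inv]
            gcongr
        _ ≤ _ := by gcongr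
  intro t ht
  rcases le_total s t with h | h
  · exact large t h
  · exact small t (Finset.mem_Icc.2 ⟨ht, h⟩)

/-- Summation by parts as an induction: raising the weight from c_T to c_{T+1} costs (c_{T+1} -
c_T)(D - V_{T+1}), which is nonnegative. -/
theorem sum_mul_sub_le_of_monotone {c V : ℕ → ℝ} {D : ℝ} {m : ℕ}
    (hc0 : 0 ≤ c m) (hc : ∀ t ≥ m, c t ≤ c (t + 1)) (hV : ∀ t ≥ m, V t ≤ D) :
    ∀ T ≥ m, ∑ t ∈ Finset.Icc m T, c t * (V t - V (t + 1)) ≤ c T * (D - V (T + 1)) := by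
  intro T hT
  induction T, hT using Nat.le_induction with
  | base =>
    simp only [Finset.Icc_self, Finset.sum_singleton]
    nlinarith [hV m le_rfl]
  | succ T hT ih =>
    rw [Finset.sum_Icc_succ_top (by omega)]
    have h1 := hc T hT
    have h2 := hV (T + 1) (by omega)
    nlinarith

end Sequences

/-! ### The regularizer and its proximal map -/

namespace CompProblem

section Regularizer

variable {n m p J : ℕ} {Ξ : Type*} [MeasurableSpace Ξ]

/-- The effective domain of the regularizer. -/
def dom (P : CompProblem n m p J Ξ) : Set (Eu n) := {x | P.R x ≠ ⊤}

/-- The regularizer as a real-valued function, meaningful on `P.dom`. -/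
noncomputable def r (P : CompProblem n m p J Ξ) (x : Eu n) : ℝ := (P.R x).toReal

variable {P : CompProblem n m p J Ξ} {ν : Measure Ξ}

namespace Assumptions

theorem coe_r (hP : P.Assumptions ν) {x : Eu n} (hx : x ∈ P.dom) :
    ((P.r x : ℝ) : EReal) = P.R x :=
  EReal.coe_toReal hx (hP.R_ne_bot x)

theorem dom_subset (hP : P.Assumptions ν) : P.dom ⊆ P.X := fun x hx => hP.R_dom x hx

theorem exists_r_subgradient (hP : P.Assumptions ν) :
    ∃ K : ℝ, 0 ≤ K ∧ ∀ x ∈ P.dom, ∃ v : Eu n, ‖v‖ ≤ K ∧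
      ∀ u ∈ P.dom, P.r x + inner ℝ v (u - x) ≤ P.r u := by
  obtain ⟨K, hK⟩ := hP.R_subgrad
  refine ⟨max K 0, le_max_right _ _, fun x hx => ?_⟩
  obtain ⟨v, hv, h⟩ := hK x hx
  refine ⟨v, hv.trans (le_max_left _ _), fun u hu => ?_⟩
  have := h u
  rw [← hP.coe_r hx, ← hP.coe_r hu] at this
  exact_mod_cast this

theorem exists_r_lipschitz (hP : P.Assumptions ν) :
    ∃ K : ℝ, 0 ≤ K ∧ ∀ x ∈ P.dom, ∀ u ∈ P.dom, |P.r x - P.r u| ≤ K * ‖x - u‖ := by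
  obtain ⟨K, hK0, hK⟩ := hP.exists_r_subgradient
  have aux : ∀ x ∈ P.dom, ∀ u ∈ P.dom, P.r x - P.r u ≤ K * ‖x - u‖ := by
    intro x hx u hu
    obtain ⟨v, hv, h⟩ := hK x hx
    have h1 := h u hu
    have h2 : -inner ℝ v (u - x) ≤ K * ‖x - u‖ := by
      rw [← inner_neg_right, neg_sub]
      exact (real_inner_le_norm _ _).trans (mul_le_mul_of_nonneg_right hv (norm_nonneg _))
    linarith
  refine ⟨K, hK0, fun x hx u hu => abs_le.2 ⟨?_, aux x hx u hu⟩⟩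
  have := aux u hu x hx
  rw [norm_sub_rev] at this
  linarith

theorem r_convexOn (hP : P.Assumptions ν) : ConvexOn ℝ P.dom P.r := by
  have key : ∀ x ∈ P.dom, ∀ y ∈ P.dom, ∀ a b : ℝ, 0 ≤ a → 0 ≤ b → a + b = 1 →
      P.R (a • x + b • y) ≤ ((a * P.r x + b * P.r y : ℝ) : EReal) := by
    intro x hx y hy a b ha hb hab
    have h1 : (x, P.r x) ∈ {u : Eu n × ℝ | P.R u.1 ≤ ((u.2 : ℝ) : EReal)} := (hP.coe_r hx).ge
    have h2 : (y, P.r y) ∈ {u : Eu n × ℝ | P.R u.1 ≤ ((u.2 : ℝ) : EReal)} := (hP.coe_r hy).ge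
    exact hP.R_convex h1 h2 ha hb hab
  have hc : Convex ℝ P.dom := by
    intro x hx y hy a b ha hb hab
    exact ((key x hx y hy a b ha hb hab).trans_lt (EReal.coe_lt_top _)).ne
  refine ⟨hc, fun x hx y hy a b ha hb hab => ?_⟩
  have := key x hx y hy a b ha hb hab
  rw [← hP.coe_r (hc hx hy ha hb hab)] at this
  exact_mod_cast this

/-- Bounded subgradients make `r` Lipschitz, hence bounded on the domain. The domain is thus a
sublevel set of a lower semicontinuous function and closed in the compact `X`. -/
theorem isCompact_dom (hP : P.Assumptions ν) : IsCompact P.dom := by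
  obtain ⟨K, hK0, hK⟩ := hP.exists_r_lipschitz
  rcases P.dom.eq_empty_or_nonempty with h | ⟨x, hx⟩
  · rw [h]; exact isCompact_empty
  · obtain ⟨D, hD⟩ := Metric.isBounded_iff.1 hP.X_compact.isBounded
    have : P.dom = P.R ⁻¹' Set.Iic ((P.r x + K * D : ℝ) : EReal) := by
      ext u
      constructor
      · intro hu
        rw [Set.mem_preimage, Set.mem_Iic, ← hP.coe_r hu]
        have h1 := (abs_le.1 (hK u hu x hx)).2
        have h2 := hD (hP.dom_subset hu) (hP.dom_subset hx)
        rw [dist_eq_norm] at h2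
        have h3 : K * ‖u - x‖ ≤ K * D := mul_le_mul_of_nonneg_left h2 hK0
        exact_mod_cast (by linarith : P.r u ≤ P.r x + K * D)
      · intro hu
        exact ((Set.mem_Iic.1 hu).trans_lt (EReal.coe_lt_top _)).ne
    refine hP.X_compact.of_isClosed_subset ?_ hP.dom_subset
    rw [this]
    exact hP.R_closed.isClosed_preimage _

theorem continuousOn_r (hP : P.Assumptions ν) : ContinuousOn P.r P.dom := by
  obtain ⟨K, hK0, hK⟩ := hP.exists_r_lipschitz
  have : LipschitzOnWith ⟨K, hK0⟩ P.r P.dom := by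
    refine LipschitzOnWith.of_dist_le_mul fun x hx y hy => ?_
    rw [Real.dist_eq, dist_eq_norm]
    exact hK x hx y hy
  exact this.continuousOn

/-- Since `prox` is a choice, its minimizing property rests on existence of a minimizer: a
continuous function attains its minimum on the compact domain, and off the domain the objective is
`⊤`. -/
theorem prox_isMinOn (hP : P.Assumptions ν) (hne : P.dom.Nonempty) {α : ℝ} (hα : 0 < α)
    (v : Eu n) :
    prox α P.R v ∈ P.dom ∧
      ∀ u ∈ P.dom, α * P.r (prox α P.R v) + ‖prox α P.R v - v‖ ^ 2 / 2
        ≤ α * P.r u + ‖u - v‖ ^ 2 / 2 := by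
  have hval : ∀ u ∈ P.dom, (α : EReal) * P.R u + ((‖u - v‖ ^ 2 / 2 : ℝ) : EReal)
      = ((α * P.r u + ‖u - v‖ ^ 2 / 2 : ℝ) : EReal) := by
    intro u hu
    rw [← hP.coe_r hu]; push_cast; rfl
  have htop : ∀ u ∉ P.dom, (α : EReal) * P.R u + ((‖u - v‖ ^ 2 / 2 : ℝ) : EReal) = ⊤ := by
    intro u hu
    have : P.R u = ⊤ := by simpa [dom] using hu
    rw [this, EReal.coe_mul_top_of_pos hα, EReal.top_add_coe]
  have hex : ∃ u, IsMinOn (fun u : Eu n => (α : EReal) * P.R u + ((‖u - v‖ ^ 2 / 2 : ℝ) : EReal))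
      Set.univ u := by
    obtain ⟨u, hu, hmin⟩ := hP.isCompact_dom.exists_isMinOn hne
      (f := fun u => α * P.r u + ‖u - v‖ ^ 2 / 2)
      ((hP.continuousOn_r.const_smul α).add (by fun_prop))
    refine ⟨u, fun w _ => ?_⟩
    by_cases hw : w ∈ P.dom
    · simp only [Set.mem_ofPred_eq, hval u hu, hval w hw]
      exact_mod_cast hmin hw
    · simp only [Set.mem_ofPred_eq, htop w hw, le_top]
  have hspec := Classical.epsilon_spec hex
  change IsMinOn _ Set.univ (prox α P.R v) at hspec
  have hmem : prox α P.R v ∈ P.dom := by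
    by_contra hcon
    obtain ⟨u, hu⟩ := hne
    have := hspec (Set.mem_univ u)
    simp only [Set.mem_ofPred_eq, htop _ hcon, hval u hu] at this
    exact absurd this (not_le.2 (EReal.coe_lt_top _))
  refine ⟨hmem, fun u hu => ?_⟩
  have := hspec (Set.mem_univ u)
  simp only [Set.mem_ofPred_eq, hval _ hmem, hval u hu] at this
  exact_mod_cast this

theorem prox_mem_dom (hP : P.Assumptions ν) (hne : P.dom.Nonempty) {α : ℝ} (hα : 0 < α)
    (v : Eu n) : prox α P.R v ∈ P.dom := (hP.prox_isMinOn hne hα v).1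

/-- The variational inequality that characterizes the proximal point. -/
theorem prox_variational (hP : P.Assumptions ν) (hne : P.dom.Nonempty) {α : ℝ} (hα : 0 < α)
    (v : Eu n) {u : Eu n} (hu : u ∈ P.dom) :
    α * P.r (prox α P.R v) + inner ℝ (prox α P.R v - v) (prox α P.R v - u) ≤ α * P.r u := by
  obtain ⟨hmem, hmin⟩ := hP.prox_isMinOn hne hα v
  set x := prox α P.R v
  set A := α * P.r u - α * P.r x + inner ℝ (x - v) (u - x) with hA
  -- The minimizer is compared with the point at parameter s of the segment to `u`; convexity of `r`
  -- and division by s leave a term of order s.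
  have hA' : ∀ s : ℝ, 0 < s → s ≤ 1 → 0 ≤ A + s * (‖u - x‖ ^ 2 / 2) := by
    intro s hs0 hs1
    have hc := hP.r_convexOn.2 hmem hu (by linarith : 0 ≤ 1 - s) hs0.le (by ring)
    have hm := hP.r_convexOn.1 hmem hu (by linarith : 0 ≤ 1 - s) hs0.le (by ring)
    have h1 := hmin _ hm
    have e : (1 - s) • x + s • u - v = (x - v) + s • (u - x) := by module
    rw [e, norm_add_sq_real, inner_smul_right, norm_smul, mul_pow, Real.norm_eq_abs, sq_abs] at h1
    simp only [smul_eq_mul] at hc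
    have h2 := mul_le_mul_of_nonneg_left hc hα.le
    have h3 : 0 ≤ s * (A + s * (‖u - x‖ ^ 2 / 2)) := by
      rw [hA]; nlinarith
    exact nonneg_of_mul_nonneg_right h3 hs0
  have hA0 : 0 ≤ A := by
    by_contra hneg
    push Not at hneg
    set B := ‖u - x‖ ^ 2 / 2 with hB
    have hB0 : 0 ≤ B := by positivity
    -- With this s the quadratic term is at most -A/2, half the assumed deficit; the +1 guards
    -- against B = 0.
    have hs : 0 < min 1 (-A / (2 * (B + 1))) := lt_min one_pos (by apply div_pos <;> linarith)
    have h1 := hA' _ hs (min_le_left _ _)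
    have h2 : min 1 (-A / (2 * (B + 1))) * B ≤ -A / (2 * (B + 1)) * (B + 1) := by
      apply mul_le_mul (min_le_right _ _) (by linarith) hB0 (by apply div_nonneg <;> linarith)
    have h3 : -A / (2 * (B + 1)) * (B + 1) = -A / 2 := by field_simp
    linarith
  have e : inner ℝ (x - v) (x - u) = - inner ℝ (x - v) (u - x) := by
    rw [← inner_neg_right, neg_sub]
  rw [e]; linarith

/-- The variational inequalities at the two proximal points, each tested with the other, add up to
firm nonexpansiveness. The resulting continuity makes the iterates measurable. -/
theorem prox_nonexpansive (hP : P.Assumptions ν) (hne : P.dom.Nonempty) {α : ℝ} (hα : 0 < α) :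
    LipschitzWith 1 (prox α P.R) := by
  refine LipschitzWith.of_dist_le_mul fun v v' => ?_
  have h1 := hP.prox_variational hne hα v (hP.prox_mem_dom hne hα v')
  have h2 := hP.prox_variational hne hα v' (hP.prox_mem_dom hne hα v)
  set x := prox α P.R v
  set x' := prox α P.R v'
  have e1 : inner ℝ (x' - v') (x' - x) = - inner ℝ (x' - v') (x - x') := by
    rw [← inner_neg_right, neg_sub]
  have h3 : inner ℝ (x - x') (x - x') ≤ inner ℝ (v - v') (x - x') := by
    have : inner ℝ (x - x') (x - x') - inner ℝ (v - v') (x - x')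
        = inner ℝ (x - v) (x - x') - inner ℝ (x' - v') (x - x') := by
      rw [← inner_sub_left, ← inner_sub_left]; congr 1; abel
    linarith
  rw [real_inner_self_eq_norm_sq] at h3
  have h4 := real_inner_le_norm (v - v') (x - x')
  rw [dist_eq_norm, dist_eq_norm, NNReal.coe_one, one_mul]
  by_contra hcon
  push Not at hcon
  nlinarith [norm_nonneg (v - v'), norm_nonneg (x - x')]

/-- The length of a proximal step started in the domain. -/
theorem exists_norm_prox_sub_le (hP : P.Assumptions ν) (hne : P.dom.Nonempty) :
    ∃ K : ℝ, 0 ≤ K ∧ ∀ α > 0, ∀ x ∈ P.dom, ∀ G : Eu n,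
      ‖prox α P.R (x - G) - x‖ ≤ α * K + ‖G‖ := by
  obtain ⟨K, hK0, hK⟩ := hP.exists_r_lipschitz
  refine ⟨K, hK0, fun α hα x hx G => ?_⟩
  -- Testing with `x` itself requires x in the domain. The initial point is arbitrary, so increments
  -- are controlled only from time 2 on.
  have h1 := hP.prox_variational hne hα (x - G) hx
  have h2 := hK x hx _ (hP.prox_mem_dom hne hα (x - G))
  set u := prox α P.R (x - G)
  have e : inner ℝ (u - (x - G)) (u - x) = ‖u - x‖ ^ 2 + inner ℝ G (u - x) := by
    rw [← real_inner_self_eq_norm_sq, ← inner_add_left]; congr 1; abel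
  rw [e] at h1
  have h3 : -inner ℝ G (u - x) ≤ ‖G‖ * ‖u - x‖ := by
    rw [← inner_neg_left]
    simpa using real_inner_le_norm (-G) (u - x)
  rw [norm_sub_rev] at h2
  have h4 := mul_le_mul_of_nonneg_left (abs_le.1 h2).2 hα.le
  have h5 : ‖u - x‖ * ‖u - x‖ ≤ (α * K + ‖G‖) * ‖u - x‖ := by nlinarith
  by_contra hcon
  push Not at hcon
  have h6 : 0 < ‖u - x‖ := lt_of_le_of_lt (by positivity) hcon
  exact absurd (le_of_mul_le_mul_right h5 h6) (not_le.2 hcon)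

/-- One proximal step, measured by the distance to a point of the domain. -/
theorem norm_prox_sub_sq_le (hP : P.Assumptions ν) (hne : P.dom.Nonempty) {α : ℝ} (hα : 0 < α)
    (x G : Eu n) {u : Eu n} (hu : u ∈ P.dom) :
    ‖prox α P.R (x - G) - u‖ ^ 2 ≤ ‖x - u‖ ^ 2
      - 2 * α * (P.r (prox α P.R (x - G)) - P.r u) - 2 * inner ℝ G (x - u) + ‖G‖ ^ 2 := by
  have h1 := hP.prox_variational hne hα (x - G) hu
  set p := prox α P.R (x - G)
  have e1 : inner ℝ (p - (x - G)) (p - u)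
      = inner ℝ (p - x) (p - u) + inner ℝ G (x - u) + inner ℝ G (p - x) := by
    have : p - (x - G) = (p - x) + G := by abel
    rw [this, inner_add_left, add_assoc, ← inner_add_right]
    congr 3; abel
  have e2 : ‖x - u‖ ^ 2 = ‖p - u‖ ^ 2 - 2 * inner ℝ (p - x) (p - u) + ‖p - x‖ ^ 2 := by
    have : x - u = (p - u) - (p - x) := by abel
    rw [this, norm_sub_sq_real, real_inner_comm]
  -- This square absorbs the cross term of G and p - x, spending ‖p - x‖² and leaving ‖G‖².
  have h2 : 0 ≤ ‖G + (p - x)‖ ^ 2 := by positivity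
  rw [norm_add_sq_real] at h2
  nlinarith

end Assumptions

end Regularizer

end CompProblem

/-! ### Second moments and convergence of integrals -/

section Moments

variable {Ω : Type*} [MeasurableSpace Ω] {μ : Measure Ω} {k : ℕ}

theorem integrable_norm_sq {f : Ω → Eu k} (hf : MemLp f 2 μ) :
    Integrable (fun ω => ‖f ω‖ ^ 2) μ := hf.integrable_norm_pow (by norm_num)

theorem memLp_two_of_integrable_sq {E : Type*} [NormedAddCommGroup E] {f : Ω → E}
    (hm : AEStronglyMeasurable f μ)
    (hf : Integrable (fun ω => ‖f ω‖ ^ 2) μ) : MemLp f 2 μ :=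
  (memLp_two_iff_integrable_sq_norm hm).2 hf

theorem sq_integral_le [IsProbabilityMeasure μ] {f : Ω → ℝ} (hf : MemLp f 2 μ) :
    (∫ ω, f ω ∂μ) ^ 2 ≤ ∫ ω, f ω ^ 2 ∂μ := by
  have h1 : Integrable f μ := hf.integrable (by norm_num)
  have h2 : Integrable (fun ω => f ω ^ 2) μ := hf.integrable_sq
  set m := ∫ ω, f ω ∂μ
  have h3 : 0 ≤ ∫ ω, (f ω - m) ^ 2 ∂μ := integral_nonneg fun _ => by positivity
  have h4 : ∫ ω, (f ω - m) ^ 2 ∂μ = ∫ ω, f ω ^ 2 ∂μ - 2 * m * m + m ^ 2 := by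
    have e : (fun ω => (f ω - m) ^ 2) = fun ω => f ω ^ 2 - 2 * m * f ω + m ^ 2 := by
      ext; ring
    have e1 := integral_add (h2.sub (h1.const_mul (2 * m))) (integrable_const (m ^ 2))
    have e2 := integral_sub h2 (h1.const_mul (2 * m))
    rw [integral_const_mul] at e2
    simp only [Pi.sub_apply, integral_const, probReal_univ, one_smul] at e1
    rw [e, e1, e2]
  nlinarith

theorem norm_integral_sq_le [IsProbabilityMeasure μ] {f : Ω → Eu k} (hf : MemLp f 2 μ) :
    ‖∫ ω, f ω ∂μ‖ ^ 2 ≤ ∫ ω, ‖f ω‖ ^ 2 ∂μ :=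
  (pow_le_pow_left₀ (norm_nonneg _) (norm_integral_le_integral_norm f) 2).trans
    (sq_integral_le hf.norm)

theorem norm_add_sq_le_two_mul {E : Type*} [NormedAddCommGroup E] (a b : E) :
    ‖a + b‖ ^ 2 ≤ 2 * ‖a‖ ^ 2 + 2 * ‖b‖ ^ 2 := by
  have := pow_le_pow_left₀ (norm_nonneg _) (norm_add_le a b) 2
  nlinarith [sq_nonneg (‖a‖ - ‖b‖)]

theorem norm_sub_sq_le_two_mul {E : Type*} [NormedAddCommGroup E] (a b : E) :
    ‖a - b‖ ^ 2 ≤ 2 * ‖a‖ ^ 2 + 2 * ‖b‖ ^ 2 := by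
  simpa [sub_eq_add_neg] using norm_add_sq_le_two_mul a (-b)

/-- Integrals converge along a pointwise convergent sequence that is bounded in `L²`. -/
theorem tendsto_integral_of_sq_bounded [IsProbabilityMeasure μ] {f : ℕ → Ω → Eu k}
    {g : Ω → Eu k} {C : ℝ} (hf : ∀ i, MemLp (f i) 2 μ) (hg : MemLp g 2 μ)
    (hC : ∀ i, ∫ ω, ‖f i ω‖ ^ 2 ∂μ ≤ C)
    (hlim : ∀ ω, Filter.Tendsto (fun i => f i ω) Filter.atTop (nhds (g ω))) :
    Filter.Tendsto (fun i => ∫ ω, f i ω ∂μ) Filter.atTop (nhds (∫ ω, g ω ∂μ)) := by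
  have hfg : ∀ i, MemLp (f i - g) 2 μ := fun i => (hf i).sub hg
  have hfi : ∀ i, Integrable (f i) μ := fun i => (hf i).integrable (by norm_num)
  have hgi : Integrable g μ := hg.integrable (by norm_num)
  set B := 2 * C + 2 * ∫ ω, ‖g ω‖ ^ 2 ∂μ with hB
  have hsq : ∀ i, ∫ ω, ‖f i ω - g ω‖ ^ 2 ∂μ ≤ B := by
    intro i
    calc _ ≤ ∫ ω, (2 * ‖f i ω‖ ^ 2 + 2 * ‖g ω‖ ^ 2) ∂μ :=
          integral_mono (integrable_norm_sq (hfg i))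
            (((integrable_norm_sq (hf i)).const_mul 2).add ((integrable_norm_sq hg).const_mul 2))
            fun ω => norm_sub_sq_le_two_mul _ _
      _ = 2 * ∫ ω, ‖f i ω‖ ^ 2 ∂μ + 2 * ∫ ω, ‖g ω‖ ^ 2 ∂μ := by
          rw [integral_add ((integrable_norm_sq (hf i)).const_mul 2)
            ((integrable_norm_sq hg).const_mul 2), integral_const_mul, integral_const_mul]
      _ ≤ _ := by rw [hB]; linarith [hC i]
  have hB0 : 0 ≤ B := (integral_nonneg fun _ => by positivity).trans (hsq 0)
  rw [Metric.tendsto_atTop]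
  intro ε hε
  -- Truncation level: y ≤ min y l + y²/l, where the truncated part converges by domination and the
  -- tail is at most B/l ≤ ε/2.
  set l := 2 * B / ε + 1 with hl
  have hl0 : 0 < l := by positivity
  have htr : Filter.Tendsto (fun i => ∫ ω, min ‖f i ω - g ω‖ l ∂μ) Filter.atTop (nhds 0) := by
    have h0 : (0:ℝ) = ∫ _ : Ω, (0:ℝ) ∂μ := by simp
    rw [h0]
    refine tendsto_integral_of_dominated_convergence (fun _ => l) (fun i => ?_)
      (integrable_const l) (fun i => ?_) (Filter.Eventually.of_forall fun ω => ?_)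
    · exact ((hfg i).1.norm.inf aestronglyMeasurable_const)
    · refine Filter.Eventually.of_forall fun ω => ?_
      rw [Real.norm_of_nonneg (le_min (norm_nonneg _) hl0.le)]
      exact min_le_right _ _
    · have h1 : Filter.Tendsto (fun i => ‖f i ω - g ω‖) Filter.atTop (nhds 0) := by
        simpa using ((hlim ω).sub_const (g ω)).norm
      have := h1.min (tendsto_const_nhds (x := l))
      simpa [hl0.le] using this
  obtain ⟨N, hN⟩ := Metric.tendsto_atTop.1 htr (ε / 2) (by positivity)
  refine ⟨N, fun i hi => ?_⟩
  have h1 := (abs_lt.1 (by simpa [Real.dist_eq] using hN i hi)).2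
  rw [dist_eq_norm, ← integral_sub (hfi i) hgi]
  have hmin : Integrable (fun ω => min ‖f i ω - g ω‖ l) μ :=
    ((hfi i).sub hgi).norm.inf (integrable_const l)
  calc _ ≤ ∫ ω, ‖f i ω - g ω‖ ∂μ := norm_integral_le_integral_norm _
    _ ≤ ∫ ω, (min ‖f i ω - g ω‖ l + ‖f i ω - g ω‖ ^ 2 / l) ∂μ := by
        refine integral_mono ((hfi i).sub hgi).norm
          (hmin.add ((integrable_norm_sq (hfg i)).div_const l)) fun ω => ?_
        show ‖f i ω - g ω‖ ≤ min ‖f i ω - g ω‖ l + ‖f i ω - g ω‖ ^ 2 / l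
        set y := ‖f i ω - g ω‖
        have hy : 0 ≤ y := norm_nonneg _
        rcases le_total y l with h | h
        · rw [min_eq_left h]
          have : 0 ≤ y ^ 2 / l := by positivity
          linarith
        · have : y ≤ y ^ 2 / l := by rw [le_div_iff₀ hl0]; nlinarith
          have : 0 ≤ min y l := le_min hy hl0.le
          linarith
    _ = ∫ ω, min ‖f i ω - g ω‖ l ∂μ + (∫ ω, ‖f i ω - g ω‖ ^ 2 ∂μ) / l := by
        rw [← integral_div]
        exact integral_add hmin ((integrable_norm_sq (hfg i)).div_const l)
    _ ≤ ∫ ω, min ‖f i ω - g ω‖ l ∂μ + B / l := by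
        gcongr; exact hsq i
    _ < ε / 2 + ε / 2 := by
        have h2 : B / l ≤ ε / 2 := by
          rw [div_le_iff₀ hl0, hl]
          have : ε / 2 * (2 * B / ε + 1) = B + ε / 2 := by field_simp
          linarith
        linarith
    _ = ε := by ring

end Moments

/-! ### Operators through their values on a basis -/

section OperatorNorm

/-- An operator on Euclidean space is controlled by its values on the standard basis. -/
theorem opNorm_sq_le_sum {n : ℕ} {F : Type*} [NormedAddCommGroup F] [NormedSpace ℝ F]
    (A : Eu n →L[ℝ] F) :
    ‖A‖ ^ 2 ≤ n * ∑ i, ‖A (EuclideanSpace.single i 1)‖ ^ 2 := by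
  have h1 : ‖A‖ ≤ ∑ i, ‖A (EuclideanSpace.single i 1)‖ := by
    refine A.opNorm_le_bound (Finset.sum_nonneg fun _ _ => norm_nonneg _) fun v => ?_
    have hv : v = ∑ i, v i • EuclideanSpace.single i (1:ℝ) := by
      ext j; simp [Finset.sum_apply, Pi.single_apply]
    calc ‖A v‖ = ‖∑ i, v i • A (EuclideanSpace.single i 1)‖ := by
          conv_lhs => rw [hv]
          simp only [map_sum, map_smul]
      _ ≤ ∑ i, ‖v i • A (EuclideanSpace.single i 1)‖ := norm_sum_le _ _
      _ ≤ ∑ i, ‖A (EuclideanSpace.single i 1)‖ * ‖v‖ := by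
          refine Finset.sum_le_sum fun i _ => ?_
          rw [norm_smul, mul_comm]
          gcongr
          exact PiLp.norm_apply_le v i
      _ = _ := by rw [Finset.sum_mul]
  calc ‖A‖ ^ 2 ≤ (∑ i, ‖A (EuclideanSpace.single i 1)‖) ^ 2 := by gcongr
    _ ≤ _ := by
      have := sq_sum_le_card_mul_sum_sq (s := Finset.univ)
        (f := fun i : Fin n => ‖A (EuclideanSpace.single i 1)‖)
      simpa using this

theorem measurable_clm_of_apply {Ω : Type*} [MeasurableSpace Ω] {n k : ℕ}
    {A : Ω → Eu n →L[ℝ] Eu k} (h : ∀ v, Measurable fun ω => A ω v) : Measurable A := by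
  have e : A = fun ω => ∑ i, (ContinuousLinearMap.smulRightL ℝ (Eu n) (Eu k)
      (EuclideanSpace.proj i)) (A ω (EuclideanSpace.single i 1)) := by
    ext ω v : 2
    have hv : v = ∑ i, v i • EuclideanSpace.single i (1:ℝ) := by
      ext j; simp [Finset.sum_apply, Pi.single_apply]
    conv_lhs => rw [hv]
    simp [map_sum, map_smul]
  rw [e]
  refine Finset.measurable_sum _ fun i _ => ?_
  exact (ContinuousLinearMap.continuous _).measurable.comp (h _)

end OperatorNorm

/-! ### Sample derivatives: measurability, moments, exchange with expectation -/

namespace CompProblem.InnerAssumptions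

variable {n k : ℕ} {Ξ : Type*} [MeasurableSpace Ξ] {X : Set (Eu n)} {ν : Measure Ξ}
  {φ : Eu n → Ξ → Eu k}

theorem measurable_uncurry (h : InnerAssumptions X ν φ) :
    Measurable fun q : Eu n × Ξ => φ q.1 q.2 :=
  measurable_uncurry_of_continuous_of_measurable (fun s => (h.contDiff s).continuous) h.measurable

theorem differentiableAt (h : InnerAssumptions X ν φ) (x : Eu n) (s : Ξ) :
    DifferentiableAt ℝ (fun x => φ x s) x :=
  ((h.contDiff s).differentiable (by norm_num)).differentiableAt

/-- A countable sequence of difference quotients serves both the measurability of the derivative and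
Fatou's lemma. -/
theorem tendsto_slope (h : InnerAssumptions X ν φ) (x v : Eu n) (s : Ξ) :
    Filter.Tendsto (fun i : ℕ => ((i : ℝ) + 1) • (φ (x + ((i : ℝ) + 1)⁻¹ • v) s - φ x s))
      Filter.atTop (nhds (fderiv ℝ (fun x => φ x s) x v)) := by
  exact ((h.differentiableAt x s).hasFDerivAt.lim_real v).comp
    (Filter.tendsto_atTop_add_const_right _ 1 tendsto_natCast_atTop_atTop)

theorem measurable_fderiv_apply (h : InnerAssumptions X ν φ) (x v : Eu n) :
    Measurable fun s => fderiv ℝ (fun x => φ x s) x v :=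
  measurable_of_tendsto_metrizable
    (fun i => ((h.measurable _).sub (h.measurable x)).const_smul ((i : ℝ) + 1))
    (tendsto_pi_nhds.2 fun s => h.tendsto_slope x v s)

theorem measurable_fderiv (h : InnerAssumptions X ν φ) :
    Measurable fun q : Eu n × Ξ => fderiv ℝ (fun x => φ x q.2) q.1 :=
  measurable_uncurry_of_continuous_of_measurable
    (u := fun x s => fderiv ℝ (fun x => φ x s) x)
    (fun s => (h.contDiff s).continuous_fderiv (by norm_num))
    (fun x => measurable_clm_of_apply fun v => h.measurable_fderiv_apply x v)

theorem exists_lipschitz (h : InnerAssumptions X ν φ) :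
    ∃ L : ℝ, 0 ≤ L ∧ ∀ x x', ∫ s, ‖φ x s - φ x' s‖ ^ 2 ∂ν ≤ L * ‖x - x'‖ ^ 2 := by
  obtain ⟨L, hL⟩ := h.lipschitz
  exact ⟨max L 0, le_max_right _ _, fun x x' => (hL x x').trans (by gcongr; exact le_max_left _ _)⟩

/-- The mean-square Lipschitz bound controls every difference quotient in L², and Fatou's lemma
passes it to the derivative. The bound on the quotients is kept for exchanging limit and
expectation. -/
theorem fderiv_apply_sq (h : InnerAssumptions X ν φ) {L : ℝ}
    (hL : ∀ x x', ∫ s, ‖φ x s - φ x' s‖ ^ 2 ∂ν ≤ L * ‖x - x'‖ ^ 2) (x v : Eu n) :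
    MemLp (fun s => fderiv ℝ (fun x => φ x s) x v) 2 ν ∧
      ∫ s, ‖fderiv ℝ (fun x => φ x s) x v‖ ^ 2 ∂ν ≤ L * ‖v‖ ^ 2 ∧
      ∀ i : ℕ, ∫ s, ‖((i : ℝ) + 1) • (φ (x + ((i : ℝ) + 1)⁻¹ • v) s - φ x s)‖ ^ 2 ∂ν
        ≤ L * ‖v‖ ^ 2 := by
  have hb : ∀ i : ℕ, ∫ s, ‖((i : ℝ) + 1) • (φ (x + ((i : ℝ) + 1)⁻¹ • v) s - φ x s)‖ ^ 2 ∂ν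
      ≤ L * ‖v‖ ^ 2 := by
    intro i
    have h1 := hL (x + ((i : ℝ) + 1)⁻¹ • v) x
    have hi : (0:ℝ) < (i : ℝ) + 1 := by positivity
    simp only [norm_smul, mul_pow, integral_const_mul, add_sub_cancel_left, norm_inv,
      Real.norm_of_nonneg hi.le] at h1 ⊢
    calc _ ≤ ((i : ℝ) + 1) ^ 2 * (L * ((((i : ℝ) + 1)⁻¹) ^ 2 * ‖v‖ ^ 2)) := by gcongr
      _ = _ := by field_simp
  have hmem : ∀ i : ℕ, MemLp
      (fun s => ((i : ℝ) + 1) • (φ (x + ((i : ℝ) + 1)⁻¹ • v) s - φ x s)) 2 ν := fun i =>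
    ((h.memLp _).sub (h.memLp x)).const_smul ((i : ℝ) + 1)
  have hLv : 0 ≤ L * ‖v‖ ^ 2 := (integral_nonneg fun _ => by positivity).trans (hb 0)
  have hlint : ∫⁻ s, ENNReal.ofReal (‖fderiv ℝ (fun x => φ x s) x v‖ ^ 2) ∂ν
      ≤ ENNReal.ofReal (L * ‖v‖ ^ 2) := by
    have hlim : ∀ s, Filter.Tendsto (fun i : ℕ => ENNReal.ofReal
        (‖((i : ℝ) + 1) • (φ (x + ((i : ℝ) + 1)⁻¹ • v) s - φ x s)‖ ^ 2)) Filter.atTop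
        (nhds (ENNReal.ofReal (‖fderiv ℝ (fun x => φ x s) x v‖ ^ 2))) := fun s =>
      (ENNReal.continuous_ofReal.tendsto _).comp (((h.tendsto_slope x v s).norm).pow 2)
    calc _ = ∫⁻ s, Filter.liminf (fun i : ℕ => ENNReal.ofReal
            (‖((i : ℝ) + 1) • (φ (x + ((i : ℝ) + 1)⁻¹ • v) s - φ x s)‖ ^ 2)) Filter.atTop ∂ν :=
          lintegral_congr fun s => (hlim s).liminf_eq.symm
      _ ≤ Filter.liminf (fun i : ℕ => ∫⁻ s, ENNReal.ofReal
            (‖((i : ℝ) + 1) • (φ (x + ((i : ℝ) + 1)⁻¹ • v) s - φ x s)‖ ^ 2) ∂ν) Filter.atTop :=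
          lintegral_liminf_le fun i => ENNReal.measurable_ofReal.comp
            ((((h.measurable _).sub (h.measurable x)).const_smul ((i : ℝ) + 1)).norm.pow_const 2)
      _ ≤ _ := by
          refine Filter.liminf_le_of_le (by isBoundedDefault) fun b hb' => ?_
          obtain ⟨i, hi⟩ := hb'.exists
          refine hi.trans ?_
          rw [← ofReal_integral_eq_lintegral_ofReal (integrable_norm_sq (hmem i))
            (Filter.Eventually.of_forall fun _ => by positivity)]
          exact ENNReal.ofReal_le_ofReal (hb i)
  have hint : Integrable (fun s => ‖fderiv ℝ (fun x => φ x s) x v‖ ^ 2) ν := by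
    refine ⟨((h.measurable_fderiv_apply x v).norm.pow_const 2).aestronglyMeasurable, ?_⟩
    rw [hasFiniteIntegral_iff_ofReal (Filter.Eventually.of_forall fun _ => by positivity)]
    exact hlint.trans_lt ENNReal.ofReal_lt_top
  refine ⟨memLp_two_of_integrable_sq (h.measurable_fderiv_apply x v).aestronglyMeasurable hint,
    ?_, hb⟩
  rw [integral_eq_lintegral_of_nonneg_ae (Filter.Eventually.of_forall fun _ => by positivity)
    hint.1]
  exact ENNReal.toReal_le_of_le_ofReal hLv hlint

/-- The expected derivative is the derivative of the expectation. -/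
theorem integral_fderiv_apply [IsProbabilityMeasure ν] (h : InnerAssumptions X ν φ)
    (x v : Eu n) :
    ∫ s, fderiv ℝ (fun x => φ x s) x v ∂ν = fderiv ℝ (fun x => ∫ s, φ x s ∂ν) x v := by
  obtain ⟨L, hL0, hL⟩ := h.exists_lipschitz
  obtain ⟨h1, h2, h3⟩ := h.fderiv_apply_sq hL x v
  have hI : ∀ x, Integrable (φ x) ν := fun x => (h.memLp x).integrable (by norm_num)
  have t1 := tendsto_integral_of_sq_bounded (fun i : ℕ =>
    ((h.memLp (x + ((i : ℝ) + 1)⁻¹ • v)).sub (h.memLp x)).const_smul ((i : ℝ) + 1)) h1 h3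
    (h.tendsto_slope x v)
  have t2 : Filter.Tendsto (fun i : ℕ => ((i : ℝ) + 1) •
      ((∫ s, φ (x + ((i : ℝ) + 1)⁻¹ • v) s ∂ν) - ∫ s, φ x s ∂ν)) Filter.atTop
      (nhds (fderiv ℝ (fun x => ∫ s, φ x s ∂ν) x v)) := by
    exact ((h.smooth.1 x).hasFDerivAt.lim_real v).comp
      (Filter.tendsto_atTop_add_const_right _ 1 tendsto_natCast_atTop_atTop)
  refine tendsto_nhds_unique t1 (t2.congr fun i => ?_)
  rw [← integral_sub (hI _) (hI _), ← integral_smul]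
  rfl

/-- The sample derivatives have a uniformly bounded second moment. -/
theorem exists_fderiv_sq_le (h : InnerAssumptions X ν φ) :
    ∃ B : ℝ, 0 ≤ B ∧ ∀ x, Integrable (fun s => ‖fderiv ℝ (fun x => φ x s) x‖ ^ 2) ν ∧
      ∫ s, ‖fderiv ℝ (fun x => φ x s) x‖ ^ 2 ∂ν ≤ B := by
  obtain ⟨L, hL0, hL⟩ := h.exists_lipschitz
  -- One factor n comes from the operator norm estimate, the other from summing the bound L over n
  -- basis vectors.
  refine ⟨n * (n * L), by positivity, fun x => ?_⟩
  have hi : ∀ i : Fin n, Integrable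
      (fun s => ‖fderiv ℝ (fun x => φ x s) x (EuclideanSpace.single i 1)‖ ^ 2) ν := fun i =>
    integrable_norm_sq (h.fderiv_apply_sq hL x _).1
  have hs : Integrable (fun s => (n : ℝ) *
      ∑ i, ‖fderiv ℝ (fun x => φ x s) x (EuclideanSpace.single i 1)‖ ^ 2) ν :=
    (integrable_finsetSum _ fun i _ => hi i).const_mul _
  have hm : Measurable (fun s => ‖fderiv ℝ (fun x => φ x s) x‖ ^ 2) :=
    (h.measurable_fderiv.comp (measurable_const.prodMk measurable_id)).norm.pow_const 2
  have hI : Integrable (fun s => ‖fderiv ℝ (fun x => φ x s) x‖ ^ 2) ν :=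
    hs.mono' hm.aestronglyMeasurable (Filter.Eventually.of_forall fun s => by
      rw [Real.norm_of_nonneg (by positivity)]
      exact opNorm_sq_le_sum _)
  refine ⟨hI, (integral_mono hI hs fun s => opNorm_sq_le_sum _).trans ?_⟩
  rw [integral_const_mul, integral_finsetSum _ fun i _ => hi i]
  gcongr
  calc _ ≤ ∑ _i : Fin n, L := by
        refine Finset.sum_le_sum fun i _ => ?_
        simpa using (h.fderiv_apply_sq hL x (EuclideanSpace.single i 1)).2.1
    _ = _ := by simp

theorem lipschitz_mean [IsProbabilityMeasure ν] (h : InnerAssumptions X ν φ) :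
    ∃ L : NNReal, LipschitzWith L fun x => ∫ s, φ x s ∂ν := by
  obtain ⟨L, hL0, hL⟩ := h.exists_lipschitz
  have hI : ∀ x, Integrable (φ x) ν := fun x => (h.memLp x).integrable (by norm_num)
  refine ⟨Real.toNNReal √L, LipschitzWith.of_dist_le_mul fun x y => ?_⟩
  rw [dist_eq_norm, dist_eq_norm, ← integral_sub (hI x) (hI y),
    Real.coe_toNNReal _ (Real.sqrt_nonneg _)]
  have h1 := (norm_integral_sq_le ((h.memLp x).sub (h.memLp y))).trans (hL x y)
  refine (sq_le_sq₀ (norm_nonneg _) (by positivity)).1 ?_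
  rw [mul_pow, Real.sq_sqrt hL0]
  exact h1

/-- Second moments away from `X`. -/
theorem exists_moment_le (h : InnerAssumptions X ν φ) :
    ∃ B : ℝ, 0 ≤ B ∧ ∀ x ∈ X, ∀ w, ∫ s, ‖φ w s‖ ^ 2 ∂ν ≤ B * (1 + ‖w - x‖ ^ 2) := by
  obtain ⟨L, hL0, hL⟩ := h.exists_lipschitz
  obtain ⟨V, hV⟩ := h.moment
  refine ⟨max (2 * L) (2 * V), le_max_of_le_left (by positivity), fun x hx w => ?_⟩
  have i1 := (integrable_norm_sq ((h.memLp w).sub (h.memLp x))).const_mul 2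
  have i2 := (integrable_norm_sq (h.memLp x)).const_mul 2
  calc _ ≤ ∫ s, (2 * ‖φ w s - φ x s‖ ^ 2 + 2 * ‖φ x s‖ ^ 2) ∂ν := by
        refine integral_mono (integrable_norm_sq (h.memLp w)) (i1.add i2) fun s => ?_
        simpa using norm_add_sq_le_two_mul (φ w s - φ x s) (φ x s)
    _ = 2 * ∫ s, ‖φ w s - φ x s‖ ^ 2 ∂ν + 2 * ∫ s, ‖φ x s‖ ^ 2 ∂ν := by
        rw [← integral_const_mul, ← integral_const_mul]
        exact integral_add i1 i2
    _ ≤ 2 * (L * ‖w - x‖ ^ 2) + 2 * V := by gcongr; exacts [hL w x, hV x hx]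
    _ ≤ max (2 * L) (2 * V) * ‖w - x‖ ^ 2 + max (2 * L) (2 * V) := by
        rw [← mul_assoc]
        gcongr
        exacts [le_max_left _ _, le_max_right _ _]
    _ = _ := by ring

end CompProblem.InnerAssumptions

/-! ### Independent samples and the history filtration -/

section Sampling

variable {Ω Ξ : Type*} [MeasurableSpace Ξ]

/-- An independent sample of the law `ν`. -/
structure IsSample [MeasurableSpace Ω] (ξ : ℕ → Ω → Ξ) (μ : Measure Ω) (ν : Measure Ξ) : Prop where
  meas : ∀ t, Measurable (ξ t)
  law : ∀ t, μ.map (ξ t) = ν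
  indep : iIndepFun ξ μ

/-- The information carried by the samples before time `t`. -/
@[reducible] def history (ξ : ℕ → Ω → Ξ) (t : ℕ) : MeasurableSpace Ω :=
  ⨆ i ∈ Set.Iio t, MeasurableSpace.comap (ξ i) inferInstance

theorem history_mono (ξ : ℕ → Ω → Ξ) {s t : ℕ} (h : s ≤ t) : history ξ s ≤ history ξ t :=
  biSup_mono fun _ hi => lt_of_lt_of_le hi h

theorem measurable_history (ξ : ℕ → Ω → Ξ) {s t : ℕ} (h : s < t) :
    Measurable[history ξ t] (ξ s) :=
  Measurable.of_comap_le (le_biSup (fun i => MeasurableSpace.comap (ξ i) inferInstance)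
    (Set.mem_Iio.2 h))

variable [mΩ : MeasurableSpace Ω]

namespace IsSample

variable {ξ : ℕ → Ω → Ξ} {μ : Measure Ω} {ν : Measure Ξ}

theorem history_le (h : IsSample ξ μ ν) (t : ℕ) : history ξ t ≤ mΩ :=
  iSup₂_le fun i _ => (h.meas i).comap_le

variable {E : Type*} [MeasurableSpace E] {t : ℕ} {V : Ω → E}

theorem measurable_of_history (h : IsSample ξ μ ν) (hV : Measurable[history ξ t] V) :
    Measurable V := hV.mono (h.history_le t) le_rfl

/-- The indices below t and the index t form disjoint blocks, so `V` and `ξ t` are independent. This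
product law is the substitute for conditional expectations throughout. -/
theorem map_prodMk [IsProbabilityMeasure μ] (h : IsSample ξ μ ν)
    (hV : Measurable[history ξ t] V) :
    μ.map (fun ω => (V ω, ξ t ω)) = (μ.map V).prod ν := by
  have h1 : Indep (history ξ t) (⨆ i ∈ ({t} : Set ℕ), MeasurableSpace.comap (ξ i) inferInstance) μ :=
    indep_iSup_of_disjoint (fun i => (h.meas i).comap_le) h.indep
      (Set.disjoint_singleton_right.2 (by simp))
  have h2 : IndepFun V (ξ t) μ := by
    refine indep_of_indep_of_le_right (indep_of_indep_of_le_left h1 hV.comap_le) ?_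
    exact le_biSup (fun i => MeasurableSpace.comap (ξ i) inferInstance) (Set.mem_singleton t)
  rw [(indepFun_iff_map_prod_eq_prod_map_map (h.measurable_of_history hV).aemeasurable
    (h.meas t).aemeasurable).1 h2, h.law]

variable [IsProbabilityMeasure μ] [IsProbabilityMeasure ν]

/-- Integrating a nonnegative function of the past and of a fresh sample. -/
theorem integrable_and_integral_le (h : IsSample ξ μ ν) (hV : Measurable[history ξ t] V)
    {Φ : E × Ξ → ℝ} (hΦ : Measurable Φ) (h0 : ∀ q, 0 ≤ Φ q) {B : Ω → ℝ}
    (hi : ∀ ω, Integrable (fun s => Φ (V ω, s)) ν) (hle : ∀ ω, ∫ s, Φ (V ω, s) ∂ν ≤ B ω)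
    (hB : Integrable B μ) :
    Integrable (fun ω => Φ (V ω, ξ t ω)) μ ∧ ∫ ω, Φ (V ω, ξ t ω) ∂μ ≤ ∫ ω, B ω ∂μ := by
  have hVm := h.measurable_of_history hV
  have hpm : Measurable fun ω => (V ω, ξ t ω) := hVm.prodMk (h.meas t)
  have : IsProbabilityMeasure (μ.map V) := Measure.isProbabilityMeasure_map hVm.aemeasurable
  have hI : Measurable fun v => ∫ s, Φ (v, s) ∂ν :=
    (hΦ.stronglyMeasurable.integral_prod_right' (ν := ν)).measurable
  -- Tonelli: the fibre integrals are finite, and integrable because `B` dominates them.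
  have hint : Integrable Φ ((μ.map V).prod ν) := by
    rw [integrable_prod_iff hΦ.aestronglyMeasurable]
    constructor
    · rw [ae_map_iff hVm.aemeasurable (measurableSet_integrable
        (f := fun v s => Φ (v, s)) hΦ.stronglyMeasurable)]
      exact Filter.Eventually.of_forall hi
    · simp only [Real.norm_of_nonneg (h0 _)]
      rw [integrable_map_measure hI.aestronglyMeasurable hVm.aemeasurable]
      refine hB.mono' (hI.comp hVm).aestronglyMeasurable (Filter.Eventually.of_forall fun ω => ?_)
      rw [Function.comp, Real.norm_of_nonneg (integral_nonneg fun _ => h0 _)]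
      exact hle ω
  have hint' := hint
  rw [← h.map_prodMk hV, integrable_map_measure hΦ.aestronglyMeasurable hpm.aemeasurable] at hint'
  refine ⟨hint', ?_⟩
  have h1 : Integrable (fun ω => ∫ s, Φ (V ω, s) ∂ν) μ := by
    refine hB.mono' (hI.comp hVm).aestronglyMeasurable (Filter.Eventually.of_forall fun ω => ?_)
    rw [Real.norm_of_nonneg (integral_nonneg fun _ => h0 _)]
    exact hle ω
  calc ∫ ω, Φ (V ω, ξ t ω) ∂μ = ∫ q, Φ q ∂(μ.map fun ω => (V ω, ξ t ω)) :=
        (integral_map hpm.aemeasurable hΦ.aestronglyMeasurable).symm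
    _ = ∫ v, ∫ s, Φ (v, s) ∂ν ∂(μ.map V) := by rw [h.map_prodMk hV, integral_prod _ hint]
    _ = ∫ ω, ∫ s, Φ (V ω, s) ∂ν ∂μ := integral_map hVm.aemeasurable hI.aestronglyMeasurable
    _ ≤ _ := integral_mono h1 hB hle

/-- Fubini's theorem for a function of the past and of a fresh sample. -/
theorem integral_eq_integral_integral (h : IsSample ξ μ ν) (hV : Measurable[history ξ t] V)
    {Φ : E × Ξ → ℝ} (hΦ : Measurable Φ) (hi : Integrable (fun ω => Φ (V ω, ξ t ω)) μ) :
    ∫ ω, Φ (V ω, ξ t ω) ∂μ = ∫ ω, ∫ s, Φ (V ω, s) ∂ν ∂μ := by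
  have hVm := h.measurable_of_history hV
  have hpm : Measurable fun ω => (V ω, ξ t ω) := hVm.prodMk (h.meas t)
  have : IsProbabilityMeasure (μ.map V) := Measure.isProbabilityMeasure_map hVm.aemeasurable
  have hI : Measurable fun v => ∫ s, Φ (v, s) ∂ν :=
    (hΦ.stronglyMeasurable.integral_prod_right' (ν := ν)).measurable
  have hint : Integrable Φ ((μ.map V).prod ν) := by
    rw [← h.map_prodMk hV, integrable_map_measure hΦ.aestronglyMeasurable hpm.aemeasurable]
    exact hi
  calc ∫ ω, Φ (V ω, ξ t ω) ∂μ = ∫ q, Φ q ∂(μ.map fun ω => (V ω, ξ t ω)) :=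
        (integral_map hpm.aemeasurable hΦ.aestronglyMeasurable).symm
    _ = ∫ v, ∫ s, Φ (v, s) ∂ν ∂(μ.map V) := by rw [h.map_prodMk hV, integral_prod _ hint]
    _ = _ := integral_map hVm.aemeasurable hI.aestronglyMeasurable

end IsSample

/-- A bounded measurable function is square integrable. -/
theorem memLp_of_bounded {k : ℕ} {μ : Measure Ω} [IsFiniteMeasure μ] {f : Ω → Eu k}
    (hf : Measurable f) (hb : ∃ K, ∀ ω, ‖f ω‖ ≤ K) (p : ENNReal) : MemLp f p μ := by
  obtain ⟨K, hK⟩ := hb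
  exact MemLp.of_bound hf.aestronglyMeasurable K (Filter.Eventually.of_forall hK)

end Sampling

/-! ### Fresh samples at points determined by the past -/

section Sampled

open CompProblem

variable {Ω Ξ : Type*} [mΩ : MeasurableSpace Ω] [MeasurableSpace Ξ]
  {ξ : ℕ → Ω → Ξ} {μ : Measure Ω} {ν : Measure Ξ} [IsProbabilityMeasure μ]
  [IsProbabilityMeasure ν] {n k : ℕ} {X : Set (Eu n)} {φ : Eu n → Ξ → Eu k}

/-- Second moment of a fresh sample at a point determined by the past, in terms of the distance
to a point of `X` determined by the past. -/
theorem IsSample.exists_sample_sq_le (h : IsSample ξ μ ν) (hφ : InnerAssumptions X ν φ) :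
    ∃ B : ℝ, 0 ≤ B ∧ ∀ t (x w : Ω → Eu n), (∀ ω, x ω ∈ X) →
      Measurable[history ξ t] w → Integrable (fun ω => ‖w ω - x ω‖ ^ 2) μ →
      MemLp (fun ω => φ (w ω) (ξ t ω)) 2 μ ∧
      ∫ ω, ‖φ (w ω) (ξ t ω)‖ ^ 2 ∂μ ≤ B * (1 + ∫ ω, ‖w ω - x ω‖ ^ 2 ∂μ) := by
  obtain ⟨B, hB0, hB⟩ := hφ.exists_moment_le
  refine ⟨B, hB0, fun t x w hx hw hi => ?_⟩
  have hm := hφ.measurable_uncurry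
  have hib : Integrable (fun ω => B * (1 + ‖w ω - x ω‖ ^ 2)) μ :=
    ((integrable_const 1).add hi).const_mul B
  obtain ⟨h1, h2⟩ := h.integrable_and_integral_le hw (Φ := fun q => ‖φ q.1 q.2‖ ^ 2)
    (hm.norm.pow_const 2) (fun _ => by positivity)
    (fun ω => integrable_norm_sq (hφ.memLp (w ω))) (fun ω => hB (x ω) (hx ω) (w ω)) hib
  refine ⟨memLp_two_of_integrable_sq
    (hm.comp ((h.measurable_of_history hw).prodMk (h.meas t))).aestronglyMeasurable h1,
    h2.trans (le_of_eq ?_)⟩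
  have e := integral_add (integrable_const (1:ℝ)) hi
  rw [integral_const_mul]
  simp only [integral_const, probReal_univ, one_smul] at e
  rw [e]

/-- The sample derivative at a point determined by the past, weighted by the past. -/
theorem IsSample.exists_weighted_fderiv_sq_le (h : IsSample ξ μ ν)
    (hφ : InnerAssumptions X ν φ) :
    ∃ B : ℝ, 0 ≤ B ∧ ∀ t (x : Ω → Eu n) (Z : Ω → ℝ), Measurable[history ξ t] x →
      Measurable[history ξ t] Z → (∀ ω, 0 ≤ Z ω) → Integrable Z μ →
      Integrable (fun ω => Z ω * ‖fderiv ℝ (fun x => φ x (ξ t ω)) (x ω)‖ ^ 2) μ ∧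
      ∫ ω, Z ω * ‖fderiv ℝ (fun x => φ x (ξ t ω)) (x ω)‖ ^ 2 ∂μ ≤ B * ∫ ω, Z ω ∂μ := by
  obtain ⟨B, hB0, hB⟩ := hφ.exists_fderiv_sq_le
  refine ⟨B, hB0, fun t x Z hx hZ hZ0 hi => ?_⟩
  have hm := hφ.measurable_fderiv
  -- The absolute value makes the integrand nonnegative for all arguments, not only along `Z`.
  have := h.integrable_and_integral_le (hx.prodMk hZ)
    (Φ := fun q : (Eu n × ℝ) × Ξ => |q.1.2| * ‖fderiv ℝ (fun x => φ x q.2) q.1.1‖ ^ 2)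
    ((measurable_snd.comp measurable_fst).abs.mul
      ((hm.comp ((measurable_fst.comp measurable_fst).prodMk measurable_snd)).norm.pow_const 2))
    (fun _ => by positivity) (B := fun ω => B * Z ω) (fun ω => (hB (x ω)).1.const_mul |Z ω|)
    (fun ω => by
      simp only [integral_const_mul]
      rw [abs_of_nonneg (hZ0 ω), mul_comm]
      exact mul_le_mul_of_nonneg_right (hB (x ω)).2 (hZ0 ω)) (hi.const_mul B)
  rw [integral_const_mul] at this
  simpa only [abs_of_nonneg (hZ0 _)] using this

/-- Conditional expectation of a fresh sample, tested against the past. -/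
theorem IsSample.integral_inner_sample (h : IsSample ξ μ ν) (hφ : InnerAssumptions X ν φ)
    {t : ℕ} {w : Ω → Eu n} {Z : Ω → Eu k} (hw : Measurable[history ξ t] w)
    (hZ : Measurable[history ξ t] Z)
    (hi : Integrable (fun ω => (inner ℝ (Z ω) (φ (w ω) (ξ t ω)) : ℝ)) μ) :
    ∫ ω, inner ℝ (Z ω) (φ (w ω) (ξ t ω)) ∂μ = ∫ ω, inner ℝ (Z ω) (∫ s, φ (w ω) s ∂ν) ∂μ := by
  rw [h.integral_eq_integral_integral (hw.prodMk hZ)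
    (Φ := fun q : (Eu n × Eu k) × Ξ => inner ℝ q.1.2 (φ q.1.1 q.2))
    (((measurable_snd.comp measurable_fst)).inner
      (hφ.measurable_uncurry.comp ((measurable_fst.comp measurable_fst).prodMk measurable_snd))) hi]
  refine integral_congr_ae (Filter.Eventually.of_forall fun ω => ?_)
  exact integral_inner ((hφ.memLp _).integrable (by norm_num)) _

/-- Conditional expectation of a fresh sample derivative, tested against the past. -/
theorem IsSample.integral_inner_fderiv (h : IsSample ξ μ ν) (hφ : InnerAssumptions X ν φ)
    {t : ℕ} {x v : Ω → Eu n} {Z : Ω → Eu k} (hx : Measurable[history ξ t] x)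
    (hv : Measurable[history ξ t] v) (hZ : Measurable[history ξ t] Z)
    (hi : Integrable (fun ω =>
      (inner ℝ (Z ω) (fderiv ℝ (fun x => φ x (ξ t ω)) (x ω) (v ω)) : ℝ)) μ) :
    ∫ ω, inner ℝ (Z ω) (fderiv ℝ (fun x => φ x (ξ t ω)) (x ω) (v ω)) ∂μ
      = ∫ ω, inner ℝ (Z ω) (fderiv ℝ (fun x => ∫ s, φ x s ∂ν) (x ω) (v ω)) ∂μ := by
  have hm : Measurable fun q : ((Eu n × Eu n) × Eu k) × Ξ =>
      fderiv ℝ (fun x => φ x q.2) q.1.1.1 q.1.1.2 := by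
    have h0 : Measurable fun q : ((Eu n × Eu n) × Eu k) × Ξ => (q.1.1.1, q.2) := by fun_prop
    have h1 := hφ.measurable_fderiv.comp h0
    have h2 : Measurable fun q : ((Eu n × Eu n) × Eu k) × Ξ => q.1.1.2 := by fun_prop
    exact (isBoundedBilinearMap_apply (𝕜 := ℝ) (E := Eu n) (F := Eu k)).continuous.measurable.comp
      (h1.prodMk h2)
  rw [h.integral_eq_integral_integral ((hx.prodMk hv).prodMk hZ)
    (Φ := fun q : ((Eu n × Eu n) × Eu k) × Ξ =>
      inner ℝ q.1.2 (fderiv ℝ (fun x => φ x q.2) q.1.1.1 q.1.1.2))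
    (((measurable_snd.comp measurable_fst)).inner hm) hi]
  refine integral_congr_ae (Filter.Eventually.of_forall fun ω => ?_)
  obtain ⟨L, hL0, hL⟩ := hφ.exists_lipschitz
  show ∫ s, inner ℝ (Z ω) (fderiv ℝ (fun x => φ x s) (x ω) (v ω)) ∂ν = _
  rw [integral_inner ((hφ.fderiv_apply_sq hL _ _).1.integrable (by norm_num)),
    hφ.integral_fderiv_apply]

end Sampled

/-! ### Tracking of the means by running averages -/

section Tracking

open CompProblem

variable {Ω Ξ : Type*} [mΩ : MeasurableSpace Ω] [MeasurableSpace Ξ]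
  {ξ : ℕ → Ω → Ξ} {μ : Measure Ω} {ν : Measure Ξ} {n k : ℕ} {X : Set (Eu n)}
  {φ : Eu n → Ξ → Eu k}

/-- The extrapolated point w may leave `X`, where no uniform moment bound is assumed; the distance
to a point of `X` pays for it through the Lipschitz condition. -/
theorem IsSample.exists_noise_sq_le [IsProbabilityMeasure μ] [IsProbabilityMeasure ν]
    (h : IsSample ξ μ ν) (hφ : InnerAssumptions X ν φ) :
    ∃ B : ℝ, 0 ≤ B ∧ ∀ t (x w : Ω → Eu n), (∀ ω, x ω ∈ X) →
      Measurable[history ξ t] w → Integrable (fun ω => ‖w ω - x ω‖ ^ 2) μ →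
      MemLp (fun ω => φ (w ω) (ξ t ω) - ∫ s, φ (w ω) s ∂ν) 2 μ ∧
      ∫ ω, ‖φ (w ω) (ξ t ω) - ∫ s, φ (w ω) s ∂ν‖ ^ 2 ∂μ ≤ B * (1 + ∫ ω, ‖w ω - x ω‖ ^ 2 ∂μ) := by
  obtain ⟨B, hB0, hB⟩ := h.exists_sample_sq_le hφ
  obtain ⟨B', hB'0, hB'⟩ := hφ.exists_moment_le
  refine ⟨2 * B + 2 * B', by positivity, fun t x w hx hw hi => ?_⟩
  obtain ⟨h1, h2⟩ := hB t x w hx hw hi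
  have hmean : Measurable fun ω => ∫ s, φ (w ω) s ∂ν :=
    hφ.smooth.1.continuous.measurable.comp (h.measurable_of_history hw)
  have hib : Integrable (fun ω => B' * (1 + ‖w ω - x ω‖ ^ 2)) μ :=
    ((integrable_const 1).add hi).const_mul B'
  have hle : ∀ ω, ‖∫ s, φ (w ω) s ∂ν‖ ^ 2 ≤ B' * (1 + ‖w ω - x ω‖ ^ 2) := fun ω =>
    (norm_integral_sq_le (hφ.memLp _)).trans (hB' _ (hx ω) _)
  have h3 : Integrable (fun ω => ‖∫ s, φ (w ω) s ∂ν‖ ^ 2) μ :=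
    hib.mono' (hmean.norm.pow_const 2).aestronglyMeasurable
      (Filter.Eventually.of_forall fun ω => by
        rw [Real.norm_of_nonneg (by positivity)]; exact hle ω)
  have h4 : MemLp (fun ω => ∫ s, φ (w ω) s ∂ν) 2 μ :=
    memLp_two_of_integrable_sq hmean.aestronglyMeasurable h3
  have h5 : MemLp (fun ω => φ (w ω) (ξ t ω) - ∫ s, φ (w ω) s ∂ν) 2 μ := h1.sub h4
  refine ⟨h5, ?_⟩
  have h6 : ∫ ω, ‖∫ s, φ (w ω) s ∂ν‖ ^ 2 ∂μ ≤ B' * (1 + ∫ ω, ‖w ω - x ω‖ ^ 2 ∂μ) := by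
    refine (integral_mono h3 hib hle).trans (le_of_eq ?_)
    have e := integral_add (integrable_const (1:ℝ)) hi
    rw [integral_const_mul]
    simp only [integral_const, probReal_univ, one_smul] at e
    rw [e]
  have i1 := (integrable_norm_sq h1).const_mul 2
  have i2 := h3.const_mul 2
  calc _ ≤ ∫ ω, (2 * ‖φ (w ω) (ξ t ω)‖ ^ 2 + 2 * ‖∫ s, φ (w ω) s ∂ν‖ ^ 2) ∂μ :=
        integral_mono (integrable_norm_sq h5) (i1.add i2) fun ω => norm_sub_sq_le_two_mul _ _
    _ = 2 * ∫ ω, ‖φ (w ω) (ξ t ω)‖ ^ 2 ∂μ + 2 * ∫ ω, ‖∫ s, φ (w ω) s ∂ν‖ ^ 2 ∂μ := by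
        rw [← integral_const_mul, ← integral_const_mul]
        exact integral_add i1 i2
    _ ≤ _ := by linarith

/-- A process adapted to the samples, with values in `X` from time `2` on, together with its
extrapolation `w`. -/
structure ExtrapolatedProcess (ξ : ℕ → Ω → Ξ) (X : Set (Eu n)) (x w : ℕ → Ω → Eu n)
    (β : ℕ → ℝ) : Prop where
  meas_x : ∀ t, 1 ≤ t → Measurable[history ξ t] (x t)
  meas_w : ∀ t, 1 ≤ t → Measurable[history ξ t] (w t)
  bdd_x : ∀ t, 1 ≤ t → ∃ K, ∀ ω, ‖x t ω‖ ≤ K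
  bdd_w : ∀ t, 1 ≤ t → ∃ K, ∀ ω, ‖w t ω‖ ≤ K
  mem : ∀ t, 2 ≤ t → ∀ ω, x t ω ∈ X
  step : ∀ t, 1 ≤ t → ∀ ω, x (t + 1) ω = (1 - β t) • x t ω + β t • w (t + 1) ω

/-- The running average of samples of `φ` along the extrapolated process. -/
structure RunningAverage (ξ : ℕ → Ω → Ξ) (φ : Eu n → Ξ → Eu k) (w : ℕ → Ω → Eu n)
    (β : ℕ → ℝ) (y : ℕ → Ω → Eu k) : Prop where
  init : ∀ ω, y 1 ω = 0
  step : ∀ t, 1 ≤ t → ∀ ω,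
    y (t + 1) ω = (1 - β t) • y t ω + β t • φ (w (t + 1) ω) (ξ (t + 1) ω)

omit mΩ in
-- `y t` contains the sample `ξ t`, so it is known only at the next stage of the history;
-- `measurable_mean` gains one stage for the averaged means.
theorem RunningAverage.measurable {x w : ℕ → Ω → Eu n} {β : ℕ → ℝ} {y : ℕ → Ω → Eu k}
    (hy : RunningAverage ξ φ w β y) (hE : ExtrapolatedProcess ξ X x w β)
    (hφ : InnerAssumptions X ν φ) : ∀ t, 1 ≤ t → Measurable[history ξ (t + 1)] (y t) := by
  intro t ht
  induction t, ht using Nat.le_induction with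
  | base =>
    rw [show y 1 = fun _ => 0 from funext hy.init]
    exact measurable_const
  | succ t ht ih =>
    rw [show y (t + 1) = _ from funext (hy.step t ht)]
    have h1 : Measurable[history ξ (t + 1 + 1)] (y t) :=
      ih.mono (history_mono ξ (Nat.le_succ _)) le_rfl
    have h2 : Measurable[history ξ (t + 1 + 1)] (w (t + 1)) :=
      (hE.meas_w _ (by omega)).mono (history_mono ξ (Nat.le_succ _)) le_rfl
    have h3 := hφ.measurable_uncurry.comp (h2.prodMk (measurable_history ξ (Nat.lt_succ_self (t + 1))))
    exact (h1.const_smul (1 - β t)).add (h3.const_smul (β t))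

omit mΩ in
theorem CompProblem.InnerAssumptions.exists_norm_mean_le [IsProbabilityMeasure ν]
    (hφ : InnerAssumptions X ν φ) (f : Ω → Eu n) (hf : ∃ K, ∀ ω, ‖f ω‖ ≤ K) :
    ∃ K, ∀ ω, ‖∫ s, φ (f ω) s ∂ν‖ ≤ K := by
  obtain ⟨Lm, hLm⟩ := hφ.lipschitz_mean
  set m : Eu n → Eu k := fun x => ∫ s, φ x s ∂ν
  obtain ⟨K, hK⟩ := hf
  refine ⟨Lm * K + ‖m 0‖, fun ω => ?_⟩
  have h1 := hLm.norm_sub_le (f ω) 0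
  rw [sub_zero] at h1
  calc ‖m (f ω)‖ ≤ ‖m (f ω) - m 0‖ + ‖m 0‖ := by simpa using norm_add_le (m (f ω) - m 0) (m 0)
    _ ≤ Lm * ‖f ω‖ + ‖m 0‖ := by gcongr
    _ ≤ _ := by gcongr; exact hK ω

omit mΩ [MeasurableSpace Ξ] in
theorem exists_runningAverage (ξ : ℕ → Ω → Ξ) (φ : Eu n → Ξ → Eu k) (w : ℕ → Ω → Eu n)
    (β : ℕ → ℝ) : ∃ y, RunningAverage ξ φ w β y := by
  refine ⟨fun t => Nat.rec (fun _ => 0) (fun t f ω =>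
    if t = 0 then 0 else (1 - β t) • f ω + β t • φ (w (t + 1) ω) (ξ (t + 1) ω)) t,
    fun ω => by simp, fun t ht ω => ?_⟩
  have : t ≠ 0 := by omega
  simp [this]

omit mΩ in
-- The averaged means see only w up to time t, which is determined before `ξ t`. This is what frees
-- the bias from the sample used in the gradient.
theorem RunningAverage.measurable_mean [IsProbabilityMeasure ν]
    {x w : ℕ → Ω → Eu n} {β : ℕ → ℝ} {ybar : ℕ → Ω → Eu k}
    (hyb : RunningAverage ξ (fun x _ => ∫ s, φ x s ∂ν) w β ybar)
    (hE : ExtrapolatedProcess ξ X x w β) (hφ : InnerAssumptions X ν φ) :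
    ∀ t, 1 ≤ t → Measurable[history ξ t] (ybar t) := by
  set m : Eu n → Eu k := fun x => ∫ s, φ x s ∂ν
  have hmc : Continuous m := hφ.smooth.1.continuous
  intro t ht
  induction t, ht using Nat.le_induction with
  | base =>
    rw [show ybar 1 = fun _ => 0 from funext hyb.init]
    exact measurable_const
  | succ t ht ih =>
    rw [show ybar (t + 1) = _ from funext (hyb.step t ht)]
    exact ((ih.mono (history_mono ξ (Nat.le_succ _)) le_rfl).const_smul (1 - β t)).add
      ((hmc.measurable.comp (hE.meas_w (t + 1) (by omega))).const_smul (β t))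

omit mΩ in
theorem RunningAverage.bdd_mean [IsProbabilityMeasure ν]
    {x w : ℕ → Ω → Eu n} {β : ℕ → ℝ} {ybar : ℕ → Ω → Eu k}
    (hyb : RunningAverage ξ (fun x _ => ∫ s, φ x s ∂ν) w β ybar)
    (hE : ExtrapolatedProcess ξ X x w β) (hφ : InnerAssumptions X ν φ) :
    ∀ t, 1 ≤ t → ∃ K, ∀ ω, ‖ybar t ω‖ ≤ K := by
  intro t ht
  induction t, ht using Nat.le_induction with
  | base => exact ⟨0, fun ω => by simp [hyb.init ω]⟩
  | succ t ht ih =>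
    obtain ⟨K1, hK1⟩ := ih
    obtain ⟨K2, hK2⟩ := hφ.exists_norm_mean_le _ (hE.bdd_w (t + 1) (by omega))
    refine ⟨‖1 - β t‖ * K1 + ‖β t‖ * K2, fun ω => ?_⟩
    rw [hyb.step t ht]
    refine (norm_add_le _ _).trans ?_
    rw [norm_smul, norm_smul]
    gcongr
    exacts [hK1 ω, hK2 ω]

/-- The bias of the averaged means decays like the squared ratio of the step sizes. -/
theorem RunningAverage.exists_bias_le [IsProbabilityMeasure μ] [IsProbabilityMeasure ν]
    {x w : ℕ → Ω → Eu n} {β : ℕ → ℝ} {ybar : ℕ → Ω → Eu k}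
    (hyb : RunningAverage ξ (fun x _ => ∫ s, φ x s ∂ν) w β ybar)
    (hE : ExtrapolatedProcess ξ X x w β)
    (h : IsSample ξ μ ν) (hφ : InnerAssumptions X ν φ)
    {Cb b c : ℝ}
    (hβ : ∀ t, β t = Cb * (t : ℝ) ^ (-b)) (hCb : 2 < Cb) (hb0 : 0 < b) (hbc : b ≤ c) (hc : c ≤ 1)
    {K : ℝ} (hΔ : ∀ t ≥ 2, ∫ ω, ‖x (t + 1) ω - x t ω‖ ^ 2 ∂μ ≤ K * (t : ℝ) ^ (-2 * c)) :
    (∀ t, 1 ≤ t → ∃ K, ∀ ω, ‖ybar t ω - ∫ s, φ (x t ω) s ∂ν‖ ≤ K) ∧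
    ∃ K', 0 ≤ K' ∧ ∀ t ≥ 2, ∫ ω, ‖ybar t ω - ∫ s, φ (x t ω) s ∂ν‖ ∂μ
      ≤ K' * (t : ℝ) ^ (-(2 * c - 2 * b)) := by
  set m : Eu n → Eu k := fun x => ∫ s, φ x s ∂ν with hm
  have hmc : Continuous m := hφ.smooth.1.continuous
  obtain ⟨L, hL⟩ := hφ.smooth.2
  have hβ0 : ∀ t, 1 ≤ t → 0 < β t := by
    intro t ht
    have : (0:ℝ) < t := by exact_mod_cast ht
    rw [hβ]; positivity
  have ybm := hyb.measurable_mean hE hφ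
  have ybb := hyb.bdd_mean hE hφ
  set A : ℕ → Ω → Eu k := fun t ω => ybar t ω - m (x t ω) with hA
  have hAm : ∀ t, 1 ≤ t → Measurable[history ξ t] (A t) := fun t ht =>
    (ybm t ht).sub (hmc.measurable.comp (hE.meas_x t ht))
  have hAb : ∀ t, 1 ≤ t → ∃ K, ∀ ω, ‖A t ω‖ ≤ K := by
    intro t ht
    obtain ⟨K1, hK1⟩ := ybb t ht
    obtain ⟨K2, hK2⟩ := hφ.exists_norm_mean_le _ (hE.bdd_x t ht)
    exact ⟨K1 + K2, fun ω => (norm_sub_le _ _).trans (add_le_add (hK1 ω) (hK2 ω))⟩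
  have hAi : ∀ t, 1 ≤ t → Integrable (fun ω => ‖A t ω‖) μ := fun t ht =>
    ((memLp_of_bounded (h.measurable_of_history (hAm t ht)) (hAb t ht) 1).integrable le_rfl).norm
  -- The error contracts, and the new contribution is the affinity defect of the mean on the segment
  -- from x_t to w_{t+1}.
  have hAstep : ∀ t, 1 ≤ t → β t ≤ 1 → ∀ ω,
      ‖A (t + 1) ω‖ ≤ (1 - β t) * ‖A t ω‖ + L / β t * ‖x (t + 1) ω - x t ω‖ ^ 2 := by
    intro t ht hβ1 ω
    have hd := norm_segment_defect_le hφ.smooth.1 hL (x t ω) (w (t + 1) ω) (hβ0 t ht).le hβ1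
    rw [← hE.step t ht ω] at hd
    have e1 : x (t + 1) ω - x t ω = β t • (w (t + 1) ω - x t ω) := by
      rw [hE.step t ht ω]; module
    have e2 : A (t + 1) ω = (1 - β t) • A t ω
        + ((1 - β t) • m (x t ω) + β t • m (w (t + 1) ω) - m (x (t + 1) ω)) := by
      simp only [hA, hyb.step t ht]; module
    rw [e2]
    refine (norm_add_le _ _).trans (add_le_add ?_ ?_)
    · rw [norm_smul, Real.norm_of_nonneg (by linarith)]
    · refine hd.trans (le_of_eq ?_)
      have := hβ0 t ht
      rw [e1, norm_smul, Real.norm_of_nonneg this.le]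
      field_simp
  have hΔm : ∀ t, 1 ≤ t → MemLp (fun ω => x (t + 1) ω - x t ω) 2 μ := fun t ht =>
    (memLp_of_bounded (h.measurable_of_history (hE.meas_x (t + 1) (by omega)))
      (hE.bdd_x _ (by omega)) 2).sub
      (memLp_of_bounded (h.measurable_of_history (hE.meas_x t ht)) (hE.bdd_x _ ht) 2)
  have hK0 : 0 ≤ K := by
    have h1 := (integral_nonneg fun _ => by positivity).trans (hΔ 2 le_rfl)
    exact nonneg_of_mul_nonneg_left h1 (by positivity)
  -- The forcing is t^{b-2c} = t^{-b-r} with r = 2c - 2b < 2, and `2 < Cb` supplies r < B.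
  obtain ⟨K₁, hK₁0, hK₁⟩ := exists_rpow_bound_of_recursion (e := fun t => ∫ ω, ‖A t ω‖ ∂μ)
    (b := b) (r := 2 * c - 2 * b) (B := Cb) (K := L / Cb * K) (t₀ := 2) (by norm_num) hb0
    (hbc.trans hc) (by linarith) (by linarith) (by positivity) (by
      intro t ht hβ1
      rw [← hβ] at hβ1 ⊢
      have ht0 : (0:ℝ) < t := by exact_mod_cast (by omega : 0 < t)
      have i1 := (hAi t (by omega)).const_mul (1 - β t)
      have i2 := (integrable_norm_sq (hΔm t (by omega))).const_mul (L / β t)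
      calc _ ≤ ∫ ω, ((1 - β t) * ‖A t ω‖ + L / β t * ‖x (t + 1) ω - x t ω‖ ^ 2) ∂μ :=
            integral_mono (hAi (t + 1) (by omega)) (i1.add i2) (hAstep t (by omega) hβ1)
        _ = (1 - β t) * ∫ ω, ‖A t ω‖ ∂μ + L / β t * ∫ ω, ‖x (t + 1) ω - x t ω‖ ^ 2 ∂μ := by
            rw [← integral_const_mul, ← integral_const_mul]
            exact integral_add i1 i2
        _ ≤ (1 - β t) * ∫ ω, ‖A t ω‖ ∂μ + L / β t * (K * (t : ℝ) ^ (-2 * c)) := by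
            have := (hβ0 t (by omega)).le
            gcongr
            exact hΔ t ht
        _ = _ := by
            congr 1
            have e : (t : ℝ) ^ (-b - (2 * c - 2 * b)) = (t : ℝ) ^ b * (t : ℝ) ^ (-2 * c) := by
              rw [← Real.rpow_add ht0]; congr 1; ring
            rw [e, hβ, Real.rpow_neg ht0.le]
            field_simp)
  exact ⟨hAb, K₁, hK₁0, hK₁⟩

/-- The noise of the running average is square integrable with second moments `O(β)`. -/
theorem RunningAverage.exists_noise_le [IsProbabilityMeasure μ] [IsProbabilityMeasure ν]
    {x w : ℕ → Ω → Eu n} {β : ℕ → ℝ} {y ybar : ℕ → Ω → Eu k}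
    (hy : RunningAverage ξ φ w β y)
    (hyb : RunningAverage ξ (fun x _ => ∫ s, φ x s ∂ν) w β ybar)
    (hE : ExtrapolatedProcess ξ X x w β)
    (h : IsSample ξ μ ν) (hφ : InnerAssumptions X ν φ)
    {Cb b c : ℝ}
    (hβ : ∀ t, β t = Cb * (t : ℝ) ^ (-b)) (hCb : 2 < Cb) (hb0 : 0 < b) (hbc : b ≤ c) (hc : c ≤ 1)
    {K : ℝ} (hΔ : ∀ t ≥ 2, ∫ ω, ‖x (t + 1) ω - x t ω‖ ^ 2 ∂μ ≤ K * (t : ℝ) ^ (-2 * c)) :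
    (∀ t, 1 ≤ t → MemLp (fun ω => y t ω - ybar t ω) 2 μ) ∧
    ∃ K', 0 ≤ K' ∧ ∀ t ≥ 2, ∫ ω, ‖y t ω - ybar t ω‖ ^ 2 ∂μ ≤ K' * (t : ℝ) ^ (-b) := by
  set m : Eu n → Eu k := fun x => ∫ s, φ x s ∂ν with hm
  have hmc : Continuous m := hφ.smooth.1.continuous
  have hβ0 : ∀ t, 1 ≤ t → 0 < β t := by
    intro t ht
    have : (0:ℝ) < t := by exact_mod_cast ht
    rw [hβ]; positivity
  have ybm := hyb.measurable_mean hE hφ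
  have hK0 : 0 ≤ K := by
    have h1 := (integral_nonneg fun _ => by positivity).trans (hΔ 2 le_rfl)
    exact nonneg_of_mul_nonneg_left h1 (by positivity)
  set M : ℕ → Ω → Eu k := fun t ω => y t ω - ybar t ω with hM
  obtain ⟨B, hB0, hB⟩ := h.exists_noise_sq_le hφ
  set N : ℕ → Ω → Eu k := fun t ω => φ (w (t + 1) ω) (ξ (t + 1) ω) - m (w (t + 1) ω) with hN
  have hMm : ∀ t, 1 ≤ t → Measurable[history ξ (t + 1)] (M t) := fun t ht =>
    (hy.measurable hE hφ t ht).sub ((ybm t ht).mono (history_mono ξ (Nat.le_succ _)) le_rfl)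
  have hMstep : ∀ t, 1 ≤ t → ∀ ω, M (t + 1) ω = (1 - β t) • M t ω + β t • N t ω := by
    intro t ht ω
    simp only [hM, hN, hy.step t ht, hyb.step t ht]; module
  have hwL2 : ∀ t, 1 ≤ t → MemLp (w (t + 1)) 2 μ := fun t ht =>
    memLp_of_bounded (h.measurable_of_history (hE.meas_w (t + 1) (by omega)))
      (hE.bdd_w _ (by omega)) 2
  have hxL2 : ∀ t, 1 ≤ t → MemLp (x t) 2 μ := fun t ht =>
    memLp_of_bounded (h.measurable_of_history (hE.meas_x t ht)) (hE.bdd_x _ ht) 2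
  have hNL2 : ∀ t, 1 ≤ t → MemLp (N t) 2 μ := fun t ht =>
    -- For integrability any reference in `X` will do; x_2 is used because x_1 may lie outside `X`.
    (hB (t + 1) (x 2) (w (t + 1)) (hE.mem 2 le_rfl) (hE.meas_w _ (by omega))
      (integrable_norm_sq ((hwL2 t ht).sub (hxL2 2 (by norm_num))))).1
  have hML2 : ∀ t, 1 ≤ t → MemLp (M t) 2 μ := by
    intro t ht
    induction t, ht using Nat.le_induction with
    | base =>
      rw [show M 1 = fun _ => 0 from funext fun ω => by simp [hM, hy.init, hyb.init]]
      exact MemLp.zero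
    | succ t ht ih =>
      rw [show M (t + 1) = _ from funext (hMstep t ht)]
      exact (ih.const_smul (1 - β t)).add ((hNL2 t ht).const_smul (β t))
  have hinner : ∀ {f g : Ω → Eu k}, MemLp f 2 μ → MemLp g 2 μ →
      Integrable (fun ω => (inner ℝ (f ω) (g ω) : ℝ)) μ := by
    intro f g hf hg
    refine ((integrable_norm_sq hf).add (integrable_norm_sq hg)).mono'
      (hf.1.inner hg.1) (Filter.Eventually.of_forall fun ω => ?_)
    have := norm_inner_le_norm (𝕜 := ℝ) (f ω) (g ω)
    show _ ≤ ‖f ω‖ ^ 2 + ‖g ω‖ ^ 2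
    nlinarith [sq_nonneg (‖f ω‖ - ‖g ω‖)]
  -- Both M_t and w_{t+1} are known before `ξ (t + 1)`, and given them N_t is centred.
  have horth : ∀ t, 1 ≤ t → ∫ ω, inner ℝ (M t ω) (N t ω) ∂μ = 0 := by
    intro t ht
    have hwm := hE.meas_w (t + 1) (by omega)
    have l1 : MemLp (fun ω => m (w (t + 1) ω)) 2 μ :=
      memLp_of_bounded (hmc.measurable.comp (h.measurable_of_history hwm))
        (hφ.exists_norm_mean_le _ (hE.bdd_w _ (by omega))) 2
    have l2 : MemLp (fun ω => φ (w (t + 1) ω) (ξ (t + 1) ω)) 2 μ := by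
      have := (hNL2 t ht).add l1
      refine this.congr_norm ?_ (Filter.Eventually.of_forall fun ω => by simp [hN])
      exact (hφ.measurable_uncurry.comp
        ((h.measurable_of_history hwm).prodMk (h.meas _))).aestronglyMeasurable
    have e1 := h.integral_inner_sample hφ hwm (hMm t ht) (hinner (hML2 t ht) l2)
    simp only [hN, inner_sub_right]
    rw [integral_sub (hinner (hML2 t ht) l2) (hinner (hML2 t ht) l1), e1, sub_self]
  -- By orthogonality the squared errors contract by (1 - β)² ≤ 1 - β, with forcing of order β² ~
  -- t^{-b-b}; hence r = b.
  obtain ⟨K₂, hK₂0, hK₂⟩ := exists_rpow_bound_of_recursion (e := fun t => ∫ ω, ‖M t ω‖ ^ 2 ∂μ)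
    (b := b) (r := b) (B := Cb) (K := Cb ^ 2 * (B * (1 + K / Cb ^ 2))) (t₀ := 2) (by norm_num) hb0
    (hbc.trans hc) hb0.le (by linarith) (by positivity) (by
      intro t ht hβ1
      rw [← hβ] at hβ1 ⊢
      have ht0 : (0:ℝ) < t := by exact_mod_cast (by omega : 0 < t)
      have ht1 : (1:ℝ) ≤ t := by exact_mod_cast (by omega : 1 ≤ t)
      have hβp := hβ0 t (by omega)
      have i1 := (integrable_norm_sq (hML2 t (by omega))).const_mul ((1 - β t) ^ 2)
      have i2 := (hinner (hML2 t (by omega)) (hNL2 t (by omega))).const_mul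
        (2 * (1 - β t) * β t)
      have i3 := (integrable_norm_sq (hNL2 t (by omega))).const_mul (β t ^ 2)
      have e1 : ∫ ω, ‖M (t + 1) ω‖ ^ 2 ∂μ
          = (1 - β t) ^ 2 * ∫ ω, ‖M t ω‖ ^ 2 ∂μ + β t ^ 2 * ∫ ω, ‖N t ω‖ ^ 2 ∂μ := by
        have e : ∀ ω, ‖M (t + 1) ω‖ ^ 2 = (1 - β t) ^ 2 * ‖M t ω‖ ^ 2
            + 2 * (1 - β t) * β t * inner ℝ (M t ω) (N t ω) + β t ^ 2 * ‖N t ω‖ ^ 2 := by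
          intro ω
          rw [hMstep t (by omega), norm_add_sq_real, norm_smul, norm_smul, mul_pow, mul_pow,
            inner_smul_left, inner_smul_right, Real.norm_eq_abs, Real.norm_eq_abs, sq_abs, sq_abs]
          simp only [conj_trivial]
          ring
        simp_rw [e]
        have a1 := integral_add (i1.add i2) i3
        have a2 := integral_add i1 i2
        simp only [Pi.add_apply] at a1
        rw [a1, a2, integral_const_mul, integral_const_mul, integral_const_mul,
          horth t (by omega)]
        ring
      -- The extrapolation divides the increment by β, giving t^{2b-2c}; it stays bounded because b
      -- ≤ c.
      have e2 : ∫ ω, ‖w (t + 1) ω - x t ω‖ ^ 2 ∂μ ≤ K / Cb ^ 2 := by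
        have e3 : ∀ ω, ‖w (t + 1) ω - x t ω‖ ^ 2 = (β t ^ 2)⁻¹ * ‖x (t + 1) ω - x t ω‖ ^ 2 := by
          intro ω
          have : x (t + 1) ω - x t ω = β t • (w (t + 1) ω - x t ω) := by
            rw [hE.step t (by omega) ω]; module
          rw [this, norm_smul, Real.norm_of_nonneg hβp.le, mul_pow]
          field_simp
        simp_rw [e3]
        rw [integral_const_mul]
        calc _ ≤ (β t ^ 2)⁻¹ * (K * (t : ℝ) ^ (-2 * c)) := by gcongr; exact hΔ t ht
          _ = K / Cb ^ 2 * (t : ℝ) ^ (2 * b - 2 * c) := by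
            have e4 : (t : ℝ) ^ (2 * b - 2 * c) = ((t : ℝ) ^ b) ^ 2 * (t : ℝ) ^ (-2 * c) := by
              rw [← Real.rpow_natCast, ← Real.rpow_mul ht0.le, ← Real.rpow_add ht0]
              congr 1; push_cast; ring
            rw [e4, hβ, Real.rpow_neg ht0.le]
            field_simp
          _ ≤ K / Cb ^ 2 * 1 := by
            gcongr
            exact Real.rpow_le_one_of_one_le_of_nonpos ht1 (by linarith)
          _ = _ := mul_one _
      have e5 : ∫ ω, ‖N t ω‖ ^ 2 ∂μ ≤ B * (1 + K / Cb ^ 2) := by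
        refine (hB (t + 1) (x t) (w (t + 1)) (hE.mem t ht) (hE.meas_w _ (by omega))
          (integrable_norm_sq ((hwL2 t (by omega)).sub (hxL2 t (by omega))))).2.trans ?_
        gcongr
      have e6 : (t : ℝ) ^ (-b - b) = ((t : ℝ) ^ (-b)) ^ 2 := by
        rw [← Real.rpow_natCast, ← Real.rpow_mul ht0.le]
        congr 1; push_cast; ring
      have e7 : 0 ≤ ∫ ω, ‖M t ω‖ ^ 2 ∂μ := integral_nonneg fun _ => by positivity
      show ∫ ω, ‖M (t + 1) ω‖ ^ 2 ∂μ ≤ _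
      rw [e1]
      refine add_le_add ?_ ?_
      · gcongr
        nlinarith
      · calc _ ≤ β t ^ 2 * (B * (1 + K / Cb ^ 2)) := by gcongr
          _ = _ := by rw [e6, hβ]; ring)
  exact ⟨hML2, K₂, hK₂0, hK₂⟩

end Tracking

/-! ### Bias of the sampled gradient -/

section StochasticGradient

open CompProblem

variable {Ω Ξ : Type*} [mΩ : MeasurableSpace Ω] [MeasurableSpace Ξ]
  {ξ : ℕ → Ω → Ξ} {μ : Measure Ω} {ν : Measure Ξ} {n k : ℕ} {X : Set (Eu n)}
  {φ : Eu n → Ξ → Eu k}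

/-- The rate at which the running averages track the means. -/
noncomputable def trackingRate (b c : ℝ) (t : ℕ) : ℝ :=
  (t : ℝ) ^ (-(2 * c - 2 * b)) + (t : ℝ) ^ (-(b / 2))

theorem trackingRate_nonneg (b c : ℝ) (t : ℕ) : 0 ≤ trackingRate b c t := by
  unfold trackingRate; positivity

theorem IsSample.measurable_fderiv_sample (h : IsSample ξ μ ν) (hφ : InnerAssumptions X ν φ)
    {t : ℕ} {x : Ω → Eu n} (hx : Measurable x) :
    Measurable fun ω => fderiv ℝ (fun x => φ x (ξ t ω)) (x ω) :=
  hφ.measurable_fderiv.comp (hx.prodMk (h.meas t))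

/-- Replacing the mean by the running average in a sampled directional derivative costs at most
the tracking rate. -/
theorem RunningAverage.exists_integral_inner_fderiv_ge
    [IsProbabilityMeasure μ] [IsProbabilityMeasure ν]
    {x w : ℕ → Ω → Eu n} {β : ℕ → ℝ} {y : ℕ → Ω → Eu k}
    (hy : RunningAverage ξ φ w β y) (hE : ExtrapolatedProcess ξ X x w β)
    (h : IsSample ξ μ ν) (hφ : InnerAssumptions X ν φ)
    {κ : Eu k → Eu k} {Lκ : NNReal} (hκ : LipschitzWith Lκ κ) {Kκ : ℝ} (hκb : ∀ y, ‖κ y‖ ≤ Kκ)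
    {u : Eu n} {D : ℝ} (hD : ∀ x ∈ X, ‖x - u‖ ≤ D)
    {Cb b c : ℝ}
    (hβ : ∀ t, β t = Cb * (t : ℝ) ^ (-b)) (hCb : 2 < Cb) (hb0 : 0 < b) (hbc : b ≤ c) (hc : c ≤ 1)
    {K : ℝ} (hΔ : ∀ t ≥ 2, ∫ ω, ‖x (t + 1) ω - x t ω‖ ^ 2 ∂μ ≤ K * (t : ℝ) ^ (-2 * c)) :
    ∃ K', 0 ≤ K' ∧ ∀ t ≥ 2,
      Integrable (fun ω => (inner ℝ (κ (y t ω))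
        (fderiv ℝ (fun x => φ x (ξ t ω)) (x t ω) (x t ω - u)) : ℝ)) μ ∧
      ∫ ω, inner ℝ (κ (∫ s, φ (x t ω) s ∂ν))
        (fderiv ℝ (fun x => ∫ s, φ x s ∂ν) (x t ω) (x t ω - u)) ∂μ - K' * trackingRate b c t ≤
      ∫ ω, inner ℝ (κ (y t ω)) (fderiv ℝ (fun x => φ x (ξ t ω)) (x t ω) (x t ω - u)) ∂μ := by
  obtain ⟨ybar, hyb⟩ := exists_runningAverage ξ (fun x _ => ∫ s, φ x s ∂ν) w β
  obtain ⟨hAb, K₁, hK₁0, hK₁⟩ := hyb.exists_bias_le hE h hφ hβ hCb hb0 hbc hc hΔ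
  obtain ⟨hML2, K₂, hK₂0, hK₂⟩ := hy.exists_noise_le hyb hE h hφ hβ hCb hb0 hbc hc hΔ
  obtain ⟨B, hB0, hB⟩ := h.exists_weighted_fderiv_sq_le hφ
  have hm : Continuous fun x => ∫ s, φ x s ∂ν := hφ.smooth.1.continuous
  have hyb' := hyb.measurable_mean hE hφ
  obtain ⟨x0⟩ : Nonempty Ω := nonempty_of_isProbabilityMeasure μ
  have hD0 : 0 ≤ D := (norm_nonneg _).trans (hD _ (hE.mem 2 le_rfl x0))
  have hKκ0 : 0 ≤ Kκ := (norm_nonneg _).trans (hκb 0)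
  refine ⟨Lκ * D * (K₁ + B * K₁ + B + K₂), by positivity, fun t ht => ?_⟩
  have ht0 : (0:ℝ) < t := by exact_mod_cast (by omega : 0 < t)
  have hxh := hE.meas_x t (by omega)
  have hxm := h.measurable_of_history hxh
  have hym := h.measurable_of_history (hy.measurable hE hφ t (by omega))
  set A : Ω → Eu k := fun ω => ybar t ω - ∫ s, φ (x t ω) s ∂ν with hA
  set M : Ω → Eu k := fun ω => y t ω - ybar t ω with hM
  set T : Ω → Eu n →L[ℝ] Eu k := fun ω => fderiv ℝ (fun x => φ x (ξ t ω)) (x t ω) with hT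
  have hTm : Measurable T := h.measurable_fderiv_sample hφ hxm
  have hAh : Measurable[history ξ t] A := (hyb' t (by omega)).sub (hm.measurable.comp hxh)
  have hAi : Integrable (fun ω => ‖A ω‖) μ :=
    ((memLp_of_bounded (h.measurable_of_history hAh) (hAb t (by omega)) 1).integrable le_rfl).norm
  obtain ⟨iT, bT⟩ := hB t (x t) (fun _ => 1) hxh measurable_const (fun _ => zero_le_one)
    (integrable_const 1)
  -- The bias A is determined before `ξ t`, so the Jacobian's second moment factors out: E[‖A‖‖T‖²]
  -- ≤ B E‖A‖.
  obtain ⟨iAT, bAT⟩ := hB t (x t) (fun ω => ‖A ω‖) hxh (measurable_norm.comp hAh) (fun _ => norm_nonneg _) hAi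
  simp only [one_mul, integral_const, probReal_univ, smul_eq_mul, mul_one] at iT bT
  have hTi : Integrable (fun ω => 1 + ‖T ω‖ ^ 2) μ := (integrable_const 1).add iT
  have hTle : ∀ ω, ‖T ω‖ ≤ 1 + ‖T ω‖ ^ 2 := fun ω => by nlinarith [sq_nonneg (‖T ω‖ - 1)]
  have hTv : Measurable fun ω => T ω (x t ω - u) :=
    (isBoundedBilinearMap_apply (𝕜 := ℝ) (E := Eu n) (F := Eu k)).continuous.measurable.comp
      (hTm.prodMk (hxm.sub_const u))
  have hint : ∀ z : Ω → Eu k, Measurable z →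
      Integrable (fun ω => (inner ℝ (κ (z ω)) (T ω (x t ω - u)) : ℝ)) μ := by
    intro z hz
    refine (hTi.const_mul (Kκ * D)).mono'
      ((hκ.continuous.measurable.comp hz).inner hTv).aestronglyMeasurable
      (Filter.Eventually.of_forall fun ω => ?_)
    calc _ ≤ ‖κ (z ω)‖ * ‖T ω (x t ω - u)‖ := norm_inner_le_norm _ _
      _ ≤ Kκ * (‖T ω‖ * D) := by
          gcongr
          · exact hκb _
          · exact ((T ω).le_opNorm _).trans (by gcongr; exact hD _ (hE.mem t ht ω))
      _ = Kκ * D * ‖T ω‖ := by ring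
      _ ≤ _ := by gcongr; exact hTle ω
  have hmx : Measurable fun ω => ∫ s, φ (x t ω) s ∂ν := hm.measurable.comp hxm
  refine ⟨hint _ hym, ?_⟩
  have hmh : Measurable[history ξ t] fun ω => ∫ s, φ (x t ω) s ∂ν := hm.measurable.comp hxh
  -- With the exact mean in place of y_t the weight is known before `ξ t`, so the sampled and the
  -- mean Jacobian have the same expectation; only replacing the mean by y_t remains.
  have e1 := h.integral_inner_fderiv (t := t) (x := x t) (v := fun ω => x t ω - u)
    (Z := fun ω => κ (∫ s, φ (x t ω) s ∂ν)) hφ hxh (hxh.sub_const u)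
    (hκ.continuous.measurable.comp hmh) (hint _ hmx)
  rw [← e1]
  have hMi := integrable_norm_sq (hML2 t (by omega))
  set p := (t : ℝ) ^ (-(b / 2)) with hp
  set q := (t : ℝ) ^ (b / 2) with hq
  have hp0 : 0 ≤ p := by positivity
  have hq0 : 0 ≤ q := by positivity
  have hpq : p * q = 1 := by rw [hp, hq, ← Real.rpow_add ht0]; simp
  have hqb : q * (t : ℝ) ^ (-b) = p := by
    rw [hp, hq, ← Real.rpow_add ht0]; congr 1; ring
  have j1 : Integrable (fun ω => ‖A ω‖ + ‖A ω‖ * ‖T ω‖ ^ 2) μ := hAi.add iAT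
  have j2 : Integrable (fun ω => p * ‖T ω‖ ^ 2 + q * ‖M ω‖ ^ 2) μ :=
    (iT.const_mul p).add (hMi.const_mul q)
  have hpt : ∀ ω, (inner ℝ (κ (∫ s, φ (x t ω) s ∂ν)) (T ω (x t ω - u)) : ℝ)
      - inner ℝ (κ (y t ω)) (T ω (x t ω - u)) ≤ Lκ * D *
        ((‖A ω‖ + ‖A ω‖ * ‖T ω‖ ^ 2) + (p * ‖T ω‖ ^ 2 + q * ‖M ω‖ ^ 2)) := by
    intro ω
    rw [← inner_sub_left]
    have h1 : ‖κ (∫ s, φ (x t ω) s ∂ν) - κ (y t ω)‖ ≤ Lκ * (‖A ω‖ + ‖M ω‖) := by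
      refine (hκ.norm_sub_le _ _).trans ?_
      gcongr
      rw [norm_sub_rev]
      calc _ = ‖A ω + M ω‖ := by simp only [hA, hM]; congr 1; abel
        _ ≤ _ := norm_add_le _ _
    have h2 : ‖T ω (x t ω - u)‖ ≤ ‖T ω‖ * D :=
      ((T ω).le_opNorm _).trans (by gcongr; exact hD _ (hE.mem t ht ω))
    -- M and T share `ξ t`, so Young's inequality is used with weights pq = 1. As E‖M‖² = O(t^{-b})
    -- and E‖T‖² = O(1), the choice p = t^{-b/2} makes both terms of order p.
    have h3 : ‖M ω‖ * ‖T ω‖ ≤ p * ‖T ω‖ ^ 2 + q * ‖M ω‖ ^ 2 := by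
      have hq1 : 0 < q := by positivity
      have : 0 ≤ p * (‖T ω‖ - q * ‖M ω‖) ^ 2 := by positivity
      have e : p * (‖T ω‖ - q * ‖M ω‖) ^ 2
          = p * ‖T ω‖ ^ 2 - 2 * (p * q) * (‖M ω‖ * ‖T ω‖) + (p * q) * q * ‖M ω‖ ^ 2 := by ring
      rw [e, hpq] at this
      nlinarith [mul_nonneg (norm_nonneg (M ω)) (norm_nonneg (T ω))]
    have h4 : ‖A ω‖ * ‖T ω‖ ≤ ‖A ω‖ + ‖A ω‖ * ‖T ω‖ ^ 2 := by
      have := mul_le_mul_of_nonneg_left (hTle ω) (norm_nonneg (A ω))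
      linarith
    calc _ ≤ ‖κ (∫ s, φ (x t ω) s ∂ν) - κ (y t ω)‖ * ‖T ω (x t ω - u)‖ := real_inner_le_norm _ _
      _ ≤ (Lκ * (‖A ω‖ + ‖M ω‖)) * (‖T ω‖ * D) := by gcongr
      _ = Lκ * D * (‖A ω‖ * ‖T ω‖ + ‖M ω‖ * ‖T ω‖) := by ring
      _ ≤ _ := by gcongr
  have hI := integral_mono ((hint _ hmx).sub (hint _ hym)) ((j1.add j2).const_mul (Lκ * D)) hpt
  have s1 := integral_sub (hint _ hmx) (hint _ hym)
  have s2 := integral_add j1 j2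
  have s3 := integral_add hAi iAT
  have s4 := integral_add (iT.const_mul p) (hMi.const_mul q)
  rw [integral_const_mul, integral_const_mul] at s4
  simp only [Pi.sub_apply, Pi.add_apply] at hI
  rw [s1, integral_const_mul] at hI
  have hbound : ∫ ω, ((‖A ω‖ + ‖A ω‖ * ‖T ω‖ ^ 2) + (p * ‖T ω‖ ^ 2 + q * ‖M ω‖ ^ 2)) ∂μ
      ≤ (K₁ + B * K₁ + B + K₂) * trackingRate b c t := by
    rw [s2, s3, s4]
    have b1 : ∫ ω, ‖A ω‖ ∂μ ≤ K₁ * (t : ℝ) ^ (-(2 * c - 2 * b)) := hK₁ t ht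
    have b2 := mul_le_mul_of_nonneg_left b1 hB0
    have b3 := mul_le_mul_of_nonneg_left bT hp0
    have b4 := mul_le_mul_of_nonneg_left (hK₂ t ht) hq0
    have b5 : q * (K₂ * (t : ℝ) ^ (-b)) = K₂ * p := by rw [← hqb]; ring
    unfold trackingRate
    rw [← hp]
    set o := (t : ℝ) ^ (-(2 * c - 2 * b))
    have ho : 0 ≤ o := by positivity
    have r1 : 0 ≤ (K₁ + B * K₁) * p := by positivity
    have r2 : 0 ≤ (B + K₂) * o := by positivity
    calc _ ≤ K₁ * o + B * (K₁ * o) + (p * B + K₂ * p) := by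
          rw [b5] at b4
          exact add_le_add (add_le_add b1 (bAT.trans b2)) (add_le_add b3 b4)
      _ ≤ _ := by linarith
  have hfin := mul_le_mul_of_nonneg_left hbound (by positivity : 0 ≤ (Lκ : ℝ) * D)
  change (∫ ω, inner ℝ (κ (∫ s, φ (x t ω) s ∂ν)) (T ω (x t ω - u)) ∂μ) - _ ≤
    ∫ ω, inner ℝ (κ (y t ω)) (T ω (x t ω - u)) ∂μ
  linarith

end StochasticGradient

/-! ### Outer gradient fields and regularity of the objective -/

section Fields

theorem inner_gradient {n : ℕ} {f : Eu n → ℝ} (x v : Eu n) :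
    inner ℝ (gradient f x) v = fderiv ℝ f x v := by
  rw [gradient, InnerProductSpace.toDual_symm_apply]

theorem IsSmoothReal.exists_lipschitz_gradient {n : ℕ} {f : Eu n → ℝ} (hf : IsSmoothReal f) :
    ∃ L : NNReal, LipschitzWith L (gradient f) := by
  obtain ⟨L, hL⟩ := hf.2
  have := (InnerProductSpace.toDual ℝ (Eu n)).symm.lipschitz.comp hL
  exact ⟨_, this⟩

theorem norm_gradient {n : ℕ} (f : Eu n → ℝ) (x : Eu n) : ‖gradient f x‖ = ‖fderiv ℝ f x‖ := by
  rw [gradient, LinearIsometryEquiv.norm_map]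

theorem lipschitzWith_of_norm_fderiv_le {E F : Type*} [NormedAddCommGroup E] [NormedSpace ℝ E]
    [NormedAddCommGroup F] [NormedSpace ℝ F] {f : E → F} (hd : Differentiable ℝ f) {K : ℝ}
    (hK : ∀ x, ‖fderiv ℝ f x‖ ≤ K) : ∃ L : NNReal, LipschitzWith L f := by
  refine ⟨K.toNNReal, lipschitzWith_of_nnnorm_fderiv_le hd fun x => ?_⟩
  rw [← NNReal.coe_le_coe, Real.coe_toNNReal _ ((norm_nonneg _).trans (hK x)), coe_nnnorm]
  exact hK x

namespace CompProblem

variable {n m p J : ℕ} {Ξ : Type*} [MeasurableSpace Ξ] {P : CompProblem n m p J Ξ}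
  {ν : Measure Ξ}

/-- The outer factor of the gradient of the penalized constraints. -/
noncomputable def constraintField (P : CompProblem n m p J Ξ) (Cl : ℝ) (z : Eu p) : Eu p :=
  ContinuousLinearMap.adjoint (fderiv ℝ P.q z) (clipVec Cl (P.q z))

omit [MeasurableSpace Ξ] in
theorem inner_constraintField (P : CompProblem n m p J Ξ) (Cl : ℝ) (z v : Eu p) :
    inner ℝ (P.constraintField Cl z) v = inner ℝ (clipVec Cl (P.q z)) (fderiv ℝ P.q z v) := by
  rw [constraintField, ContinuousLinearMap.adjoint_inner_left]

namespace Assumptions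

/-- A product of two bounded Lipschitz factors. The linear growth of the penalty beyond `Cl` is what
bounds `clipVec`. -/
theorem exists_constraintField_bounds (hP : P.Assumptions ν) {Cl : ℝ} (hCl : 0 ≤ Cl) :
    (∃ K, ∀ z, ‖P.constraintField Cl z‖ ≤ K) ∧
      ∃ L : NNReal, LipschitzWith L (P.constraintField Cl) := by
  obtain ⟨K, hK⟩ := hP.q_bdd
  obtain ⟨hqd, L, hL⟩ := hP.q_smooth
  obtain ⟨Lq, hLq⟩ := lipschitzWith_of_norm_fderiv_le hqd hK
  have hK0 : 0 ≤ K := (norm_nonneg _).trans (hK 0)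
  set c := √(J * Cl ^ 2) with hc
  have hc0 : 0 ≤ c := Real.sqrt_nonneg _
  constructor
  · refine ⟨K * c, fun z => ?_⟩
    refine (ContinuousLinearMap.le_opNorm _ _).trans ?_
    rw [LinearIsometryEquiv.norm_map]
    exact mul_le_mul (hK z) (norm_clipVec_le hCl _) (norm_nonneg _) hK0
  · refine ⟨Real.toNNReal (L * c + K * Lq), LipschitzWith.of_dist_le_mul fun z z' => ?_⟩
    rw [dist_eq_norm, dist_eq_norm, Real.coe_toNNReal _ (by positivity)]
    have e : P.constraintField Cl z - P.constraintField Cl z'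
        = ContinuousLinearMap.adjoint (fderiv ℝ P.q z - fderiv ℝ P.q z') (clipVec Cl (P.q z))
          + ContinuousLinearMap.adjoint (fderiv ℝ P.q z')
            (clipVec Cl (P.q z) - clipVec Cl (P.q z')) := by
      simp only [constraintField, map_sub, _root_.sub_apply]; abel
    rw [e]
    calc _ ≤ ‖fderiv ℝ P.q z - fderiv ℝ P.q z'‖ * ‖clipVec Cl (P.q z)‖
          + ‖fderiv ℝ P.q z'‖ * ‖clipVec Cl (P.q z) - clipVec Cl (P.q z')‖ := by
          refine (norm_add_le _ _).trans (add_le_add ?_ ?_)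
          · refine (ContinuousLinearMap.le_opNorm _ _).trans ?_
            rw [LinearIsometryEquiv.norm_map]
          · refine (ContinuousLinearMap.le_opNorm _ _).trans ?_
            rw [LinearIsometryEquiv.norm_map]
      _ ≤ (L * ‖z - z'‖) * c + K * (Lq * ‖z - z'‖) := by
          gcongr
          · exact hL.norm_sub_le _ _
          · exact norm_clipVec_le hCl _
          · exact hK _
          · exact (norm_clipVec_sub_le _ _ _).trans (hLq.norm_sub_le _ _)
      _ = _ := by ring

theorem exists_lipschitz_F [IsProbabilityMeasure ν] (hP : P.Assumptions ν) :
    ∃ L : NNReal, LipschitzWith L (P.F ν) := by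
  obtain ⟨K, hK⟩ := hP.f_bdd
  obtain ⟨L1, h1⟩ := lipschitzWith_of_norm_fderiv_le hP.f_smooth.1 hK
  obtain ⟨L2, h2⟩ := hP.g_inner.lipschitz_mean
  exact ⟨_, h1.comp h2⟩

theorem exists_lipschitz_Q [IsProbabilityMeasure ν] (hP : P.Assumptions ν) :
    ∃ L : NNReal, LipschitzWith L (P.Q ν) := by
  obtain ⟨K, hK⟩ := hP.q_bdd
  obtain ⟨L1, h1⟩ := lipschitzWith_of_norm_fderiv_le hP.q_smooth.1 hK
  obtain ⟨L2, h2⟩ := hP.h_inner.lipschitz_mean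
  exact ⟨_, h1.comp h2⟩

theorem inner_gradient_f (hP : P.Assumptions ν) (x v : Eu n) :
    inner ℝ (gradient P.f (∫ s, P.g x s ∂ν)) (fderiv ℝ (fun x => ∫ s, P.g x s ∂ν) x v)
      = fderiv ℝ (P.F ν) x v := by
  rw [inner_gradient]
  have := (hP.f_smooth.1 (∫ s, P.g x s ∂ν)).hasFDerivAt.comp x (hP.g_inner.smooth.1 x).hasFDerivAt
  rw [show P.F ν = P.f ∘ fun x => ∫ s, P.g x s ∂ν from rfl, this.fderiv]
  rfl

theorem inner_constraintField_mean (hP : P.Assumptions ν) (Cl : ℝ) (x v : Eu n) :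
    inner ℝ (P.constraintField Cl (∫ s, P.h x s ∂ν)) (fderiv ℝ (fun x => ∫ s, P.h x s ∂ν) x v)
      = inner ℝ (clipVec Cl (P.Q ν x)) (fderiv ℝ (P.Q ν) x v) := by
  rw [inner_constraintField]
  have := (hP.q_smooth.1 (∫ s, P.h x s ∂ν)).hasFDerivAt.comp x (hP.h_inner.smooth.1 x).hasFDerivAt
  rw [show P.Q ν = P.q ∘ fun x => ∫ s, P.h x s ∂ν from rfl, this.fderiv]
  rfl

theorem measurable_r (hP : P.Assumptions ν) : Measurable P.r :=
  measurable_ereal_toReal.comp hP.R_closed.measurable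

theorem measurable_H [IsProbabilityMeasure ν] (hP : P.Assumptions ν) : Measurable (P.H ν) :=
  hP.F_smooth.1.continuous.measurable.add hP.measurable_r

theorem exists_abs_H_le (hP : P.Assumptions ν) : ∃ B, 0 ≤ B ∧ ∀ x ∈ P.dom, |P.H ν x| ≤ B := by
  obtain ⟨B, hB⟩ := hP.isCompact_dom.exists_bound_of_continuousOn
    (hP.F_smooth.1.continuous.continuousOn.add hP.continuousOn_r)
  exact ⟨max B 0, le_max_right _ _, fun x hx => (hB x hx).trans (le_max_left _ _)⟩

theorem H_convexOn (hP : P.Assumptions ν) : ConvexOn ℝ P.dom (P.H ν) :=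
  (hP.F_convex.subset hP.dom_subset hP.r_convexOn.1).add hP.r_convexOn

end Assumptions

end CompProblem

end Fields

/-! ### The iterates as random variables -/

section Run

namespace CompProblem

variable {Ω Ξ : Type*} [mΩ : MeasurableSpace Ω] [MeasurableSpace Ξ] {n m p J : ℕ}

/-- The iterates `x_t` as random variables. -/
noncomputable def iterX (P : CompProblem n m p J Ξ) (Cl : ℝ) (α β δ : ℕ → ℝ) (x1 : Eu n)
    (ξ : ℕ → Ω → Ξ) (t : ℕ) (ω : Ω) : Eu n := (P.run Cl α β δ x1 (fun i => ξ i ω) t).x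

/-- The extrapolated points `w_t` as random variables. -/
noncomputable def iterW (P : CompProblem n m p J Ξ) (Cl : ℝ) (α β δ : ℕ → ℝ) (x1 : Eu n)
    (ξ : ℕ → Ω → Ξ) (t : ℕ) (ω : Ω) : Eu n := (P.run Cl α β δ x1 (fun i => ξ i ω) t).w

/-- The running averages `y_t` as random variables. -/
noncomputable def iterY (P : CompProblem n m p J Ξ) (Cl : ℝ) (α β δ : ℕ → ℝ) (x1 : Eu n)
    (ξ : ℕ → Ω → Ξ) (t : ℕ) (ω : Ω) : Eu m := (P.run Cl α β δ x1 (fun i => ξ i ω) t).y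

/-- The running averages `z_t` as random variables. -/
noncomputable def iterZ (P : CompProblem n m p J Ξ) (Cl : ℝ) (α β δ : ℕ → ℝ) (x1 : Eu n)
    (ξ : ℕ → Ω → Ξ) (t : ℕ) (ω : Ω) : Eu p := (P.run Cl α β δ x1 (fun i => ξ i ω) t).z

/-- The sampled gradient step at time `t`. -/
noncomputable def direction (P : CompProblem n m p J Ξ) (Cl : ℝ) (α β δ : ℕ → ℝ) (x1 : Eu n)
    (ξ : ℕ → Ω → Ξ) (t : ℕ) (ω : Ω) : Eu n :=
  α t • ContinuousLinearMap.adjoint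
      (fderiv ℝ (fun x => P.g x (ξ t ω)) (P.iterX Cl α β δ x1 ξ t ω))
      (gradient P.f (P.iterY Cl α β δ x1 ξ t ω))
    + δ t • ContinuousLinearMap.adjoint
      (fderiv ℝ (fun x => P.h x (ξ t ω)) (P.iterX Cl α β δ x1 ξ t ω))
      (P.constraintField Cl (P.iterZ Cl α β δ x1 ξ t ω))

variable {P : CompProblem n m p J Ξ} {ν : Measure Ξ} {Cl : ℝ} {α β δ : ℕ → ℝ} {x1 : Eu n}
  {ξ : ℕ → Ω → Ξ}

omit [MeasurableSpace Ξ] in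
theorem run_succ {s : ℕ → Ξ} {t : ℕ} (ht : 1 ≤ t) :
    P.run Cl α β δ x1 s (t + 1) = P.step Cl (α t) (β t) (δ t) (s t) (s (t + 1))
      (P.run Cl α β δ x1 s t) := by
  obtain ⟨t, rfl⟩ := Nat.exists_eq_add_of_le' ht
  rfl

omit mΩ [MeasurableSpace Ξ] in
theorem iterX_succ (hCl : 0 ≤ Cl) {t : ℕ} (ht : 1 ≤ t) (ω : Ω) :
    P.iterX Cl α β δ x1 ξ (t + 1) ω
      = prox (α t) P.R (P.iterX Cl α β δ x1 ξ t ω - P.direction Cl α β δ x1 ξ t ω) := by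
  rw [iterX, run_succ ht, direction, ← sub_sub]
  simp only [step, constraintField, gradient_penalty hCl]
  rfl

omit mΩ [MeasurableSpace Ξ] in
theorem iterW_succ {t : ℕ} (ht : 1 ≤ t) (ω : Ω) :
    P.iterW Cl α β δ x1 ξ (t + 1) ω = (1 - 1 / β t) • P.iterX Cl α β δ x1 ξ t ω
      + (1 / β t) • P.iterX Cl α β δ x1 ξ (t + 1) ω := by
  simp only [iterW, iterX, run_succ ht, step]

omit mΩ [MeasurableSpace Ξ] in
theorem iterY_average : RunningAverage ξ P.g (P.iterW Cl α β δ x1 ξ) β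
    (P.iterY Cl α β δ x1 ξ) where
  init _ := rfl
  step t ht ω := by simp only [iterY, iterW, run_succ ht, step]

omit mΩ [MeasurableSpace Ξ] in
theorem iterZ_average : RunningAverage ξ P.h (P.iterW Cl α β δ x1 ξ) β
    (P.iterZ Cl α β δ x1 ξ) where
  init _ := rfl
  step t ht ω := by simp only [iterZ, iterW, run_succ ht, step]

/-- Measurability of a sampled gradient. -/
theorem measurable_adjoint_fderiv {k : ℕ} {X : Set (Eu n)} {φ : Eu n → Ξ → Eu k}
    (hφ : InnerAssumptions X ν φ) {κ : Eu k → Eu k} (hκ : Measurable κ)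
    {x : Ω → Eu n} {s : Ω → Ξ} {y : Ω → Eu k} (hx : Measurable x) (hs : Measurable s)
    (hy : Measurable y) :
    Measurable fun ω => ContinuousLinearMap.adjoint (fderiv ℝ (fun x => φ x (s ω)) (x ω))
      (κ (y ω)) := by
  have h1 : Measurable fun ω => ContinuousLinearMap.adjoint (fderiv ℝ (fun x => φ x (s ω)) (x ω)) :=
    (ContinuousLinearMap.adjoint (𝕜 := ℝ) (E := Eu n) (F := Eu k)).continuous.measurable.comp
      (hφ.measurable_fderiv.comp (hx.prodMk hs))
  exact (isBoundedBilinearMap_apply (𝕜 := ℝ) (E := Eu k) (F := Eu n)).continuous.measurable.comp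
    (h1.prodMk (hκ.comp hy))

namespace Assumptions

omit mΩ in
theorem iterX_mem_dom (hP : P.Assumptions ν) (hne : P.dom.Nonempty) (hCl : 0 ≤ Cl)
    (hα : ∀ t, 1 ≤ t → 0 < α t) {t : ℕ} (ht : 2 ≤ t) (ω : Ω) :
    P.iterX Cl α β δ x1 ξ t ω ∈ P.dom := by
  obtain ⟨t, rfl⟩ := Nat.exists_eq_add_of_le' (by omega : 1 ≤ t)
  rw [iterX_succ hCl (by omega)]
  exact hP.prox_mem_dom hne (hα t (by omega)) _

omit mΩ in
-- The four processes are treated in one induction: x_{t+1} needs y_t, z_t and `ξ t`, all known at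
-- stage t + 1, while the averages lag one stage behind.
theorem measurable_run (hP : P.Assumptions ν) (hne : P.dom.Nonempty) (hCl : 0 ≤ Cl)
    (hα : ∀ t, 1 ≤ t → 0 < α t) : ∀ t, 1 ≤ t →
    Measurable[history ξ t] (P.iterX Cl α β δ x1 ξ t) ∧
    Measurable[history ξ t] (P.iterW Cl α β δ x1 ξ t) ∧
    Measurable[history ξ (t + 1)] (P.iterY Cl α β δ x1 ξ t) ∧
    Measurable[history ξ (t + 1)] (P.iterZ Cl α β δ x1 ξ t) := by
  intro t ht
  induction t, ht using Nat.le_induction with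
  | base => exact ⟨measurable_const, measurable_const, measurable_const, measurable_const⟩
  | succ t ht ih =>
    obtain ⟨hx, hw, hy, hz⟩ := ih
    have hx' : Measurable[history ξ (t + 1)] (P.iterX Cl α β δ x1 ξ t) :=
      hx.mono (history_mono ξ (Nat.le_succ _)) le_rfl
    have hs : Measurable[history ξ (t + 1)] (ξ t) := measurable_history ξ (Nat.lt_succ_self t)
    obtain ⟨Lf, hLf⟩ := hP.f_smooth.exists_lipschitz_gradient
    obtain ⟨-, Lq, hLq⟩ := hP.exists_constraintField_bounds hCl
    have hd : Measurable[history ξ (t + 1)] (P.direction Cl α β δ x1 ξ t) :=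
      ((measurable_adjoint_fderiv (mΩ := history ξ (t + 1)) hP.g_inner hLf.continuous.measurable
        hx' hs hy).const_smul (α t)).add
      ((measurable_adjoint_fderiv (mΩ := history ξ (t + 1)) hP.h_inner hLq.continuous.measurable
        hx' hs hz).const_smul (δ t))
    have hxs : Measurable[history ξ (t + 1)] (P.iterX Cl α β δ x1 ξ (t + 1)) := by
      rw [show P.iterX Cl α β δ x1 ξ (t + 1) = _ from funext (iterX_succ hCl ht)]
      exact (hP.prox_nonexpansive hne (hα t ht)).continuous.measurable.comp (hx'.sub hd)
    have hws : Measurable[history ξ (t + 1)] (P.iterW Cl α β δ x1 ξ (t + 1)) := by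
      rw [show P.iterW Cl α β δ x1 ξ (t + 1) = _ from funext (iterW_succ ht)]
      exact (hx'.const_smul (1 - 1 / β t)).add (hxs.const_smul (1 / β t))
    have hws' : Measurable[history ξ (t + 1 + 1)] (P.iterW Cl α β δ x1 ξ (t + 1)) :=
      hws.mono (history_mono ξ (Nat.le_succ _)) le_rfl
    have hs' : Measurable[history ξ (t + 1 + 1)] (ξ (t + 1)) :=
      measurable_history ξ (Nat.lt_succ_self (t + 1))
    refine ⟨hxs, hws, ?_, ?_⟩
    · rw [show P.iterY Cl α β δ x1 ξ (t + 1) = _ from funext (iterY_average.step t ht)]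
      exact ((hy.mono (history_mono ξ (Nat.le_succ _)) le_rfl).const_smul (1 - β t)).add
        ((hP.g_inner.measurable_uncurry.comp (hws'.prodMk hs')).const_smul (β t))
    · rw [show P.iterZ Cl α β δ x1 ξ (t + 1) = _ from funext (iterZ_average.step t ht)]
      exact ((hz.mono (history_mono ξ (Nat.le_succ _)) le_rfl).const_smul (1 - β t)).add
        ((hP.h_inner.measurable_uncurry.comp (hws'.prodMk hs')).const_smul (β t))

omit mΩ in
theorem extrapolatedProcess (hP : P.Assumptions ν) (hne : P.dom.Nonempty) (hCl : 0 ≤ Cl)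
    (hα : ∀ t, 1 ≤ t → 0 < α t) (hβ : ∀ t, 1 ≤ t → 0 < β t) :
    ExtrapolatedProcess ξ P.X (P.iterX Cl α β δ x1 ξ) (P.iterW Cl α β δ x1 ξ) β := by
  have hmem : ∀ t, 2 ≤ t → ∀ ω, P.iterX Cl α β δ x1 ξ t ω ∈ P.X := fun t ht ω =>
    hP.dom_subset (hP.iterX_mem_dom hne hCl hα ht ω)
  have hbx : ∀ t, 1 ≤ t → ∃ K, ∀ ω, ‖P.iterX Cl α β δ x1 ξ t ω‖ ≤ K := by
    intro t ht
    rcases ht.eq_or_lt with rfl | ht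
    · exact ⟨‖x1‖, fun ω => le_rfl⟩
    · obtain ⟨K, hK⟩ := hP.X_compact.isBounded.exists_norm_le
      exact ⟨K, fun ω => hK _ (hmem t ht ω)⟩
  refine ⟨fun t ht => (hP.measurable_run hne hCl hα t ht).1,
    fun t ht => (hP.measurable_run hne hCl hα t ht).2.1, hbx, fun t ht => ?_, hmem,
    fun t ht ω => ?_⟩
  · rcases ht.eq_or_lt with rfl | ht
    · exact ⟨‖x1‖, fun ω => le_rfl⟩
    · obtain ⟨t, rfl⟩ := Nat.exists_eq_add_of_le' (by omega : 1 ≤ t)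
      obtain ⟨K1, hK1⟩ := hbx t (by omega)
      obtain ⟨K2, hK2⟩ := hbx (t + 1) (by omega)
      refine ⟨‖1 - 1 / β t‖ * K1 + ‖1 / β t‖ * K2, fun ω => ?_⟩
      rw [iterW_succ (by omega)]
      refine (norm_add_le _ _).trans ?_
      rw [norm_smul, norm_smul]
      gcongr
      exacts [hK1 ω, hK2 ω]
  · have := (hβ t ht).ne'
    rw [iterW_succ ht]
    match_scalars <;> field_simp
    ring

end Assumptions

end CompProblem

end Run

/-! ### Expected descent in one iteration -/

section Descent

namespace CompProblem.Assumptions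

variable {Ω Ξ : Type*} [mΩ : MeasurableSpace Ω] [MeasurableSpace Ξ] {n m p J : ℕ}
  {P : CompProblem n m p J Ξ} {ν : Measure Ξ} {Cl : ℝ} {α β δ : ℕ → ℝ} {x1 : Eu n}
  {ξ : ℕ → Ω → Ξ} {μ : Measure Ω} [IsProbabilityMeasure μ] [IsProbabilityMeasure ν]

/-- Uniform bounds on the outer factors remove y_t and z_t from the estimate, so their correlation
with `ξ t` is harmless here. -/
theorem exists_direction_sq_le (hP : P.Assumptions ν) (hne : P.dom.Nonempty) (hCl : 0 ≤ Cl)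
    (hα : ∀ t, 1 ≤ t → 0 < α t) (h : IsSample ξ μ ν) :
    ∃ K : ℝ, 0 ≤ K ∧ ∀ t, 1 ≤ t → MemLp (P.direction Cl α β δ x1 ξ t) 2 μ ∧
      ∫ ω, ‖P.direction Cl α β δ x1 ξ t ω‖ ^ 2 ∂μ ≤ K * (α t ^ 2 + δ t ^ 2) := by
  obtain ⟨Kf, hKf⟩ := hP.f_bdd
  obtain ⟨Lf, hLf⟩ := hP.f_smooth.exists_lipschitz_gradient
  obtain ⟨⟨Kq, hKq⟩, Lq, hLq⟩ := hP.exists_constraintField_bounds hCl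
  have hKf0 : 0 ≤ Kf := (norm_nonneg _).trans (hKf 0)
  have hKq0 : 0 ≤ Kq := (norm_nonneg _).trans (hKq 0)
  obtain ⟨Bg, hBg0, hBg⟩ := h.exists_weighted_fderiv_sq_le hP.g_inner
  obtain ⟨Bh, hBh0, hBh⟩ := h.exists_weighted_fderiv_sq_le hP.h_inner
  refine ⟨2 * Kf ^ 2 * Bg + 2 * Kq ^ 2 * Bh, by positivity, fun t ht => ?_⟩
  obtain ⟨hx, hw, hy, hz⟩ := hP.measurable_run (β := β) (δ := δ) (x1 := x1) (ξ := ξ) hne hCl hα t ht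
  have hxm := h.measurable_of_history hx
  have hG : Measurable (P.direction Cl α β δ x1 ξ t) :=
    ((measurable_adjoint_fderiv hP.g_inner hLf.continuous.measurable hxm (h.meas t)
      (h.measurable_of_history hy)).const_smul (α t)).add
    ((measurable_adjoint_fderiv hP.h_inner hLq.continuous.measurable hxm (h.meas t)
      (h.measurable_of_history hz)).const_smul (δ t))
  obtain ⟨ig, bg⟩ := hBg t _ (fun _ => 1) hx measurable_const (fun _ => zero_le_one)
    (integrable_const 1)
  obtain ⟨ih, bh⟩ := hBh t _ (fun _ => 1) hx measurable_const (fun _ => zero_le_one)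
    (integrable_const 1)
  simp only [one_mul, integral_const, probReal_univ, smul_eq_mul, mul_one] at ig bg ih bh
  set Tg : Ω → Eu n →L[ℝ] Eu m := fun ω =>
    fderiv ℝ (fun x => P.g x (ξ t ω)) (P.iterX Cl α β δ x1 ξ t ω) with hTg
  set Th : Ω → Eu n →L[ℝ] Eu p := fun ω =>
    fderiv ℝ (fun x => P.h x (ξ t ω)) (P.iterX Cl α β δ x1 ξ t ω) with hTh
  have hle : ∀ ω, ‖P.direction Cl α β δ x1 ξ t ω‖ ^ 2
      ≤ 2 * α t ^ 2 * Kf ^ 2 * ‖Tg ω‖ ^ 2 + 2 * δ t ^ 2 * Kq ^ 2 * ‖Th ω‖ ^ 2 := by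
    intro ω
    refine (norm_add_sq_le_two_mul _ _).trans ?_
    rw [norm_smul, norm_smul, mul_pow, mul_pow, Real.norm_eq_abs, Real.norm_eq_abs, sq_abs, sq_abs]
    have h1 : ‖ContinuousLinearMap.adjoint (Tg ω) (gradient P.f (P.iterY Cl α β δ x1 ξ t ω))‖
        ≤ ‖Tg ω‖ * Kf := by
      refine (ContinuousLinearMap.le_opNorm _ _).trans ?_
      rw [LinearIsometryEquiv.norm_map, norm_gradient]
      gcongr
      exact hKf _
    have h2 : ‖ContinuousLinearMap.adjoint (Th ω)
        (P.constraintField Cl (P.iterZ Cl α β δ x1 ξ t ω))‖ ≤ ‖Th ω‖ * Kq := by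
      refine (ContinuousLinearMap.le_opNorm _ _).trans ?_
      rw [LinearIsometryEquiv.norm_map]
      gcongr
      exact hKq _
    calc _ ≤ 2 * (α t ^ 2 * (‖Tg ω‖ * Kf) ^ 2) + 2 * (δ t ^ 2 * (‖Th ω‖ * Kq) ^ 2) := by gcongr
      _ = _ := by ring
  have i1 := ig.const_mul (2 * α t ^ 2 * Kf ^ 2)
  have i2 := ih.const_mul (2 * δ t ^ 2 * Kq ^ 2)
  have hI : Integrable (fun ω => ‖P.direction Cl α β δ x1 ξ t ω‖ ^ 2) μ :=
    (i1.add i2).mono' (hG.norm.pow_const 2).aestronglyMeasurable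
      (Filter.Eventually.of_forall fun ω => by
        rw [Real.norm_of_nonneg (by positivity)]; exact hle ω)
  refine ⟨memLp_two_of_integrable_sq hG.aestronglyMeasurable hI, ?_⟩
  have hfin := integral_mono hI (i1.add i2) hle
  have e := integral_add i1 i2
  rw [integral_const_mul, integral_const_mul] at e
  simp only [Pi.add_apply] at hfin
  rw [e] at hfin
  refine hfin.trans ?_
  have c1 : 2 * α t ^ 2 * Kf ^ 2 * ∫ ω, ‖Tg ω‖ ^ 2 ∂μ ≤ 2 * α t ^ 2 * Kf ^ 2 * Bg := by gcongr
  have c2 : 2 * δ t ^ 2 * Kq ^ 2 * ∫ ω, ‖Th ω‖ ^ 2 ∂μ ≤ 2 * δ t ^ 2 * Kq ^ 2 * Bh := by gcongr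
  have c3 : 0 ≤ 2 * Kq ^ 2 * Bh * α t ^ 2 := by positivity
  have c4 : 0 ≤ 2 * Kf ^ 2 * Bg * δ t ^ 2 := by positivity
  linarith

theorem exists_increment_sq_le (hP : P.Assumptions ν) (hne : P.dom.Nonempty) (hCl : 0 ≤ Cl)
    (hα : ∀ t, 1 ≤ t → 0 < α t) (h : IsSample ξ μ ν) :
    ∃ K : ℝ, 0 ≤ K ∧ ∀ t, 2 ≤ t →
      ∫ ω, ‖P.iterX Cl α β δ x1 ξ (t + 1) ω - P.iterX Cl α β δ x1 ξ t ω‖ ^ 2 ∂μ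
        ≤ K * (α t ^ 2 + δ t ^ 2) := by
  obtain ⟨K, hK0, hK⟩ := hP.exists_direction_sq_le (β := β) (δ := δ) (x1 := x1) hne hCl hα h
  obtain ⟨Kp, hKp0, hKp⟩ := hP.exists_norm_prox_sub_le hne
  refine ⟨2 * Kp ^ 2 + 2 * K, by positivity, fun t ht => ?_⟩
  obtain ⟨h1, h2⟩ := hK t (by omega)
  have i1 := (integrable_norm_sq h1).const_mul 2
  have hle : ∀ ω, ‖P.iterX Cl α β δ x1 ξ (t + 1) ω - P.iterX Cl α β δ x1 ξ t ω‖ ^ 2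
      ≤ 2 * (α t * Kp) ^ 2 + 2 * ‖P.direction Cl α β δ x1 ξ t ω‖ ^ 2 := by
    intro ω
    have h3 := hKp (α t) (hα t (by omega)) _
      (hP.iterX_mem_dom (β := β) (δ := δ) (x1 := x1) (ξ := ξ) hne hCl hα ht ω)
      (P.direction Cl α β δ x1 ξ t ω)
    rw [← iterX_succ hCl (by omega)] at h3
    have h4 := pow_le_pow_left₀ (norm_nonneg _) h3 2
    nlinarith [sq_nonneg (α t * Kp - ‖P.direction Cl α β δ x1 ξ t ω‖)]
  have e := integral_add (integrable_const (2 * (α t * Kp) ^ 2)) i1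
  simp only [integral_const, probReal_univ, one_smul, integral_const_mul] at e
  calc _ ≤ ∫ ω, (2 * (α t * Kp) ^ 2 + 2 * ‖P.direction Cl α β δ x1 ξ t ω‖ ^ 2) ∂μ :=
        integral_mono_of_nonneg (Filter.Eventually.of_forall fun _ => by positivity)
          ((integrable_const _).add i1) (Filter.Eventually.of_forall hle)
    _ = _ := e
    _ ≤ _ := by nlinarith [mul_nonneg (sq_nonneg Kp) (sq_nonneg (δ t))]

omit [IsProbabilityMeasure ν] in
/-- Integrability of a bounded measurable function of the iterates. -/
theorem integrable_comp_iterX (hP : P.Assumptions ν) (hne : P.dom.Nonempty) (hCl : 0 ≤ Cl)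
    (hα : ∀ t, 1 ≤ t → 0 < α t) (h : IsSample ξ μ ν) {f : Eu n → ℝ} (hf : Measurable f)
    (hb : ∃ B, ∀ x ∈ P.dom, |f x| ≤ B) {t : ℕ} (ht : 2 ≤ t) :
    Integrable (fun ω => f (P.iterX Cl α β δ x1 ξ t ω)) μ := by
  obtain ⟨B, hB⟩ := hb
  have hx := h.measurable_of_history
    (hP.measurable_run (β := β) (δ := δ) (x1 := x1) (ξ := ξ) hne hCl hα t (by omega)).1
  exact Integrable.of_bound (hf.comp hx).aestronglyMeasurable B
    (Filter.Eventually.of_forall fun ω => hB _ (hP.iterX_mem_dom hne hCl hα ht ω))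

omit [IsProbabilityMeasure ν] in
theorem exists_abs_le_of_continuous (hP : P.Assumptions ν) {f : Eu n → ℝ} (hf : Continuous f) :
    ∃ B, ∀ x ∈ P.dom, |f x| ≤ B :=
  hP.isCompact_dom.exists_bound_of_continuousOn hf.continuousOn

omit [IsProbabilityMeasure ν] in
theorem exists_abs_r_le (hP : P.Assumptions ν) : ∃ B, ∀ x ∈ P.dom, |P.r x| ≤ B :=
  hP.isCompact_dom.exists_bound_of_continuousOn hP.continuousOn_r

theorem _root_.continuous_penalty {J : ℕ} {Cl : ℝ} (hCl : 0 ≤ Cl) :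
    Continuous (penalty Cl : Eu J → ℝ) :=
  continuous_iff_continuousAt.2 fun v => (hasGradientAt_penalty hCl v).continuousAt

/-- The expected decrease of the distance to a feasible point of the domain in one iteration. -/
theorem exists_expected_descent (hP : P.Assumptions ν) (hCl : 0 ≤ Cl) (h : IsSample ξ μ ν)
    {xs : Eu n} (hxs : xs ∈ P.dom) (hfeas : ∀ j, P.Q ν xs j ≤ 0) {C Cb a b c : ℝ}
    (hα : ∀ t, α t = C * (t : ℝ) ^ (-a)) (hβ : ∀ t, β t = Cb * (t : ℝ) ^ (-b))
    (hδ : ∀ t, δ t = C * (t : ℝ) ^ (-c)) (hC : 0 < C) (hCb : 2 < Cb) (hb0 : 0 < b) (hbc : b ≤ c)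
    (hc : c ≤ 1) (hca : c ≤ a) :
    ∃ K : ℝ, 0 ≤ K ∧ ∀ t, 2 ≤ t →
      2 * α t * ∫ ω, (P.H ν (P.iterX Cl α β δ x1 ξ (t + 1) ω) - P.H ν xs) ∂μ
        + 2 * δ t * ∫ ω, penalty Cl (P.Q ν (P.iterX Cl α β δ x1 ξ (t + 1) ω)) ∂μ
      ≤ ∫ ω, ‖P.iterX Cl α β δ x1 ξ t ω - xs‖ ^ 2 ∂μ
        - ∫ ω, ‖P.iterX Cl α β δ x1 ξ (t + 1) ω - xs‖ ^ 2 ∂μ + K * (δ t * trackingRate b c t) := by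
  have hne : P.dom.Nonempty := ⟨xs, hxs⟩
  have hαp : ∀ t, 1 ≤ t → 0 < α t := by
    intro t ht
    have : (0:ℝ) < t := by exact_mod_cast ht
    rw [hα]; positivity
  have hβp : ∀ t, 1 ≤ t → 0 < β t := by
    intro t ht
    have : (0:ℝ) < t := by exact_mod_cast ht
    rw [hβ]; positivity
  have hδp : ∀ t, 1 ≤ t → 0 < δ t := by
    intro t ht
    have : (0:ℝ) < t := by exact_mod_cast ht
    rw [hδ]; positivity
  -- Since c ≤ a, the constraint step dominates, and all errors can be measured by δ.
  have hαδ : ∀ t, 1 ≤ t → α t ≤ δ t := by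
    intro t ht
    have : (1:ℝ) ≤ t := by exact_mod_cast ht
    rw [hα, hδ]
    gcongr
  have hE := hP.extrapolatedProcess (δ := δ) (x1 := x1) (ξ := ξ) hne hCl hαp hβp
  obtain ⟨KΔ, hKΔ0, hKΔ⟩ := hP.exists_increment_sq_le (β := β) (δ := δ) (x1 := x1) hne hCl hαp h
  obtain ⟨KG, hKG0, hKG⟩ := hP.exists_direction_sq_le (β := β) (δ := δ) (x1 := x1) hne hCl hαp h
  set x := P.iterX Cl α β δ x1 ξ with hx
  set G := P.direction Cl α β δ x1 ξ with hG
  have hsum : ∀ t, 1 ≤ t → α t ^ 2 + δ t ^ 2 ≤ 2 * δ t ^ 2 := by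
    intro t ht
    have := pow_le_pow_left₀ (hαp t ht).le (hαδ t ht) 2
    linarith
  have hΔδ : ∀ t ≥ 2, ∫ ω, ‖x (t + 1) ω - x t ω‖ ^ 2 ∂μ ≤ 2 * KΔ * δ t ^ 2 := by
    intro t ht
    have := mul_le_mul_of_nonneg_left (hsum t (by omega)) hKΔ0
    linarith [hKΔ t ht]
  have hΔ : ∀ t ≥ 2, ∫ ω, ‖x (t + 1) ω - x t ω‖ ^ 2 ∂μ
      ≤ (2 * KΔ * C ^ 2) * (t : ℝ) ^ (-2 * c) := by
    intro t ht
    refine (hΔδ t ht).trans (le_of_eq ?_)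
    have e : (t : ℝ) ^ (-2 * c) = ((t : ℝ) ^ (-c)) ^ 2 := by
      rw [← Real.rpow_natCast, ← Real.rpow_mul (Nat.cast_nonneg t)]
      congr 1; push_cast; ring
    rw [e, hδ]; ring
  obtain ⟨D, hD⟩ := Metric.isBounded_iff.1 hP.X_compact.isBounded
  have hDx : ∀ x ∈ P.X, ‖x - xs‖ ≤ D := fun x hx => by
    rw [← dist_eq_norm]; exact hD hx (hP.dom_subset hxs)
  obtain ⟨Kf, hKf⟩ := hP.f_bdd
  obtain ⟨Lf, hLf⟩ := hP.f_smooth.exists_lipschitz_gradient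
  obtain ⟨⟨Kq, hKq⟩, Lq, hLq⟩ := hP.exists_constraintField_bounds hCl
  obtain ⟨K₁, hK₁0, hK₁⟩ := (iterY_average (P := P) (Cl := Cl) (α := α) (β := β) (δ := δ)
    (x1 := x1) (ξ := ξ)).exists_integral_inner_fderiv_ge hE h hP.g_inner hLf (Kκ := Kf)
    (fun y => (norm_gradient _ _).trans_le (hKf y)) hDx hβ hCb hb0 hbc hc hΔ
  obtain ⟨K₂, hK₂0, hK₂⟩ := (iterZ_average (P := P) (Cl := Cl) (α := α) (β := β) (δ := δ)
    (x1 := x1) (ξ := ξ)).exists_integral_inner_fderiv_ge hE h hP.h_inner hLq hKq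
    hDx hβ hCb hb0 hbc hc hΔ
  obtain ⟨LF, hLF⟩ := hP.exists_lipschitz_F
  obtain ⟨LQ, hLQ⟩ := hP.exists_lipschitz_Q
  set LP : ℝ := √(J * Cl ^ 2) * LQ with hLP
  have hLP0 : 0 ≤ LP := by positivity
  set KD := √(2 * KΔ) with hKD
  have hKD0 : 0 ≤ KD := Real.sqrt_nonneg _
  -- In order: tracking errors of y and z, passage from x_t to x_{t+1} in F and in the penalty, and
  -- the squared direction.
  refine ⟨2 * K₁ + 2 * K₂ + 2 * (LF + LP) * KD * C + 2 * KG * C, by positivity, fun t ht => ?_⟩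
  have ht1 : (1:ℝ) ≤ t := by exact_mod_cast (by omega : 1 ≤ t)
  have hα0 := hαp t (by omega)
  have hδ0 := hδp t (by omega)
  have hd : ∀ ω, x t ω ∈ P.dom := fun ω => hP.iterX_mem_dom hne hCl hαp ht ω
  have hd' : ∀ ω, x (t + 1) ω ∈ P.dom := fun ω => hP.iterX_mem_dom hne hCl hαp (by omega) ω
  obtain ⟨iI1, hI1⟩ := hK₁ t ht
  obtain ⟨iI2, hI2⟩ := hK₂ t ht
  obtain ⟨hGL, hG2⟩ := hKG t (by omega)
  have iG := integrable_norm_sq hGL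
  have hFc := hP.F_smooth.1.continuous
  have hQc := hP.Q_smooth.1.continuous
  have hPc : Continuous fun u => penalty Cl (P.Q ν u) := (continuous_penalty hCl).comp hQc
  have iV : ∀ t, 2 ≤ t → Integrable (fun ω => ‖x t ω - xs‖ ^ 2) μ := fun t ht => by
    have hc : Continuous fun u => ‖u - xs‖ ^ 2 := by fun_prop
    exact hP.integrable_comp_iterX hne hCl hαp h hc.measurable (hP.exists_abs_le_of_continuous hc) ht
  have iF : ∀ t, 2 ≤ t → Integrable (fun ω => P.F ν (x t ω)) μ := fun t ht =>
    hP.integrable_comp_iterX hne hCl hαp h hFc.measurable (hP.exists_abs_le_of_continuous hFc) ht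
  have iP : ∀ t, 2 ≤ t → Integrable (fun ω => penalty Cl (P.Q ν (x t ω))) μ := fun t ht =>
    hP.integrable_comp_iterX hne hCl hαp h hPc.measurable (hP.exists_abs_le_of_continuous hPc) ht
  have iR : Integrable (fun ω => P.r (x (t + 1) ω)) μ :=
    hP.integrable_comp_iterX hne hCl hαp h hP.measurable_r hP.exists_abs_r_le (by omega)
  have iF' : ∀ t, 2 ≤ t → Integrable (fun ω => P.F ν (x t ω) - P.F ν xs) μ := fun t ht =>
    (iF t ht).sub (integrable_const _)
  have iR' : Integrable (fun ω => P.r (x (t + 1) ω) - P.r xs) μ := iR.sub (integrable_const _)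
  have iN : MemLp (fun ω => ‖x (t + 1) ω - x t ω‖) 2 μ := by
    have hm : ∀ t, 1 ≤ t → MemLp (x t) 2 μ := fun t ht =>
      memLp_of_bounded (h.measurable_of_history (hE.meas_x t ht)) (hE.bdd_x t ht) 2
    exact ((hm (t + 1) (by omega)).sub (hm t (by omega))).norm
  have iN1 := iN.integrable (by norm_num : (1:ENNReal) ≤ 2)
  -- the increments
  have hD1 : ∫ ω, ‖x (t + 1) ω - x t ω‖ ∂μ ≤ KD * δ t := by
    refine (sq_le_sq₀ (integral_nonneg fun _ => norm_nonneg _) (by positivity)).1 ?_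
    rw [mul_pow, hKD, Real.sq_sqrt (by positivity)]
    exact (sq_integral_le iN).trans (hΔδ t ht)
  -- one step
  set I₁ : Ω → ℝ := fun ω => inner ℝ (gradient P.f (P.iterY Cl α β δ x1 ξ t ω))
    (fderiv ℝ (fun x => P.g x (ξ t ω)) (x t ω) (x t ω - xs)) with hI₁
  set I₂ : Ω → ℝ := fun ω => inner ℝ (P.constraintField Cl (P.iterZ Cl α β δ x1 ξ t ω))
    (fderiv ℝ (fun x => P.h x (ξ t ω)) (x t ω) (x t ω - xs)) with hI₂
  have hpt : ∀ ω, ‖x (t + 1) ω - xs‖ ^ 2 + 2 * α t * (P.r (x (t + 1) ω) - P.r xs)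
      + (2 * α t * I₁ ω + 2 * δ t * I₂ ω) ≤ ‖x t ω - xs‖ ^ 2 + ‖G t ω‖ ^ 2 := by
    intro ω
    have h1 := hP.norm_prox_sub_sq_le hne hα0 (x t ω) (G t ω) hxs
    rw [← iterX_succ hCl (by omega)] at h1
    -- Moving the adjoints to the displacement produces the sampled directional derivatives whose
    -- bias was estimated.
    have h2 : inner ℝ (G t ω) (x t ω - xs) = α t * I₁ ω + δ t * I₂ ω := by
      simp only [hG, direction, inner_add_left, inner_smul_left, conj_trivial,
        ContinuousLinearMap.adjoint_inner_left, hI₁, hI₂, hx]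
    rw [h2] at h1
    linarith
  have hstep : ∫ ω, ‖x (t + 1) ω - xs‖ ^ 2 ∂μ
      + 2 * α t * ∫ ω, (P.r (x (t + 1) ω) - P.r xs) ∂μ
      + (2 * α t * ∫ ω, I₁ ω ∂μ + 2 * δ t * ∫ ω, I₂ ω ∂μ)
      ≤ ∫ ω, ‖x t ω - xs‖ ^ 2 ∂μ + ∫ ω, ‖G t ω‖ ^ 2 ∂μ := by
    have j1 := iV (t + 1) (by omega)
    have j2 := iR'.const_mul (2 * α t)
    have j3 := iI1.const_mul (2 * α t)
    have j4 := iI2.const_mul (2 * δ t)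
    have hmono := integral_mono ((j1.add j2).add (j3.add j4)) ((iV t ht).add iG) hpt
    have s1 := integral_add (j1.add j2) (j3.add j4)
    have s2 := integral_add j1 j2
    have s3 := integral_add j3 j4
    have s4 := integral_add (iV t ht) iG
    simp only [Pi.add_apply, integral_const_mul] at hmono s1 s2 s3 s4
    rw [s1, s2, s3, s4] at hmono
    exact hmono
  -- lower bounds for the directional derivatives
  have hF0 : ∫ ω, (P.F ν (x t ω) - P.F ν xs) ∂μ
      ≤ ∫ ω, inner ℝ (gradient P.f (∫ s, P.g (x t ω) s ∂ν))
        (fderiv ℝ (fun x => ∫ s, P.g x s ∂ν) (x t ω) (x t ω - xs)) ∂μ := by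
    simp only [hP.inner_gradient_f]
    obtain ⟨L, hL⟩ := hP.F_smooth.2
    have hc : Continuous fun u => fderiv ℝ (P.F ν) u (u - xs) :=
      hL.continuous.clm_apply (continuous_id.sub continuous_const)
    refine integral_mono (iF' t ht) (hP.integrable_comp_iterX hne hCl hαp h hc.measurable
      (hP.exists_abs_le_of_continuous hc) ht) fun ω => ?_
    have h1 := hP.F_convex.add_fderiv_le (hP.dom_subset (hd ω)) (hP.dom_subset hxs)
      (hP.F_smooth.1 _)
    rw [← neg_sub (x t ω) xs, map_neg] at h1
    show P.F ν (x t ω) - P.F ν xs ≤ fderiv ℝ (P.F ν) (x t ω) (x t ω - xs)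
    linarith
  have hP0 : ∫ ω, penalty Cl (P.Q ν (x t ω)) ∂μ
      ≤ ∫ ω, inner ℝ (P.constraintField Cl (∫ s, P.h (x t ω) s ∂ν))
        (fderiv ℝ (fun x => ∫ s, P.h x s ∂ν) (x t ω) (x t ω - xs)) ∂μ := by
    simp only [hP.inner_constraintField_mean]
    obtain ⟨L, hL⟩ := hP.Q_smooth.2
    have hcl : Continuous fun u : Eu n => clipVec Cl (P.Q ν u) := by
      have : LipschitzWith 1 (clipVec Cl : Eu J → Eu J) := LipschitzWith.of_dist_le_mul fun v w => by
        rw [dist_eq_norm, dist_eq_norm, NNReal.coe_one, one_mul]; exact norm_clipVec_sub_le _ _ _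
      exact this.continuous.comp hQc
    have hc : Continuous fun u => (inner ℝ (clipVec Cl (P.Q ν u)) (fderiv ℝ (P.Q ν) u (u - xs)) : ℝ) :=
      hcl.inner (hL.continuous.clm_apply (continuous_id.sub continuous_const))
    exact integral_mono (iP t ht) (hP.integrable_comp_iterX hne hCl hαp h hc.measurable
      (hP.exists_abs_le_of_continuous hc) ht) fun ω =>
        penalty_le_inner_clipVec hCl hP.Q_smooth.1 hP.Q_convex (hP.dom_subset (hd ω))
          (hP.dom_subset hxs) hfeas
  -- from the current to the next iterate
  have hF1 : ∫ ω, (P.F ν (x (t + 1) ω) - P.F ν xs) ∂μ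
      ≤ ∫ ω, (P.F ν (x t ω) - P.F ν xs) ∂μ + LF * (KD * δ t) := by
    have hmono := integral_mono (iF' (t + 1) (by omega)) ((iF' t ht).add (iN1.const_mul (LF : ℝ)))
      (fun ω => by
        have := (abs_le.1 ((Real.norm_eq_abs _).symm.trans_le
          (hLF.norm_sub_le (x (t + 1) ω) (x t ω)))).2
        show P.F ν (x (t + 1) ω) - P.F ν xs
          ≤ (P.F ν (x t ω) - P.F ν xs) + LF * ‖x (t + 1) ω - x t ω‖
        linarith)
    have s1 := integral_add (iF' t ht) (iN1.const_mul (LF : ℝ))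
    simp only [Pi.add_apply, integral_const_mul] at hmono s1
    rw [s1] at hmono
    have := mul_le_mul_of_nonneg_left hD1 LF.2
    exact hmono.trans (by gcongr)
  have hP1 : ∫ ω, penalty Cl (P.Q ν (x (t + 1) ω)) ∂μ
      ≤ ∫ ω, penalty Cl (P.Q ν (x t ω)) ∂μ + LP * (KD * δ t) := by
    have hmono := integral_mono (iP (t + 1) (by omega)) ((iP t ht).add (iN1.const_mul LP))
      (fun ω => by
        have h1 := (abs_le.1 (abs_penalty_sub_le hCl (P.Q ν (x (t + 1) ω)) (P.Q ν (x t ω)))).2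
        have h2 := mul_le_mul_of_nonneg_left (hLQ.norm_sub_le (x (t + 1) ω) (x t ω))
          (Real.sqrt_nonneg (J * Cl ^ 2))
        show penalty Cl (P.Q ν (x (t + 1) ω))
          ≤ penalty Cl (P.Q ν (x t ω)) + LP * ‖x (t + 1) ω - x t ω‖
        rw [hLP]
        linarith)
    have s1 := integral_add (iP t ht) (iN1.const_mul LP)
    simp only [Pi.add_apply, integral_const_mul] at hmono s1
    rw [s1] at hmono
    exact hmono.trans (by gcongr)
  have hHsplit : ∫ ω, (P.H ν (x (t + 1) ω) - P.H ν xs) ∂μ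
      = ∫ ω, (P.F ν (x (t + 1) ω) - P.F ν xs) ∂μ + ∫ ω, (P.r (x (t + 1) ω) - P.r xs) ∂μ := by
    rw [← integral_add (iF' (t + 1) (by omega)) iR']
    refine integral_congr_ae (Filter.Eventually.of_forall fun ω => ?_)
    simp only [H, r]
    ring
  have hρ0 := trackingRate_nonneg b c t
  -- As b/2 ≤ c, the step δ is itself O(ρ), so the terms of order δ² are absorbed in δρ.
  have hδρ : δ t ≤ C * trackingRate b c t := by
    rw [hδ]
    gcongr
    unfold trackingRate
    have h1 : (t : ℝ) ^ (-c) ≤ (t : ℝ) ^ (-(b / 2)) :=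
      Real.rpow_le_rpow_of_exponent_le ht1 (by linarith)
    have h2 : 0 ≤ (t : ℝ) ^ (-(2 * c - 2 * b)) := by positivity
    linarith
  rw [hHsplit]
  set ρ := trackingRate b c t
  have hI1' : ∫ ω, (P.F ν (x t ω) - P.F ν xs) ∂μ - K₁ * ρ ≤ ∫ ω, I₁ ω ∂μ := by linarith
  have hI2' : ∫ ω, penalty Cl (P.Q ν (x t ω)) ∂μ - K₂ * ρ ≤ ∫ ω, I₂ ω ∂μ := by linarith
  have hG' : ∫ ω, ‖G t ω‖ ^ 2 ∂μ ≤ KG * (2 * δ t ^ 2) :=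
    hG2.trans (mul_le_mul_of_nonneg_left (hsum t (by omega)) hKG0)
  generalize ∫ ω, I₁ ω ∂μ = i₁ at *
  generalize ∫ ω, I₂ ω ∂μ = i₂ at *
  generalize ∫ ω, ‖G t ω‖ ^ 2 ∂μ = g at *
  generalize ∫ ω, (P.F ν (x t ω) - P.F ν xs) ∂μ = f₀ at *
  generalize ∫ ω, (P.F ν (x (t + 1) ω) - P.F ν xs) ∂μ = f₁ at *
  generalize ∫ ω, penalty Cl (P.Q ν (x t ω)) ∂μ = p₀ at *
  generalize ∫ ω, penalty Cl (P.Q ν (x (t + 1) ω)) ∂μ = p₁ at *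
  generalize ∫ ω, ‖x (t + 1) ω - xs‖ ^ 2 ∂μ = v₁ at *
  generalize ∫ ω, ‖x t ω - xs‖ ^ 2 ∂μ = v₀ at *
  generalize ∫ ω, (P.r (x (t + 1) ω) - P.r xs) ∂μ = r₁ at *
  have hαδt := hαδ t (by omega)
  have q1 : 2 * α t * (f₁ - LF * (KD * δ t) - K₁ * ρ) ≤ 2 * α t * i₁ := by
    gcongr; linarith
  have q2 : 2 * δ t * (p₁ - LP * (KD * δ t) - K₂ * ρ) ≤ 2 * δ t * i₂ := by
    gcongr; linarith
  have q3 : 2 * α t * (LF * (KD * δ t) + K₁ * ρ) ≤ 2 * δ t * (LF * (KD * δ t) + K₁ * ρ) := by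
    gcongr
  have q4 : δ t * δ t ≤ δ t * (C * ρ) := by gcongr
  have q5 := mul_le_mul_of_nonneg_left q4 (by positivity : 0 ≤ 2 * (LF + LP) * KD + 2 * KG)
  linarith

end CompProblem.Assumptions

end Descent

/-! ### Averaging over the window -/

section Window

/-- The indices over which the output averages. -/
def window (T : ℕ) : Finset ℕ := Finset.Icc ((T + 1) / 2) T

theorem one_le_of_mem_window {T t : ℕ} (hT : 1 ≤ T) (ht : t ∈ window T) : 1 ≤ t := by
  have := (Finset.mem_Icc.1 ht).1; omega

theorem window_card_pos {T : ℕ} (hT : 1 ≤ T) : 0 < ((window T).card : ℝ) := by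
  have : 0 < (window T).card := Finset.card_pos.2 ⟨T, Finset.mem_Icc.2 ⟨by omega, le_rfl⟩⟩
  exact_mod_cast this

theorem two_div_mul_window_card_le {T : ℕ} (hT : 1 ≤ T) :
    2 / (T : ℝ) * (window T).card ≤ 3 := by
  have hT0 : (0:ℝ) < T := by exact_mod_cast hT
  have h1 : 2 * (window T).card ≤ 3 * T := by
    rw [window, Nat.card_Icc]; omega
  have h2 : (2:ℝ) * (window T).card ≤ 3 * T := by exact_mod_cast h1
  rw [div_mul_eq_mul_div, div_le_iff₀ hT0]
  exact h2

theorem rpow_le_of_mem_window {T t : ℕ} (hT : 1 ≤ T) (ht : t ∈ window T) {s : ℝ} (hs0 : 0 ≤ s)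
    (hs2 : s ≤ 2) : (t : ℝ) ^ (-s) ≤ 4 * (T : ℝ) ^ (-s) := by
  have hT0 : (0:ℝ) < T := by exact_mod_cast hT
  have h1 : T ≤ 2 * t := by have := (Finset.mem_Icc.1 ht).1; omega
  have h2 : (T : ℝ) / 2 ≤ t := by
    have : (T : ℝ) ≤ 2 * t := by exact_mod_cast h1
    linarith
  calc (t : ℝ) ^ (-s) ≤ ((T : ℝ) / 2) ^ (-s) :=
        Real.rpow_le_rpow_of_nonpos (by positivity) h2 (by linarith)
    _ = (2:ℝ) ^ s * (T : ℝ) ^ (-s) := by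
        rw [Real.div_rpow hT0.le (by norm_num), Real.rpow_neg (by norm_num : (0:ℝ) ≤ 2),
          div_inv_eq_mul, mul_comm]
    _ ≤ 4 * (T : ℝ) ^ (-s) := by
        gcongr
        calc (2:ℝ) ^ s ≤ (2:ℝ) ^ (2:ℝ) := Real.rpow_le_rpow_of_exponent_le (by norm_num) hs2
          _ = 4 := by norm_num

theorem trackingRate_le_of_mem_window {T t : ℕ} (hT : 1 ≤ T) (ht : t ∈ window T) {b c : ℝ}
    (hb0 : 0 ≤ b) (hbc : b ≤ c) (hc : c ≤ 1) : trackingRate b c t ≤ 4 * trackingRate b c T := by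
  unfold trackingRate
  rw [mul_add]
  exact add_le_add (rpow_le_of_mem_window hT ht (by linarith) (by linarith))
    (rpow_le_of_mem_window hT ht (by linarith) (by linarith))

/-- Averaging a telescoping recursion with monotone weights over the window. -/
theorem window_average_le {e w V E : ℕ → ℝ} {D : ℝ} (hw0 : 0 ≤ w 2)
    (hw : ∀ t ≥ 2, w t ≤ w (t + 1)) (hV0 : ∀ t, 0 ≤ V t) (hV : ∀ t ≥ 2, V t ≤ D) {T : ℕ}
    (hT : 3 ≤ T) (hE0 : 0 ≤ E T)
    (he : ∀ t ∈ window T, e t ≤ w t * (V t - V (t + 1)) + E T) :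
    2 / (T : ℝ) * ∑ t ∈ window T, e t ≤ 2 / T * (w T * D) + 3 * E T := by
  have hT0 : (0:ℝ) < T := by exact_mod_cast (by omega : 0 < T)
  -- For T ≥ 3 the window avoids t = 1, where the descent inequality is not available; T = 1, 2 are
  -- covered by boundedness.
  have hm : 2 ≤ (T + 1) / 2 := by omega
  have hwn : ∀ t ≥ 2, 0 ≤ w t := fun t ht => by
    induction t, ht using Nat.le_induction with
    | base => exact hw0
    | succ t ht ih => exact ih.trans (hw t ht)
  have h1 := sum_mul_sub_le_of_monotone (c := w) (V := V) (D := D) (m := (T + 1) / 2) (hwn _ hm)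
    (fun t ht => hw t (by omega)) (fun t ht => hV t (by omega)) T (by omega)
  have h2 : w T * (D - V (T + 1)) ≤ w T * D :=
    mul_le_mul_of_nonneg_left (by linarith [hV0 (T + 1)]) (hwn T (by omega))
  calc _ ≤ 2 / (T : ℝ) * ∑ t ∈ window T, (w t * (V t - V (t + 1)) + E T) := by
        gcongr with t ht; exact he t ht
    _ = 2 / (T : ℝ) * ∑ t ∈ window T, w t * (V t - V (t + 1))
        + (2 / (T : ℝ) * (window T).card) * E T := by
        rw [Finset.sum_add_distrib, Finset.sum_const, nsmul_eq_mul]; ring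
    _ ≤ _ := by
        have := mul_le_mul_of_nonneg_right (two_div_mul_window_card_le (by omega : 1 ≤ T)) hE0
        gcongr
        exact h1.trans h2

end Window

/-! ### Rates and elimination of the auxiliary exponents -/

section Rates

/-- At T = 1, 2 the rate is at least min(1, 2^s), so the uniform bound fits after enlarging the
constant. -/
theorem UpperO.of_bounded {u r : ℕ → ℝ} {s B K : ℝ} (hr : ∀ T : ℕ, 1 ≤ T → (T : ℝ) ^ s ≤ r T)
    (hB : ∀ T : ℕ, 1 ≤ T → u T ≤ B) (hK : ∀ T : ℕ, 3 ≤ T → u T ≤ K * r T) : UpperO u r := by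
  have hr0 : ∀ T : ℕ, 1 ≤ T → 0 ≤ r T := fun T hT =>
    (Real.rpow_nonneg (Nat.cast_nonneg T) s).trans (hr T hT)
  set c := min 1 ((2:ℝ) ^ s) with hc
  have hc0 : 0 < c := lt_min one_pos (by positivity)
  refine ⟨|K| + |B| / c, fun T hT => ?_⟩
  by_cases hT3 : 3 ≤ T
  · calc u T ≤ K * r T := hK T hT3
      _ ≤ (|K| + |B| / c) * r T := by
        have := hr0 T hT
        gcongr
        have : 0 ≤ |B| / c := by positivity
        linarith [le_abs_self K]
  · have h1 : c ≤ r T := by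
      refine le_trans ?_ (hr T hT)
      have : T = 1 ∨ T = 2 := by omega
      rcases this with rfl | rfl
      · simp [hc]
      · simp [hc]
    calc u T ≤ |B| := (hB T hT).trans (le_abs_self B)
      _ = |B| / c * c := by field_simp
      _ ≤ |B| / c * r T := by gcongr
      _ ≤ _ := by
        have := hr0 T hT
        have := mul_nonneg (abs_nonneg K) this
        linarith

theorem UpperO.of_one_le {u r : ℕ → ℝ} {B : ℝ} (hr : ∀ T : ℕ, 1 ≤ T → 1 ≤ r T)
    (hB : ∀ T : ℕ, 1 ≤ T → u T ≤ B) : UpperO u r :=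
  ⟨|B|, fun T hT => (hB T hT).trans <| (le_abs_self B).trans <|
    le_mul_of_one_le_right (abs_nonneg B) (hr T hT)⟩

theorem UpperO.mono {u r r' : ℕ → ℝ} (h : UpperO u r) (h0 : ∀ T, 0 ≤ r T) {M : ℝ}
    (hr : ∀ T : ℕ, 1 ≤ T → r T ≤ M * r' T) : UpperO u r' := by
  obtain ⟨K, hK⟩ := h
  refine ⟨|K| * M, fun T hT => (hK T hT).trans ?_⟩
  calc K * r T ≤ |K| * r T := mul_le_mul_of_nonneg_right (le_abs_self K) (h0 T)
    _ ≤ |K| * (M * r' T) := mul_le_mul_of_nonneg_left (hr T hT) (abs_nonneg K)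
    _ = _ := by ring

theorem rpow_le_rpow_of_le {T : ℕ} (hT : 1 ≤ T) {x y : ℝ} (h : x ≤ y) :
    (T : ℝ) ^ x ≤ (T : ℝ) ^ y :=
  Real.rpow_le_rpow_of_exponent_le (by exact_mod_cast hT) h

/-- A power is dominated by two powers whose exponents have a larger average. -/
theorem rpow_le_add_of_two_mul_le {T : ℕ} (hT : 1 ≤ T) {x y z : ℝ} (h : 2 * x ≤ y + z) :
    (T : ℝ) ^ x ≤ (T : ℝ) ^ y + (T : ℝ) ^ z := by
  have hy : 0 ≤ (T : ℝ) ^ y := by positivity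
  have hz : 0 ≤ (T : ℝ) ^ z := by positivity
  rcases le_total x y with h1 | h1
  · linarith [rpow_le_rpow_of_le hT h1]
  · linarith [rpow_le_rpow_of_le hT (by linarith : x ≤ z)]

/-- The optimality-gap rate after eliminating the auxiliary exponents. -/
noncomputable def reducedGapRate (a b c : ℝ) (T : ℕ) : ℝ :=
  (T : ℝ) ^ (a - 1) + (T : ℝ) ^ (a + 2 * b - 3 * c) + (T : ℝ) ^ (a - c - b / 2)

/-- The constraint-violation rate after eliminating the auxiliary exponents. -/
noncomputable def reducedViolRate (a b c : ℝ) (T : ℕ) : ℝ :=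
  (T : ℝ) ^ ((c - 1) / 2) + (T : ℝ) ^ (b - c) + (T : ℝ) ^ (-b / 4) + (T : ℝ) ^ ((c - a) / 2)

theorem reducedGapRate_nonneg (a b c : ℝ) (T : ℕ) : 0 ≤ reducedGapRate a b c T := by
  unfold reducedGapRate; positivity

theorem reducedViolRate_nonneg (a b c : ℝ) (T : ℕ) : 0 ≤ reducedViolRate a b c T := by
  unfold reducedViolRate; positivity

/-- 2(a+2b-3c) and 2(a-c-b/2) are the sums of d with 2a+4b-6c-d and with 2a-b-2c-d. The remaining
terms only need to be nonnegative. -/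
theorem reducedGapRate_le (a b c d e : ℝ) {T : ℕ} (hT : 1 ≤ T) :
    reducedGapRate a b c T ≤ 2 * gapRate a b c d e T := by
  have h1 : (T : ℝ) ^ (a + 2 * b - 3 * c) ≤ (T : ℝ) ^ d + (T : ℝ) ^ (2 * a + 4 * b - 6 * c - d) :=
    rpow_le_add_of_two_mul_le hT (by linarith)
  have h2 : (T : ℝ) ^ (a - c - b / 2) ≤ (T : ℝ) ^ d + (T : ℝ) ^ (2 * a - b - 2 * c - d) :=
    rpow_le_add_of_two_mul_le hT (by linarith)
  have hp : ∀ x : ℝ, 0 ≤ (T : ℝ) ^ x := fun x => by positivity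
  unfold reducedGapRate gapRate
  linarith [hp (a - 1), hp d, hp (4 * b - 4 * c - d), hp (-b - d),
    hp (2 * a + 4 * b - 6 * c - d), hp (2 * a - b - 2 * c - d), hp (-2 * a), hp (-a - c), hp (-e),
    hp (2 * a - 2 * c - e), hp (e - 2 * a)]

/-- Both b - c and -b/4 are midpoints between (d+c-a)/2 and a term in which d has the opposite sign.
-/
theorem reducedViolRate_le (a b c d e : ℝ) {T : ℕ} (hT : 1 ≤ T) :
    reducedViolRate a b c T ≤ 2 * violRate a b c d e T := by
  have h1 : (T : ℝ) ^ (b - c) ≤ (T : ℝ) ^ ((d + c - a) / 2)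
      + (T : ℝ) ^ ((a + 4 * b - 5 * c - d) / 2) := rpow_le_add_of_two_mul_le hT (by linarith)
  have h2 : (T : ℝ) ^ (-b / 4) ≤ (T : ℝ) ^ ((d + c - a) / 2) + (T : ℝ) ^ ((a - b - c - d) / 2) :=
    rpow_le_add_of_two_mul_le hT (by linarith)
  have hp : ∀ x : ℝ, 0 ≤ (T : ℝ) ^ x := fun x => by positivity
  unfold reducedViolRate violRate
  linarith [hp ((c - 1) / 2), hp ((d + c - a) / 2), hp ((4 * b - 3 * c - d - a) / 2),
    hp ((c - a - b - d) / 2), hp ((a + 4 * b - 5 * c - d) / 2), hp (-a), hp ((a - b - c - d) / 2),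
    hp ((-3 * a + c) / 2), hp ((c - a - e) / 2), hp ((a - c - e) / 2), hp ((e - 3 * a + c) / 2),
    hp ((c - a) / 2)]

theorem reducedGapRate_le_rpow {a b c s : ℝ} (h1 : a - 1 ≤ s) (h2 : a + 2 * b - 3 * c ≤ s)
    (h3 : a - c - b / 2 ≤ s) {T : ℕ} (hT : 1 ≤ T) :
    reducedGapRate a b c T ≤ 3 * (T : ℝ) ^ s := by
  unfold reducedGapRate
  linarith [rpow_le_rpow_of_le hT h1, rpow_le_rpow_of_le hT h2, rpow_le_rpow_of_le hT h3]

theorem reducedViolRate_le_rpow {a b c s : ℝ} (h1 : (c - 1) / 2 ≤ s) (h2 : b - c ≤ s)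
    (h3 : -b / 4 ≤ s) (h4 : (c - a) / 2 ≤ s) {T : ℕ} (hT : 1 ≤ T) :
    reducedViolRate a b c T ≤ 4 * (T : ℝ) ^ s := by
  unfold reducedViolRate
  linarith [rpow_le_rpow_of_le hT h1, rpow_le_rpow_of_le hT h2, rpow_le_rpow_of_le hT h3,
    rpow_le_rpow_of_le hT h4]

end Rates

/-! ### From the iterates to the averaged output -/

section Output

namespace CompProblem.Assumptions

variable {Ω Ξ : Type*} [mΩ : MeasurableSpace Ω] [MeasurableSpace Ξ] {n m p J : ℕ}
  {P : CompProblem n m p J Ξ} {ν : Measure Ξ} {Cl : ℝ} {α β δ : ℕ → ℝ} {x1 : Eu n}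
  {ξ : ℕ → Ω → Ξ} {μ : Measure Ω}

omit mΩ in
theorem output_mem_dom (hP : P.Assumptions ν) (hne : P.dom.Nonempty) (hCl : 0 ≤ Cl)
    (hα : ∀ t, 1 ≤ t → 0 < α t) {T : ℕ} (hT : 1 ≤ T) (ω : Ω) :
    P.output Cl α β δ x1 (fun t => ξ t ω) T ∈ P.dom := by
  have hN := window_card_pos hT
  change ((window T).card : ℝ)⁻¹ • ∑ t ∈ window T, P.iterX Cl α β δ x1 ξ (t + 1) ω ∈ P.dom
  rw [Finset.smul_sum]
  refine hP.r_convexOn.1.sum_mem (fun _ _ => by positivity) ?_ fun t ht =>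
    hP.iterX_mem_dom hne hCl hα (by have := one_le_of_mem_window hT ht; omega) ω
  rw [Finset.sum_const, nsmul_eq_mul, mul_inv_cancel₀ hN.ne']

omit mΩ in
theorem card_mul_output_le (hP : P.Assumptions ν) (hne : P.dom.Nonempty) (hCl : 0 ≤ Cl)
    (hα : ∀ t, 1 ≤ t → 0 < α t) {f : Eu n → ℝ} (hf : ConvexOn ℝ P.dom f) {T : ℕ} (hT : 1 ≤ T)
    (ω : Ω) : (window T).card * f (P.output Cl α β δ x1 (fun t => ξ t ω) T)
      ≤ ∑ t ∈ window T, f (P.iterX Cl α β δ x1 ξ (t + 1) ω) := by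
  have hN := window_card_pos hT
  have h := hf.map_sum_le (t := window T) (w := fun _ => ((window T).card : ℝ)⁻¹)
    (p := fun t => P.iterX Cl α β δ x1 ξ (t + 1) ω) (fun _ _ => by positivity)
    (by rw [Finset.sum_const, nsmul_eq_mul, mul_inv_cancel₀ hN.ne'])
    (fun t ht => hP.iterX_mem_dom hne hCl hα (by have := one_le_of_mem_window hT ht; omega) ω)
  rw [← Finset.smul_sum, ← Finset.smul_sum, smul_eq_mul] at h
  change f (P.output Cl α β δ x1 (fun t => ξ t ω) T) ≤ _ at h
  rw [← div_eq_inv_mul, le_div_iff₀ hN, mul_comm] at h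
  exact h

variable [IsProbabilityMeasure μ]

omit [IsProbabilityMeasure μ] in
theorem measurable_output (hP : P.Assumptions ν) (hne : P.dom.Nonempty) (hCl : 0 ≤ Cl)
    (hα : ∀ t, 1 ≤ t → 0 < α t) (h : IsSample ξ μ ν) (T : ℕ) :
    Measurable fun ω => P.output Cl α β δ x1 (fun t => ξ t ω) T := by
  refine (Finset.measurable_sum (f := fun t ω => P.iterX Cl α β δ x1 ξ (t + 1) ω) (window T)
    fun t ht => ?_).const_smul ((window T).card : ℝ)⁻¹
  exact h.measurable_of_history (hP.measurable_run hne hCl hα (t + 1) (by omega)).1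

theorem integrable_comp_output (hP : P.Assumptions ν) (hne : P.dom.Nonempty) (hCl : 0 ≤ Cl)
    (hα : ∀ t, 1 ≤ t → 0 < α t) (h : IsSample ξ μ ν) {f : Eu n → ℝ} (hf : Measurable f)
    (hb : ∃ B, ∀ x ∈ P.dom, |f x| ≤ B) {T : ℕ} (hT : 1 ≤ T) :
    Integrable (fun ω => f (P.output Cl α β δ x1 (fun t => ξ t ω) T)) μ := by
  obtain ⟨B, hB⟩ := hb
  exact Integrable.of_bound (hf.comp (hP.measurable_output hne hCl hα h T)).aestronglyMeasurable B
    (Filter.Eventually.of_forall fun ω => hB _ (hP.output_mem_dom hne hCl hα hT ω))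

theorem continuous_Q_apply (hP : P.Assumptions ν) (j : Fin J) :
    Continuous fun x => P.Q ν x j :=
  (EuclideanSpace.proj j : Eu J →L[ℝ] ℝ).continuous.comp hP.Q_smooth.1.continuous

variable [IsProbabilityMeasure ν]

theorem outputRegular (hP : P.Assumptions ν) (hne : P.dom.Nonempty) (hCl : 0 ≤ Cl)
    (hα : ∀ t, 1 ≤ t → 0 < α t) (h : IsSample ξ μ ν) :
    P.OutputRegular ν μ fun T ω => P.output Cl α β δ x1 (fun t => ξ t ω) T := by
  obtain ⟨B, -, hB⟩ := hP.exists_abs_H_le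
  exact fun T hT => ⟨fun ω => hP.output_mem_dom hne hCl hα hT ω,
    hP.integrable_comp_output hne hCl hα h hP.measurable_H ⟨B, hB⟩ hT,
    fun j => hP.integrable_comp_output hne hCl hα h (hP.continuous_Q_apply j).measurable
      (hP.exists_abs_le_of_continuous (hP.continuous_Q_apply j)) hT⟩

theorem exists_optGap_le (hP : P.Assumptions ν) {xs : Eu n} (hxs : xs ∈ P.dom) (hCl : 0 ≤ Cl)
    (hα : ∀ t, 1 ≤ t → 0 < α t) (h : IsSample ξ μ ν) :
    ∃ B, ∀ T : ℕ, 1 ≤ T →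
      P.optGap ν μ xs (fun T ω => P.output Cl α β δ x1 (fun t => ξ t ω) T) T ≤ B := by
  obtain ⟨B, hB0, hB⟩ := hP.exists_abs_H_le
  have hne : P.dom.Nonempty := ⟨xs, hxs⟩
  refine ⟨3 * (2 * B), fun T hT => ?_⟩
  have h1 : ∫ ω, (P.H ν (P.output Cl α β δ x1 (fun t => ξ t ω) T) - P.H ν xs) ∂μ ≤ 2 * B := by
    have hI := hP.integrable_comp_output (β := β) (δ := δ) (x1 := x1) hne hCl hα h
      hP.measurable_H ⟨B, hB⟩ hT
    refine (integral_mono (hI.sub (integrable_const _)) (integrable_const (2 * B)) fun ω => ?_).trans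
      (by simp)
    have := (abs_le.1 (hB _ (hP.output_mem_dom (β := β) (δ := δ) (x1 := x1) (ξ := ξ)
      hne hCl hα hT ω))).2
    have := (abs_le.1 (hB _ hxs)).1
    show P.H ν (P.output Cl α β δ x1 (fun t => ξ t ω) T) - P.H ν xs ≤ 2 * B
    linarith
  rw [optGap, Finset.sum_const, nsmul_eq_mul, ← mul_assoc]
  have hN := window_card_pos hT
  have h2 : 0 ≤ 2 / (T : ℝ) * (window T).card := by positivity
  exact (mul_le_mul_of_nonneg_left h1 h2).trans
    (mul_le_mul_of_nonneg_right (two_div_mul_window_card_le hT) (by positivity))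

theorem optGap_le_sum (hP : P.Assumptions ν) {xs : Eu n} (hxs : xs ∈ P.dom) (hCl : 0 ≤ Cl)
    (hα : ∀ t, 1 ≤ t → 0 < α t) (h : IsSample ξ μ ν) {T : ℕ} (hT : 1 ≤ T) :
    P.optGap ν μ xs (fun T ω => P.output Cl α β δ x1 (fun t => ξ t ω) T) T
      ≤ 2 / (T : ℝ) * ∑ t ∈ window T,
        ∫ ω, (P.H ν (P.iterX Cl α β δ x1 ξ (t + 1) ω) - P.H ν xs) ∂μ := by
  obtain ⟨B, hB0, hB⟩ := hP.exists_abs_H_le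
  have hne : P.dom.Nonempty := ⟨xs, hxs⟩
  rw [optGap, Finset.sum_const, nsmul_eq_mul]
  refine mul_le_mul_of_nonneg_left ?_ (by positivity)
  have hI : ∀ t ∈ window T, Integrable
      (fun ω => P.H ν (P.iterX Cl α β δ x1 ξ (t + 1) ω) - P.H ν xs) μ := fun t ht =>
    (hP.integrable_comp_iterX hne hCl hα h hP.measurable_H ⟨B, hB⟩
      (by have := one_le_of_mem_window hT ht; omega)).sub (integrable_const _)
  have hI' := (hP.integrable_comp_output (β := β) (δ := δ) (x1 := x1) hne hCl hα h
    hP.measurable_H ⟨B, hB⟩ hT).sub (integrable_const (P.H ν xs))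
  rw [← integral_finsetSum _ hI]
  change ((window T).card : ℝ) * _ ≤ _
  rw [← integral_const_mul]
  refine integral_mono (hI'.const_mul _) (integrable_finsetSum _ hI) fun ω => ?_
  have h1 := hP.card_mul_output_le (β := β) (δ := δ) (x1 := x1) (ξ := ξ) hne hCl hα
    hP.H_convexOn hT ω
  show (window T).card * (P.H ν (P.output Cl α β δ x1 (fun t => ξ t ω) T) - P.H ν xs)
    ≤ ∑ t ∈ window T, (P.H ν (P.iterX Cl α β δ x1 ξ (t + 1) ω) - P.H ν xs)
  rw [Finset.sum_sub_distrib, Finset.sum_const, nsmul_eq_mul]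
  linarith

omit [IsProbabilityMeasure ν] in
-- Nonnegativity of `B` covers J = 0, where the supremum over no constraints is 0.
theorem violation_le_of_forall (μ : Measure Ω) {T : ℕ} {B : ℝ} (hB0 : 0 ≤ B)
    (hB : ∀ j, 2 / (T : ℝ) * ((window T).card *
      ∫ ω, P.Q ν (P.output Cl α β δ x1 (fun t => ξ t ω) T) j ∂μ) ≤ B) :
    P.violation ν μ (fun T ω => P.output Cl α β δ x1 (fun t => ξ t ω) T) T ≤ B := by
  rw [violation, Finset.sum_const, nsmul_eq_mul]
  change 2 / (T : ℝ) * ((window T).card * _) ≤ B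
  rw [Real.mul_iSup_of_nonneg (by positivity), Real.mul_iSup_of_nonneg (by positivity)]
  exact Real.iSup_le hB hB0

omit [IsProbabilityMeasure ν] in
theorem exists_violation_le (hP : P.Assumptions ν) (hne : P.dom.Nonempty) (hCl : 0 ≤ Cl)
    (hα : ∀ t, 1 ≤ t → 0 < α t) (h : IsSample ξ μ ν)
    (hbound : ∀ x ∈ P.X, ∀ j, P.Q ν x j ≤ Cl) :
    ∃ B, ∀ T : ℕ, 1 ≤ T →
      P.violation ν μ (fun T ω => P.output Cl α β δ x1 (fun t => ξ t ω) T) T ≤ B := by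
  refine ⟨3 * Cl, fun T hT => violation_le_of_forall μ (by positivity) fun j => ?_⟩
  have h1 : ∫ ω, P.Q ν (P.output Cl α β δ x1 (fun t => ξ t ω) T) j ∂μ ≤ Cl := by
    refine (integral_mono (hP.integrable_comp_output hne hCl hα h
      (hP.continuous_Q_apply j).measurable
      (hP.exists_abs_le_of_continuous (hP.continuous_Q_apply j)) hT)
      (integrable_const Cl) fun ω => ?_).trans (by simp)
    exact hbound _ (hP.dom_subset (hP.output_mem_dom hne hCl hα hT ω)) j
  rw [← mul_assoc]
  have hN := window_card_pos hT
  have h2 : 0 ≤ 2 / (T : ℝ) * (window T).card := by positivity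
  exact (mul_le_mul_of_nonneg_left h1 h2).trans
    (mul_le_mul_of_nonneg_right (two_div_mul_window_card_le hT) hCl)

omit [IsProbabilityMeasure ν] in
/-- The expected constraint value at the output, in terms of the penalty along the iterates. -/
theorem card_mul_integral_Q_le (hP : P.Assumptions ν) (hne : P.dom.Nonempty) (hCl : 0 ≤ Cl)
    (hα : ∀ t, 1 ≤ t → 0 < α t) (h : IsSample ξ μ ν)
    (hbound : ∀ x ∈ P.X, ∀ j, P.Q ν x j ≤ Cl) {T : ℕ} (hT : 1 ≤ T) (j : Fin J) {l : ℝ}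
    (hl : 0 < l) :
    (window T).card * ∫ ω, P.Q ν (P.output Cl α β δ x1 (fun t => ξ t ω) T) j ∂μ
      ≤ (window T).card * (l / 2)
        + l⁻¹ * ∑ t ∈ window T, ∫ ω, penalty Cl (P.Q ν (P.iterX Cl α β δ x1 ξ (t + 1) ω)) ∂μ := by
  have hPc : Continuous fun u => penalty Cl (P.Q ν u) :=
    (continuous_penalty hCl).comp hP.Q_smooth.1.continuous
  have hI : ∀ t ∈ window T, Integrable
      (fun ω => penalty Cl (P.Q ν (P.iterX Cl α β δ x1 ξ (t + 1) ω))) μ := fun t ht =>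
    hP.integrable_comp_iterX hne hCl hα h hPc.measurable (hP.exists_abs_le_of_continuous hPc)
      (by have := one_le_of_mem_window hT ht; omega)
  have hI' := (integrable_finsetSum _ hI).const_mul l⁻¹
  have hQ := hP.integrable_comp_output (β := β) (δ := δ) (x1 := x1) hne hCl hα h
    (hP.continuous_Q_apply j).measurable
    (hP.exists_abs_le_of_continuous (hP.continuous_Q_apply j)) hT
  -- The square root in linearized form, q ≤ l/2 + q²/(2l) with l free; on `X` the bound `Cl` keeps
  -- the penalty in its quadratic and zero pieces.
  have hle : ∀ x ∈ P.dom, P.Q ν x j ≤ l / 2 + l⁻¹ * penalty Cl (P.Q ν x) := by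
    intro x hx
    have h1 : huber Cl (P.Q ν x j) ≤ penalty Cl (P.Q ν x) :=
      Finset.single_le_sum (f := fun j => huber Cl (P.Q ν x j))
        (fun i _ => huber_nonneg hCl _) (Finset.mem_univ j)
    rw [huber_of_le (hbound x (hP.dom_subset hx) j)] at h1
    set q := max (P.Q ν x j) 0
    have h2 : P.Q ν x j ≤ q := le_max_left _ _
    have h3 : l⁻¹ * (q ^ 2 / 2) ≤ l⁻¹ * penalty Cl (P.Q ν x) := by gcongr
    have h4 : q ≤ l / 2 + l⁻¹ * (q ^ 2 / 2) := by
      have e : l / 2 + l⁻¹ * (q ^ 2 / 2) - q = l⁻¹ * ((q - l) ^ 2 / 2) := by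
        field_simp; ring
      have : 0 ≤ l⁻¹ * ((q - l) ^ 2 / 2) := by positivity
      linarith
    linarith
  have hmono := integral_mono (hQ.const_mul ((window T).card : ℝ))
    ((integrable_const ((window T).card * (l / 2))).add hI') fun ω => by
      have h1 := hP.card_mul_output_le (β := β) (δ := δ) (x1 := x1) (ξ := ξ) hne hCl hα
        ((hP.Q_convex j).subset hP.dom_subset hP.r_convexOn.1) hT ω
      refine h1.trans ?_
      show _ ≤ (window T).card * (l / 2)
        + l⁻¹ * ∑ t ∈ window T, penalty Cl (P.Q ν (P.iterX Cl α β δ x1 ξ (t + 1) ω))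
      rw [Finset.mul_sum, ← nsmul_eq_mul, ← Finset.sum_const, ← Finset.sum_add_distrib]
      exact Finset.sum_le_sum fun t ht => hle _
        (hP.iterX_mem_dom hne hCl hα (by have := one_le_of_mem_window hT ht; omega) ω)
  have s1 := integral_add (integrable_const ((window T).card * (l / 2))) hI'
  simp only [Pi.add_apply, integral_const_mul, integral_const, probReal_univ, one_smul] at hmono s1
  rw [s1, integral_finsetSum _ hI] at hmono
  exact hmono

variable {a b c C Cb : ℝ}

/-- The descent inequality is divided by 2α_t after discarding the nonnegative penalty term. -/
theorem upperO_optGap (hP : P.Assumptions ν) (hCl : 0 ≤ Cl) (h : IsSample ξ μ ν)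
    {xs : Eu n} (hxs : xs ∈ P.dom) (hfeas : ∀ j, P.Q ν xs j ≤ 0)
    (hC : 0 < C) (hCb : 2 < Cb) (hb : 0 ≤ b) (hc0 : 0 ≤ c) (hc : c ≤ 1) (hca : c ≤ a) :
    UpperO (P.optGap ν μ xs (fun T ω => P.xhat Cl C Cb a b c x1 (fun t => ξ t ω) T))
      (reducedGapRate a b c) := by
  set α : ℕ → ℝ := fun t => C * (t : ℝ) ^ (-a) with hα
  set β : ℕ → ℝ := fun t => Cb * (t : ℝ) ^ (-b) with hβ
  set δ : ℕ → ℝ := fun t => C * (t : ℝ) ^ (-c) with hδ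
  have hαp : ∀ t, 1 ≤ t → 0 < α t := by
    intro t ht
    have : (0:ℝ) < t := by exact_mod_cast ht
    rw [hα]; positivity
  change UpperO (P.optGap ν μ xs (fun T ω => P.output Cl α β δ x1 (fun t => ξ t ω) T)) _
  obtain ⟨B, hB⟩ := hP.exists_optGap_le (β := β) (δ := δ) (x1 := x1) hxs hCl hαp h
  -- The analysis needs 0 < b ≤ c. Otherwise one exponent of the rate is nonnegative and boundedness
  -- is enough.
  by_cases hcase : 0 < b ∧ b ≤ c
  swap
  · refine UpperO.of_one_le (B := B) (fun T hT => ?_) hB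
    have hT1 : (1:ℝ) ≤ T := by exact_mod_cast hT
    have hp : ∀ x : ℝ, 0 ≤ (T : ℝ) ^ x := fun x => by positivity
    unfold reducedGapRate
    rcases hb.eq_or_lt with h0 | h0
    · have := Real.one_le_rpow hT1 (by linarith : 0 ≤ a - c - b / 2)
      linarith [hp (a - 1), hp (a + 2 * b - 3 * c)]
    · have hbc : c < b := not_le.1 fun hcon => hcase ⟨h0, hcon⟩
      have := Real.one_le_rpow hT1 (by linarith : 0 ≤ a + 2 * b - 3 * c)
      linarith [hp (a - 1), hp (a - c - b / 2)]
  obtain ⟨hb0, hbc⟩ := hcase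
  obtain ⟨K, hK0, hK⟩ := hP.exists_expected_descent (x1 := x1) hCl h hxs hfeas (α := α) (β := β)
    (δ := δ) (fun _ => rfl) (fun _ => rfl) (fun _ => rfl) hC hCb hb0 hbc hc hca
  obtain ⟨D, hD⟩ := Metric.isBounded_iff.1 hP.X_compact.isBounded
  have hne : P.dom.Nonempty := ⟨xs, hxs⟩
  set V : ℕ → ℝ := fun t => ∫ ω, ‖P.iterX Cl α β δ x1 ξ t ω - xs‖ ^ 2 ∂μ with hV
  have hV0 : ∀ t, 0 ≤ V t := fun t => integral_nonneg fun _ => by positivity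
  have hVD : ∀ t ≥ 2, V t ≤ D ^ 2 := by
    intro t ht
    have hle : ∀ ω, ‖P.iterX Cl α β δ x1 ξ t ω - xs‖ ^ 2 ≤ D ^ 2 := fun ω => by
      have := hD (hP.dom_subset (hP.iterX_mem_dom (β := β) (δ := δ) (x1 := x1) (ξ := ξ)
        hne hCl hαp ht ω)) (hP.dom_subset hxs)
      rw [dist_eq_norm] at this
      gcongr
    exact (integral_mono_of_nonneg (Filter.Eventually.of_forall fun _ => by positivity)
      (integrable_const (D ^ 2)) (Filter.Eventually.of_forall hle)).trans (by simp)
  set K' := D ^ 2 / C + 3 * (2 * K) with hK'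
  refine UpperO.of_bounded (s := a - 1) (B := B) (K := K') (fun T hT => ?_) hB fun T hT => ?_
  · have hp : ∀ x : ℝ, 0 ≤ (T : ℝ) ^ x := fun x => by positivity
    unfold reducedGapRate
    linarith [hp (a + 2 * b - 3 * c), hp (a - c - b / 2)]
  have hT1 : 1 ≤ T := by omega
  have hT0 : (0:ℝ) < T := by exact_mod_cast hT1
  have hT1' : (1:ℝ) ≤ T := by exact_mod_cast hT1
  refine (hP.optGap_le_sum hxs hCl hαp h hT1).trans ?_
  -- The weight is 1/(2α_t), increasing in t. In `E`, 2K is K/2 times the factor 4 for replacing t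
  -- by T in the tracking rate.
  have hw := window_average_le (w := fun t => (t : ℝ) ^ a / (2 * C)) (V := V) (D := D ^ 2)
    (E := fun T => 2 * K * ((T : ℝ) ^ (a - c) * trackingRate b c T))
    (e := fun t => ∫ ω, (P.H ν (P.iterX Cl α β δ x1 ξ (t + 1) ω) - P.H ν xs) ∂μ)
    (by positivity) (fun t ht => by
      have : (t : ℝ) ≤ (t + 1 : ℕ) := by push_cast; linarith
      have ha : 0 ≤ a := hc0.trans hca
      show (t : ℝ) ^ a / (2 * C) ≤ ((t + 1 : ℕ) : ℝ) ^ a / (2 * C)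
      gcongr) hV0 hVD hT
    (by have := trackingRate_nonneg b c T; positivity) (fun t ht => by
      have ht2 : 2 ≤ t := by have := (Finset.mem_Icc.1 ht).1; omega
      have htT : (t : ℝ) ≤ T := by exact_mod_cast (Finset.mem_Icc.1 ht).2
      have ht0 : (0:ℝ) < t := by exact_mod_cast (by omega : 0 < t)
      have h1 := hK t ht2
      have h2 : 0 ≤ 2 * δ t * ∫ ω, penalty Cl (P.Q ν (P.iterX Cl α β δ x1 ξ (t + 1) ω)) ∂μ := by
        have : 0 ≤ ∫ ω, penalty Cl (P.Q ν (P.iterX Cl α β δ x1 ξ (t + 1) ω)) ∂μ :=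
          integral_nonneg fun _ => penalty_nonneg hCl _
        have : 0 ≤ δ t := by rw [hδ]; positivity
        positivity
      have h3 : δ t = (t : ℝ) ^ (a - c) * α t := by
        simp only [hδ, hα]
        rw [mul_left_comm, ← Real.rpow_add ht0]; congr 2; ring
      have h4 : (t : ℝ) ^ a / (2 * C) * (2 * α t) = 1 := by
        simp only [hα]
        rw [Real.rpow_neg ht0.le]
        field_simp
      show _ ≤ (t : ℝ) ^ a / (2 * C) * (V t - V (t + 1))
        + 2 * K * ((T : ℝ) ^ (a - c) * trackingRate b c T)
      set w := (t : ℝ) ^ a / (2 * C) with hwdef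
      have hw0 : 0 ≤ w := by positivity
      set e := ∫ ω, (P.H ν (P.iterX Cl α β δ x1 ξ (t + 1) ω) - P.H ν xs) ∂μ
      have h5 : 2 * α t * e ≤ (V t - V (t + 1)) + K * (δ t * trackingRate b c t) := by
        linarith
      have h6 := mul_le_mul_of_nonneg_left h5 hw0
      have h7 : w * (2 * α t * e) = e := by rw [← mul_assoc, h4, one_mul]
      have h8 : w * (K * (δ t * trackingRate b c t))
          = K / 2 * ((t : ℝ) ^ (a - c) * trackingRate b c t) := by
        rw [h3]
        linear_combination (K / 2 * ((t : ℝ) ^ (a - c) * trackingRate b c t)) * h4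
      have h9 : (t : ℝ) ^ (a - c) * trackingRate b c t
          ≤ (T : ℝ) ^ (a - c) * (4 * trackingRate b c T) := by
        have := trackingRate_nonneg b c t
        have h10 := trackingRate_le_of_mem_window hT1 ht hb hbc hc
        have h11 : (t : ℝ) ^ (a - c) ≤ (T : ℝ) ^ (a - c) :=
          Real.rpow_le_rpow ht0.le htT (by linarith)
        exact mul_le_mul h11 h10 this (by positivity)
      have h12 := mul_le_mul_of_nonneg_left h9 (by positivity : 0 ≤ K / 2)
      linarith)
  refine hw.trans ?_
  have e1 : 2 / (T : ℝ) * ((T : ℝ) ^ a / (2 * C) * D ^ 2) = D ^ 2 / C * (T : ℝ) ^ (a - 1) := by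
    rw [Real.rpow_sub_one hT0.ne']; field_simp
  have e2 : (T : ℝ) ^ (a - c) * trackingRate b c T
      = (T : ℝ) ^ (a + 2 * b - 3 * c) + (T : ℝ) ^ (a - c - b / 2) := by
    unfold trackingRate
    rw [mul_add, ← Real.rpow_add hT0, ← Real.rpow_add hT0]
    congr 2
    all_goals ring
  simp only [e1, e2]
  unfold reducedGapRate
  have p1 : 0 ≤ (T : ℝ) ^ (a - 1) := by positivity
  have p2 : 0 ≤ (T : ℝ) ^ (a + 2 * b - 3 * c) + (T : ℝ) ^ (a - c - b / 2) := by positivity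
  have p3 : 0 ≤ D ^ 2 / C := by positivity
  rw [hK', add_assoc, mul_add]
  have q1 := mul_nonneg (by positivity : 0 ≤ 3 * (2 * K)) p1
  have q2 := mul_nonneg p3 p2
  linarith

theorem upperO_violation (hP : P.Assumptions ν) (hCl : 0 ≤ Cl)
    (hbound : ∀ x ∈ P.X, ∀ j, P.Q ν x j ≤ Cl) (h : IsSample ξ μ ν)
    {xs : Eu n} (hxs : xs ∈ P.dom) (hfeas : ∀ j, P.Q ν xs j ≤ 0)
    (hC : 0 < C) (hCb : 2 < Cb) (ha : a ≤ 1) (hb : 0 ≤ b) (hc0 : 0 ≤ c) (hc : c ≤ 1)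
    (hca : c ≤ a) :
    UpperO (P.violation ν μ (fun T ω => P.xhat Cl C Cb a b c x1 (fun t => ξ t ω) T))
      (reducedViolRate a b c) := by
  set α : ℕ → ℝ := fun t => C * (t : ℝ) ^ (-a) with hα
  set β : ℕ → ℝ := fun t => Cb * (t : ℝ) ^ (-b) with hβ
  set δ : ℕ → ℝ := fun t => C * (t : ℝ) ^ (-c) with hδ
  have hαp : ∀ t, 1 ≤ t → 0 < α t := by
    intro t ht
    have : (0:ℝ) < t := by exact_mod_cast ht
    rw [hα]; positivity
  have hne : P.dom.Nonempty := ⟨xs, hxs⟩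
  change UpperO (P.violation ν μ (fun T ω => P.output Cl α β δ x1 (fun t => ξ t ω) T)) _
  obtain ⟨B, hB⟩ := hP.exists_violation_le (β := β) (δ := δ) (x1 := x1) hne hCl hαp h hbound
  by_cases hcase : 0 < b ∧ b ≤ c
  swap
  · refine UpperO.of_one_le (B := B) (fun T hT => ?_) hB
    have hT1 : (1:ℝ) ≤ T := by exact_mod_cast hT
    have hp : ∀ x : ℝ, 0 ≤ (T : ℝ) ^ x := fun x => by positivity
    unfold reducedViolRate
    rcases hb.eq_or_lt with h0 | h0
    · have := Real.one_le_rpow hT1 (by linarith : 0 ≤ -b / 4)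
      linarith [hp ((c - 1) / 2), hp (b - c), hp ((c - a) / 2)]
    · have hbc : c < b := not_le.1 fun hcon => hcase ⟨h0, hcon⟩
      have := Real.one_le_rpow hT1 (by linarith : 0 ≤ b - c)
      linarith [hp ((c - 1) / 2), hp (-b / 4), hp ((c - a) / 2)]
  obtain ⟨hb0, hbc⟩ := hcase
  obtain ⟨K, hK0, hK⟩ := hP.exists_expected_descent (x1 := x1) hCl h hxs hfeas (α := α) (β := β)
    (δ := δ) (fun _ => rfl) (fun _ => rfl) (fun _ => rfl) hC hCb hb0 hbc hc hca
  obtain ⟨D, hD⟩ := Metric.isBounded_iff.1 hP.X_compact.isBounded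
  obtain ⟨BH, hBH0, hBH⟩ := hP.exists_abs_H_le
  set V : ℕ → ℝ := fun t => ∫ ω, ‖P.iterX Cl α β δ x1 ξ t ω - xs‖ ^ 2 ∂μ with hV
  have hV0 : ∀ t, 0 ≤ V t := fun t => integral_nonneg fun _ => by positivity
  have hVD : ∀ t ≥ 2, V t ≤ D ^ 2 := by
    intro t ht
    have hle : ∀ ω, ‖P.iterX Cl α β δ x1 ξ t ω - xs‖ ^ 2 ≤ D ^ 2 := fun ω => by
      have := hD (hP.dom_subset (hP.iterX_mem_dom (β := β) (δ := δ) (x1 := x1) (ξ := ξ)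
        hne hCl hαp ht ω)) (hP.dom_subset hxs)
      rw [dist_eq_norm] at this
      gcongr
    exact (integral_mono_of_nonneg (Filter.Eventually.of_forall fun _ => by positivity)
      (integrable_const (D ^ 2)) (Filter.Eventually.of_forall hle)).trans (by simp)
  -- Iterates may violate the constraints, so H may drop below H(xs). Only the uniform bound is
  -- available, and dividing by δ it costs α/δ = t^{c-a}.
  have hHlow : ∀ t, 2 ≤ t →
      -(2 * BH) ≤ ∫ ω, (P.H ν (P.iterX Cl α β δ x1 ξ (t + 1) ω) - P.H ν xs) ∂μ := by
    intro t ht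
    have hI := (hP.integrable_comp_iterX (β := β) (δ := δ) (x1 := x1) hne hCl hαp h
      hP.measurable_H ⟨BH, hBH⟩ (by omega : 2 ≤ t + 1)).sub (integrable_const (P.H ν xs))
    refine le_trans (by simp) (integral_mono (integrable_const (-(2 * BH))) hI fun ω => ?_)
    have h1 := (abs_le.1 (hBH _ (hP.iterX_mem_dom (β := β) (δ := δ) (x1 := x1) (ξ := ξ)
      hne hCl hαp (by omega : 2 ≤ t + 1) ω))).1
    have h2 := (abs_le.1 (hBH _ hxs)).2
    show -(2 * BH) ≤ P.H ν (P.iterX Cl α β δ x1 ξ (t + 1) ω) - P.H ν xs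
    linarith
  set K' := D ^ 2 / C + 3 * (2 * K + 8 * BH) with hK'
  have hK'0 : 0 ≤ K' := by positivity
  refine UpperO.of_bounded (s := (c - 1) / 2) (B := B) (K := 3 / 2 + K') (fun T hT => ?_) hB
    fun T hT => ?_
  · have hp : ∀ x : ℝ, 0 ≤ (T : ℝ) ^ x := fun x => by positivity
    unfold reducedViolRate
    linarith [hp (b - c), hp (-b / 4), hp ((c - a) / 2)]
  have hT1 : 1 ≤ T := by omega
  have hT0 : (0:ℝ) < T := by exact_mod_cast hT1
  -- The Young parameter is the target rate: the penalty average is at most K' l², so both halves of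
  -- the estimate are O(l).
  set l := reducedViolRate a b c T with hl
  have hl0 : 0 < l := by rw [hl]; unfold reducedViolRate; positivity
  refine violation_le_of_forall μ (by positivity) fun j => ?_
  have hw := window_average_le (w := fun t => (t : ℝ) ^ c / (2 * C)) (V := V) (D := D ^ 2)
    (E := fun T => 2 * K * trackingRate b c T + 8 * BH * (T : ℝ) ^ (c - a))
    (e := fun t => ∫ ω, penalty Cl (P.Q ν (P.iterX Cl α β δ x1 ξ (t + 1) ω)) ∂μ)
    (by positivity) (fun t ht => by
      have : (t : ℝ) ≤ (t + 1 : ℕ) := by push_cast; linarith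
      show (t : ℝ) ^ c / (2 * C) ≤ ((t + 1 : ℕ) : ℝ) ^ c / (2 * C)
      gcongr) hV0 hVD hT
    (by have := trackingRate_nonneg b c T; positivity) (fun t ht => by
      have ht2 : 2 ≤ t := by have := (Finset.mem_Icc.1 ht).1; omega
      have ht0 : (0:ℝ) < t := by exact_mod_cast (by omega : 0 < t)
      have h1 := hK t ht2
      have h3 : α t = (t : ℝ) ^ (c - a) * δ t := by
        simp only [hδ, hα]
        rw [mul_left_comm, ← Real.rpow_add ht0]; congr 2; ring
      have h4 : (t : ℝ) ^ c / (2 * C) * (2 * δ t) = 1 := by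
        simp only [hδ]
        rw [Real.rpow_neg ht0.le]
        field_simp
      show _ ≤ (t : ℝ) ^ c / (2 * C) * (V t - V (t + 1))
        + (2 * K * trackingRate b c T + 8 * BH * (T : ℝ) ^ (c - a))
      set w := (t : ℝ) ^ c / (2 * C) with hwdef
      have hw0 : 0 ≤ w := by positivity
      set e := ∫ ω, penalty Cl (P.Q ν (P.iterX Cl α β δ x1 ξ (t + 1) ω)) ∂μ
      have h2 := mul_le_mul_of_nonneg_left (hHlow t ht2)
        (by have := hαp t (by omega); positivity : 0 ≤ 2 * α t)
      have h5 : 2 * δ t * e ≤ (V t - V (t + 1)) + K * (δ t * trackingRate b c t)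
          + 2 * α t * (2 * BH) := by
        linarith
      have h6 := mul_le_mul_of_nonneg_left h5 hw0
      have h7 : w * (2 * δ t * e) = e := by rw [← mul_assoc, h4, one_mul]
      have h8 : w * (K * (δ t * trackingRate b c t)) = K / 2 * trackingRate b c t := by
        linear_combination (K / 2 * trackingRate b c t) * h4
      have h9 : w * (2 * α t * (2 * BH)) = 2 * BH * (t : ℝ) ^ (c - a) := by
        rw [h3]
        linear_combination (2 * BH * (t : ℝ) ^ (c - a)) * h4
      have h10 := trackingRate_le_of_mem_window hT1 ht hb hbc hc
      have h11 := rpow_le_of_mem_window hT1 ht (s := a - c) (by linarith) (by linarith)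
      rw [neg_sub] at h11
      have h12 := mul_le_mul_of_nonneg_left h10 (by positivity : 0 ≤ K / 2)
      have h13 := mul_le_mul_of_nonneg_left h11 (by positivity : 0 ≤ 2 * BH)
      linarith)
  have e1 : 2 / (T : ℝ) * ((T : ℝ) ^ c / (2 * C) * D ^ 2) = D ^ 2 / C * (T : ℝ) ^ (c - 1) := by
    rw [Real.rpow_sub_one hT0.ne']; field_simp
  have hsq : ∀ x y : ℝ, 2 * y = x → (T : ℝ) ^ y ≤ l → (T : ℝ) ^ x ≤ l ^ 2 := by
    intro x y hxy hy
    have : (T : ℝ) ^ x = ((T : ℝ) ^ y) ^ 2 := by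
      rw [← Real.rpow_natCast, ← Real.rpow_mul hT0.le]
      congr 1; push_cast; linarith
    rw [this]
    gcongr
  have hp : ∀ x : ℝ, 0 ≤ (T : ℝ) ^ x := fun x => by positivity
  have l1 : (T : ℝ) ^ (c - 1) ≤ l ^ 2 := hsq _ ((c - 1) / 2) (by ring) (by
    rw [hl]; unfold reducedViolRate; linarith [hp (b - c), hp (-b / 4), hp ((c - a) / 2)])
  have l2 : (T : ℝ) ^ (c - a) ≤ l ^ 2 := hsq _ ((c - a) / 2) (by ring) (by
    rw [hl]; unfold reducedViolRate; linarith [hp (b - c), hp (-b / 4), hp ((c - 1) / 2)])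
  have l3 : trackingRate b c T ≤ l ^ 2 := by
    have : trackingRate b c T ≤ ((T : ℝ) ^ (b - c) + (T : ℝ) ^ (-b / 4)) ^ 2 := by
      have r1 : (T : ℝ) ^ (-(2 * c - 2 * b)) = ((T : ℝ) ^ (b - c)) ^ 2 := by
        rw [← Real.rpow_natCast, ← Real.rpow_mul hT0.le]
        congr 1; push_cast; ring
      have r2 : (T : ℝ) ^ (-(b / 2)) = ((T : ℝ) ^ (-b / 4)) ^ 2 := by
        rw [← Real.rpow_natCast, ← Real.rpow_mul hT0.le]
        congr 1; push_cast; ring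
      unfold trackingRate
      rw [r1, r2]
      nlinarith [mul_nonneg (hp (b - c)) (hp (-b / 4))]
    refine this.trans (pow_le_pow_left₀ (add_nonneg (hp _) (hp _)) ?_ 2)
    rw [hl]; unfold reducedViolRate; linarith [hp ((c - 1) / 2), hp ((c - a) / 2)]
  have hsum : 2 / (T : ℝ) * ∑ t ∈ window T,
      ∫ ω, penalty Cl (P.Q ν (P.iterX Cl α β δ x1 ξ (t + 1) ω)) ∂μ ≤ K' * l ^ 2 := by
    refine hw.trans ?_
    simp only [e1]
    have m1 := mul_le_mul_of_nonneg_left l1 (by positivity : 0 ≤ D ^ 2 / C)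
    have m2 := mul_le_mul_of_nonneg_left l2 (by positivity : 0 ≤ 8 * BH)
    have m3 := mul_le_mul_of_nonneg_left l3 (by positivity : 0 ≤ 2 * K)
    rw [hK']
    linarith
  have hQ := mul_le_mul_of_nonneg_left
    (hP.card_mul_integral_Q_le (β := β) (δ := δ) (x1 := x1) hne hCl hαp h hbound hT1 j hl0)
    (by positivity : 0 ≤ 2 / (T : ℝ))
  refine hQ.trans ?_
  have n1 := mul_le_mul_of_nonneg_right (two_div_mul_window_card_le hT1)
    (by positivity : 0 ≤ l / 2)
  have n2 := mul_le_mul_of_nonneg_left hsum (by positivity : 0 ≤ l⁻¹)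
  have n3 : l⁻¹ * (K' * l ^ 2) = K' * l := by field_simp
  rw [n3] at n2
  linarith

end CompProblem.Assumptions

end Output

/-! ### The theorem -/

theorem theorem1 {n m p J : ℕ} {Ξ Ω : Type*} [MeasurableSpace Ξ] [MeasurableSpace Ω]
    (P : CompProblem n m p J Ξ) (ν : Measure Ξ) [IsProbabilityMeasure ν]
    (hP : P.Assumptions ν)
    (μ : Measure Ω) [IsProbabilityMeasure μ] (ξ : ℕ → Ω → Ξ)
    (hξ_meas : ∀ t, Measurable (ξ t)) (hξ_law : ∀ t, μ.map (ξ t) = ν) (hξ_indep : iIndepFun ξ μ)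
    (Cl : ℝ) (hCl : 0 ≤ Cl) (hCl_bound : ∀ x ∈ P.X, ∀ j, P.Q ν x j ≤ Cl)
    (x1 xs : Eu n) (hxs : P.IsSolution ν xs)
    (C Cb : ℝ) (hC : 0 < C) (hCb : 2 < Cb) :
    (∀ a b c d e : ℝ, 0 ≤ a → a ≤ 1 → 0 ≤ b → b ≤ 1 → 0 ≤ c → c ≤ 1 → c ≤ a →
      P.OutputRegular ν μ (fun T ω => P.xhat Cl C Cb a b c x1 (fun t => ξ t ω) T) ∧
      UpperO (P.optGap ν μ xs (fun T ω => P.xhat Cl C Cb a b c x1 (fun t => ξ t ω) T))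
        (gapRate a b c d e) ∧
      UpperO (P.violation ν μ (fun T ω => P.xhat Cl C Cb a b c x1 (fun t => ξ t ω) T))
        (violRate a b c d e)) ∧
    (UpperO (P.optGap ν μ xs
        (fun T ω => P.xhat Cl C Cb (19 / 21) (4 / 7) (5 / 7) x1 (fun t => ξ t ω) T))
        (fun T => (T : ℝ) ^ (-(2 / 21) : ℝ)) ∧
      UpperO (P.violation ν μ
        (fun T ω => P.xhat Cl C Cb (19 / 21) (4 / 7) (5 / 7) x1 (fun t => ξ t ω) T))
        (fun T => (T : ℝ) ^ (-(2 / 21) : ℝ))) ∧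
    (UpperO (P.optGap ν μ xs
        (fun T ω => P.xhat Cl C Cb (6 / 7) (4 / 7) (5 / 7) x1 (fun t => ξ t ω) T))
        (fun T => (T : ℝ) ^ (-(1 / 7) : ℝ)) ∧
      UpperO (P.violation ν μ
        (fun T ω => P.xhat Cl C Cb (6 / 7) (4 / 7) (5 / 7) x1 (fun t => ξ t ω) T))
        (fun T => (T : ℝ) ^ (-(1 / 14) : ℝ))) ∧
    (UpperO (P.optGap ν μ xs
        (fun T ω => P.xhat Cl C Cb (5 / 7) (4 / 7) (5 / 7) x1 (fun t => ξ t ω) T))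
        (fun T => (T : ℝ) ^ (-(2 / 7) : ℝ)) ∧
      UpperO (P.violation ν μ
        (fun T ω => P.xhat Cl C Cb (5 / 7) (4 / 7) (5 / 7) x1 (fun t => ξ t ω) T))
        (fun _ => 1)) := by
  have hS : IsSample ξ μ ν := ⟨hξ_meas, hξ_law, hξ_indep⟩
  have hd : xs ∈ P.dom := hxs.2.1
  have hfeas : ∀ j, P.Q ν xs j ≤ 0 := hxs.2.2.1
  have gap : ∀ a b c : ℝ, 0 ≤ b → 0 ≤ c → c ≤ 1 → c ≤ a →
      UpperO (P.optGap ν μ xs (fun T ω => P.xhat Cl C Cb a b c x1 (fun t => ξ t ω) T))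
        (reducedGapRate a b c) := fun a b c hb hc0 hc hca =>
    hP.upperO_optGap hCl hS hd hfeas hC hCb hb hc0 hc hca
  have viol : ∀ a b c : ℝ, a ≤ 1 → 0 ≤ b → 0 ≤ c → c ≤ 1 → c ≤ a →
      UpperO (P.violation ν μ (fun T ω => P.xhat Cl C Cb a b c x1 (fun t => ξ t ω) T))
        (reducedViolRate a b c) := fun a b c ha hb hc0 hc hca =>
    hP.upperO_violation hCl hCl_bound hS hd hfeas hC hCb ha hb hc0 hc hca
  refine ⟨fun a b c d e _ ha hb _ hc0 hc hca => ⟨?_, ?_, ?_⟩, ⟨?_, ?_⟩, ⟨?_, ?_⟩, ⟨?_, ?_⟩⟩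
  · refine hP.outputRegular ⟨xs, hd⟩ hCl (fun t ht => ?_) hS
    have : (0:ℝ) < t := by exact_mod_cast ht
    positivity
  · exact (gap a b c hb hc0 hc hca).mono (reducedGapRate_nonneg a b c)
      fun T hT => reducedGapRate_le a b c d e hT
  · exact (viol a b c ha hb hc0 hc hca).mono (reducedViolRate_nonneg a b c)
      fun T hT => reducedViolRate_le a b c d e hT
  -- With b = 4/7 and c = 5/7 the first three violation exponents equal -1/7 and all gap exponents
  -- equal a - 1. Only a remains, trading a - 1 against (c - a)/2; they agree at a = 19/21.
  · exact (gap _ _ _ (by norm_num) (by norm_num) (by norm_num) (by norm_num)).mono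
      (reducedGapRate_nonneg _ _ _)
      fun T hT => reducedGapRate_le_rpow (by norm_num) (by norm_num) (by norm_num) hT
  · exact (viol _ _ _ (by norm_num) (by norm_num) (by norm_num) (by norm_num) (by norm_num)).mono
      (reducedViolRate_nonneg _ _ _)
      fun T hT => reducedViolRate_le_rpow (by norm_num) (by norm_num) (by norm_num) (by norm_num) hT
  · exact (gap _ _ _ (by norm_num) (by norm_num) (by norm_num) (by norm_num)).mono
      (reducedGapRate_nonneg _ _ _)
      fun T hT => reducedGapRate_le_rpow (by norm_num) (by norm_num) (by norm_num) hT
  · exact (viol _ _ _ (by norm_num) (by norm_num) (by norm_num) (by norm_num) (by norm_num)).mono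
      (reducedViolRate_nonneg _ _ _)
      fun T hT => reducedViolRate_le_rpow (by norm_num) (by norm_num) (by norm_num) (by norm_num) hT
  · exact (gap _ _ _ (by norm_num) (by norm_num) (by norm_num) (by norm_num)).mono
      (reducedGapRate_nonneg _ _ _)
      fun T hT => reducedGapRate_le_rpow (by norm_num) (by norm_num) (by norm_num) hT
  · refine (viol _ _ _ (by norm_num) (by norm_num) (by norm_num) (by norm_num) (by norm_num)).mono
      (reducedViolRate_nonneg _ _ _) (M := 4) fun T hT => ?_
    -- For a = c the exponent (c - a)/2 vanishes, hence s = 0 and the constant rate.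
    simpa using reducedViolRate_le_rpow (a := 5 / 7) (b := 4 / 7) (c := 5 / 7) (s := 0)
      (by norm_num) (by norm_num) (by norm_num) (by norm_num) hT
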